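/- **Setup.** Let $T\ge 1$ and let $\omega$ be a primitive $T$-th root of unity. Let $\mathfrak g$ be a finite-dimensional complex Lie algebra with a linear automorphism $\sigma$ and an antilinear automorphism $\tau$ satisfying $\sigma^T=\tau^2=(\sigma\tau)^2=\mathrm{id}$, and with a nondegenerate symmetric invariant bilinear form such that $\langle\sigma x,\sigma y\rangle=\langle x,y\rangle$ and $\langle\tau x,\tau y\rangle=\overline{\langle x,y\rangle}$. Let $\tilde{\mathfrak g}=\mathfrak g[t,t^{-1}]\oplus\mathbb C K\oplus\mathbb C D$ with $K$ central, $[x_m,y_n]=[x,y]_{m+n}+m\,\delta_{m+n,0}\langle x,y\rangle K$ and $[D,x_n]=n\,x_n$, where $x_n=x\otimes t^n$. The automorphisms are extended by $\sigma x_n=(\sigma x)_n$, $\sigma K=K$, $\sigma D=D$, $\tau x_n=(\tau x)_{-n}$, $\tau K=-K$, $\tau D=-D$. Put $\mathsf F_n\tilde{\mathfrak g}=\mathfrak g\otimes t^n\mathbb C[t]$ and $\overline{\mathsf F}_n\tilde{\mathfrak g}=\mathfrak g\otimes t^{-n}\mathbb C[t^{-1}]$ $(n\ge 0)$. Let $\pi_{(j)}=\frac1T\sum_{k=0}^{T-1}\omega^{-kj}\sigma^k$.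 The dihedral group $\Pi$ acts on $\mathbb P^1$ by $s: z\mapsto\omega z$ and $t: z\mapsto\bar z$. Let $\mathcal D=\sum_{x\in\boldsymbol z}n_x x$ with $n_x\ge1$, where $\boldsymbol z\subset\mathbb P^1$ is finite, contains $\infty$, and its distinct points have disjoint $\Pi$-orbits. Let $\boldsymbol z_{\rm c}\subset\boldsymbol z$ be the set of points fixed by no $s^kt$. To $x\ne\infty$ attach $\mathcal T_x=\tilde{\mathfrak g}\otimes\mathbb C[\varepsilon]/\varepsilon^{n_x}$ and to $\infty$ attach $\mathcal T_\infty=\tilde{\mathfrak g}\otimes\varepsilon\mathbb C[\varepsilon]/\varepsilon^{n_\infty}$. An element $s^k$ of the stabiliser $\Pi_x$ acts on $\mathcal T_x$ by $X\varepsilon^p\mapsto\omega^{-kp}\sigma^kX\varepsilon^p$ (by $\omega^{kp}$ instead of $\omega^{-kp}$ at $\infty$), and $s^kt\in\Pi_x$ by $X\varepsilon^p\mapsto\omega^{-kp}\sigma^k\tau X\,\varepsilon^p$ (with $\omega^{kp}$ at $\infty$). Let $\tilde{\mathfrak g}^{\mathcal D}=\bigoplus_{x\in\boldsymbol z}\mathcal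 T_x^{\Pi_x}$, a real Lie algebra, and let $L=\tilde{\mathfrak g}^{\mathcal D}\otimes_{\mathbb R}\mathbb C$, with complex conjugation $c$. For $x\in\boldsymbol z_{\rm c}$ and $Y\in\mathcal T_x$ put $Y^{(x)}=\frac12\big(Y\otimes1-iY\otimes i\big)$ and $Y^{(\bar x)}=\frac12\big(Y\otimes1+iY\otimes i\big)$. For $x\notin\boldsymbol z_{\rm c}$ let $w$ be the action of $s^kt\in\Pi_x$ with the least $k\ge0$, and, for $Y\in\mathcal T_x$ invariant under the rotations in $\Pi_x$, put $Y^{(x)}=\frac12\big((Y+wY)\otimes1-i(Y-wY)\otimes i\big)$. Write $X^{(x)}_p=(X\varepsilon^p)^{(x)}$, and similarly for $\bar x$. Let $\mathsf F_nL$ be the span of all $Y^{(x)}$ with $Y\in\mathcal T_x$ rotation-invariant with coefficients in $\mathsf F_n\tilde{\mathfrak g}$, together with all $Y^{(\bar x)}$, $x\in\boldsymbol z_{\rm c}$, with coefficients of $Y$ in $\overline{\mathsf F}_n\tilde{\mathfrak g}$. Let $S=S(L)$ be the symmetric algebra with the Poisson bracket extending the Lie bracket of $L$, let $\mathsf F_nS=(\mathsf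 F_nL)S\cap c(\mathsf F_nL)S$, and let $\hat S=\varprojlim S/\mathsf F_nS$. Let $\mathfrak F$ be the completion of $\tilde{\mathfrak g}\otimes L$ with respect to $\mathsf F_n\tilde{\mathfrak g}\otimes c(\mathsf F_nL)+\overline{\mathsf F}_n\tilde{\mathfrak g}\otimes\mathsf F_nL$. Let $I^a,I_a$ be dual bases of $\mathfrak g$, and let $\sum_{\tilde a}I_{\tilde a}\otimes I^{\tilde a}=D\otimes K+K\otimes D+\sum_{n\in\mathbb Z}\sum_aI_{a,-n}\otimes I^a_n$. The formal Lax matrix is $$\mathcal L(z)=\frac1T\sum_{k=0}^{T-1}\sum_{x}\sum_{p<n_x}\frac{\omega^{-k}\sigma^kA^x_p}{(\omega^{-k}z-x)^{p+1}}+\sum_{p<n_0}\frac{A^0_p}{z^{p+1}}-\sum_{q=0}^{n_\infty-2}A^\infty_{q+1}z^q .$$ Here $x$ runs over $(\boldsymbol z\setminus\{0,\infty\})\cup\overline{\boldsymbol z_{\rm c}}$ with $n_{\bar x}=n_x$, the second sum is absent if $0\notin\boldsymbol z$, $\sigma$ acts on the first tensor factor, and $A^x_p=\sum I_{\tilde a}\otimes(I^{\tilde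 a})^{(x)}_p$, $A^{\bar x}_p=\sum\tau I_{\tilde a}\otimes(I^{\tilde a})^{(\bar x)}_p$, $A^0_p=\sum I_{\tilde a}\otimes(\pi_{(p)}I^{\tilde a})^{(0)}_p$, $A^\infty_{q+1}=\sum I_{\tilde a}\otimes(\pi_{(-q-1)}I^{\tilde a})^{(\infty)}_{q+1}$. The formal constraint is $\mathcal C=-\operatorname{res}_{z=\infty}\mathcal L(z)\,dz\in\mathfrak F$, where $\operatorname{res}_\infty dz/z=-1$. Let $I^\alpha,I_\alpha$ be bases of the real Lie algebra $\{x\in\mathfrak g:\sigma x=\tau x=x\}$ with $\langle I^\alpha,I_\beta\rangle=\delta^\alpha_\beta$, and define $f^{\alpha\beta}{}_\gamma$ by $[I^\alpha,I^\beta]=\sum_\gamma f^{\alpha\beta}{}_\gamma I^\gamma$. Define $$\mathcal K=-i\sum_{x\in\boldsymbol z\setminus\{\infty\}}K^{(x)}_0+i\sum_{x\in\boldsymbol z_{\rm c}}K^{(\bar x)}_0,\qquad \mathcal P=-i\sum_{x\in\boldsymbol z\setminus\{\infty\}}D^{(x)}_0+i\sum_{x\in\boldsymbol z_{\rm c}}D^{(\bar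 x)}_0,$$ $$\mathcal C^\alpha_n=\sum_{x\in\boldsymbol z\setminus\{\infty\}}(I^\alpha_n)^{(x)}_0+\sum_{x\in\boldsymbol z_{\rm c}}(I^\alpha_{-n})^{(\bar x)}_0 .$$ Let $J_{\mathcal C}\subset S$ be the ideal generated by $\mathcal K$ and all $\mathcal C^\alpha_n$, and let $\hat J_{\mathcal C}=\varprojlim J_{\mathcal C}/(J_{\mathcal C}\cap\mathsf F_nS)\subset\hat S$. **Proposition.** The Poisson bracket of $S$ extends by continuity to $\hat S$. The elements $\mathcal K$, $\mathcal P$, $\mathcal C^\alpha_n$ are the modes of the formal constraint: $$\mathcal C=D\otimes i\mathcal K+K\otimes i\mathcal P+\sum_{n\in\mathbb Z}\sum_\alpha I_{\alpha,-n}\otimes\mathcal C^\alpha_n .$$ The element $\mathcal K$ is central in $\hat S$, and $$\{\mathcal P,\mathcal C^\alpha_n\}=-in\,\mathcal C^\alpha_n,\qquad \{\mathcal C^\alpha_m,\mathcal C^\beta_n\}=\sum_\gamma f^{\alpha\beta}{}_\gamma\,\mathcal C^\gamma_{m+n}+i\,m\,\langle I^\alpha,I^\beta\rangle\,\delta_{m+n,0}\,\mathcal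 K .$$ The ideal $\hat J_{\mathcal C}\subset\hat S$ is a Poisson subalgebra, $\{\hat J_{\mathcal C},\hat J_{\mathcal C}\}\subset\hat J_{\mathcal C}$; that is, the set of constraints $\mathcal K\approx0$, $\mathcal C^\alpha_n\approx0$ is first class. -/

import Mathlib

open scoped TensorProduct ComplexConjugate
noncomputable section

namespace AffineGaudin

/-- A complex Lie algebra with an action of the dihedral group of order `2 T` by a linear
automorphism `σ` and an antilinear automorphism `τ`, and a compatible nondegenerate invariant
symmetric bilinear form. The parameter `ω` is the chosen primitive `T`-th root of unity. -/
structure DihedralData (T : ℕ) (ω : ℂ) (𝔤 : Type*) [LieRing 𝔤] [LieAlgebra ℂ 𝔤] where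
  σ : 𝔤 →ₗ⁅ℂ⁆ 𝔤
  τ : 𝔤 →ₛₗ[starRingEnd ℂ] 𝔤
  form : LinearMap.BilinForm ℂ 𝔤
  sigma_pow : ∀ x, σ^[T] x = x
  tau_lie : ∀ x y, τ ⁅x, y⁆ = ⁅τ x, τ y⁆
  tau_tau : ∀ x, τ (τ x) = x
  sigma_tau : ∀ x, σ (τ (σ (τ x))) = x
  form_symm : ∀ x y, form x y = form y x
  form_lie : ∀ x y z, form ⁅x, y⁆ z = form x ⁅y, z⁆
  form_nondeg : form.Nondegenerate
  form_sigma : ∀ x y, form (σ x) (σ y) = form x y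
  form_tau : ∀ x y, form (τ x) (τ y) = conj (form x y)

variable {T : ℕ} {ω : ℂ} {𝔤 : Type*} [LieRing 𝔤] [LieAlgebra ℂ 𝔤]

/-- `(x ⊗ t ^ m, y ⊗ t ^ n) ↦ [x, y] ⊗ t ^ (m + n)`; an element of the loop algebra is a finitely
supported function from exponents of `t` to coefficients. -/
def loopBracket (𝔤 : Type*) [LieRing 𝔤] [LieAlgebra ℂ 𝔤] :
    (ℤ →₀ 𝔤) →ₗ[ℂ] (ℤ →₀ 𝔤) →ₗ[ℂ] (ℤ →₀ 𝔤) :=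
  Finsupp.lsum ℂ fun m => LinearMap.flip <| Finsupp.lsum ℂ fun n => LinearMap.flip <|
    LinearMap.compr₂ (LieModule.toEnd ℂ 𝔤 𝔤 : 𝔤 →ₗ[ℂ] 𝔤 →ₗ[ℂ] 𝔤) (Finsupp.lsingle (m + n))

@[simp] theorem loopBracket_single (m n : ℤ) (x y : 𝔤) :
    loopBracket 𝔤 (Finsupp.single m x) (Finsupp.single n y) = Finsupp.single (m + n) ⁅x, y⁆ := by
  simp [loopBracket]

/-- The derivation `t d/dt` of the loop algebra. -/
def loopDegree (𝔤 : Type*) [LieRing 𝔤] [LieAlgebra ℂ 𝔤] : (ℤ →₀ 𝔤) →ₗ[ℂ] (ℤ →₀ 𝔤) :=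
  Finsupp.lsum ℂ fun n => (n : ℂ) • Finsupp.lsingle n

@[simp] theorem loopDegree_single (n : ℤ) (x : 𝔤) :
    loopDegree 𝔤 (Finsupp.single n x) = (n : ℂ) • Finsupp.single n x := by
  simp [loopDegree]

/-- `(x ⊗ t ^ m, y ⊗ t ^ n) ↦ m δ_{m + n, 0} ⟨x, y⟩` -/
def loopCocycle (B : LinearMap.BilinForm ℂ 𝔤) : (ℤ →₀ 𝔤) →ₗ[ℂ] (ℤ →₀ 𝔤) →ₗ[ℂ] ℂ :=
  Finsupp.lsum ℂ fun m => LinearMap.flip <| Finsupp.lsum ℂ fun n => LinearMap.flip <|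
    if m + n = 0 then (m : ℂ) • B else 0

@[simp] theorem loopCocycle_single (B : LinearMap.BilinForm ℂ 𝔤) (m n : ℤ) (x y : 𝔤) :
    loopCocycle B (Finsupp.single m x) (Finsupp.single n y) =
      if m + n = 0 then (m : ℂ) * B x y else 0 := by
  simp [loopCocycle]
  split_ifs <;> simp

/-- The affine Kac-Moody algebra `𝔤[t, t⁻¹] ⊕ ℂ K ⊕ ℂ D`. -/
structure Affine (G : DihedralData T ω 𝔤) where
  loop : ℤ →₀ 𝔤
  k : ℂ
  d : ℂ

namespace Affine
variable (G : DihedralData T ω 𝔤)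

def equivProd : Affine G ≃ (ℤ →₀ 𝔤) × ℂ × ℂ where
  toFun X := (X.loop, X.k, X.d)
  invFun X := ⟨X.1, X.2.1, X.2.2⟩
  left_inv _ := rfl
  right_inv _ := rfl

instance : AddCommGroup (Affine G) := (equivProd G).addCommGroup
instance : Module ℂ (Affine G) := (equivProd G).module ℂ
variable {G}
@[ext] theorem ext' {X Y : Affine G} (h1 : X.loop = Y.loop) (h2 : X.k = Y.k) (h3 : X.d = Y.d) : X = Y := by
  cases X; cases Y; simp_all
@[simp] theorem add_loop (X Y : Affine G) : (X + Y).loop = X.loop + Y.loop := rfl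
@[simp] theorem add_k (X Y : Affine G) : (X + Y).k = X.k + Y.k := rfl
@[simp] theorem add_d (X Y : Affine G) : (X + Y).d = X.d + Y.d := rfl
@[simp] theorem neg_loop (X : Affine G) : (-X).loop = -X.loop := rfl
@[simp] theorem neg_k (X : Affine G) : (-X).k = -X.k := rfl
@[simp] theorem neg_d (X : Affine G) : (-X).d = -X.d := rfl
@[simp] theorem zero_loop : (0 : Affine G).loop = 0 := rfl
@[simp] theorem zero_k : (0 : Affine G).k = 0 := rfl
@[simp] theorem zero_d : (0 : Affine G).d = 0 := rfl
@[simp] theorem smul_loop (c : ℂ) (X : Affine G) : (c • X).loop = c • X.loop := rfl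
@[simp] theorem smul_k (c : ℂ) (X : Affine G) : (c • X).k = c * X.k := rfl
@[simp] theorem smul_d (c : ℂ) (X : Affine G) : (c • X).d = c * X.d := rfl

instance : Bracket (Affine G) (Affine G) where
  bracket X Y :=
    ⟨loopBracket 𝔤 X.loop Y.loop + X.d • loopDegree 𝔤 Y.loop - Y.d • loopDegree 𝔤 X.loop,
      loopCocycle G.form X.loop Y.loop, 0⟩

theorem lie_def (X Y : Affine G) : ⁅X, Y⁆ =
    ⟨loopBracket 𝔤 X.loop Y.loop + X.d • loopDegree 𝔤 Y.loop - Y.d • loopDegree 𝔤 X.loop,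
      loopCocycle G.form X.loop Y.loop, 0⟩ := rfl
end Affine

theorem loopBracket_skew (f g : ℤ →₀ 𝔤) : loopBracket 𝔤 f g = - loopBracket 𝔤 g f := by
  suffices h : loopBracket 𝔤 = - (loopBracket 𝔤).flip by
    exact congrArg (fun φ => φ f g) h
  ext m x n y : 4
  simp [add_comm n m, ← Finsupp.single_neg]

theorem loopBracket_jacobi (f g h : ℤ →₀ 𝔤) :
    loopBracket 𝔤 f (loopBracket 𝔤 g h) =
      loopBracket 𝔤 (loopBracket 𝔤 f g) h + loopBracket 𝔤 g (loopBracket 𝔤 f h) := by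
  induction f using Finsupp.induction_linear with
  | zero => simp
  | add a b ha hb => simp only [map_add, LinearMap.add_apply, ha, hb]; abel
  | single m x =>
  induction g using Finsupp.induction_linear with
  | zero => simp
  | add a b ha hb => simp only [map_add, LinearMap.add_apply, ha, hb]; abel
  | single n y =>
  induction h using Finsupp.induction_linear with
  | zero => simp
  | add a b ha hb => simp only [map_add, LinearMap.add_apply, ha, hb]; abel
  | single p z =>
    simp only [loopBracket_single]
    rw [show n + (m + p) = m + (n + p) by ring, show m + n + p = m + (n + p) by ring,
      ← Finsupp.single_add, leibniz_lie]

theorem loopDegree_bracket (f g : ℤ →₀ 𝔤) :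
    loopDegree 𝔤 (loopBracket 𝔤 f g) =
      loopBracket 𝔤 (loopDegree 𝔤 f) g + loopBracket 𝔤 f (loopDegree 𝔤 g) := by
  induction f using Finsupp.induction_linear with
  | zero => simp
  | add a b ha hb => simp only [map_add, LinearMap.add_apply, ha, hb]; abel
  | single m x =>
  induction g using Finsupp.induction_linear with
  | zero => simp
  | add a b ha hb => simp only [map_add, LinearMap.add_apply, ha, hb]; abel
  | single n y =>
    simp [add_smul]

theorem loopCocycle_skew (G : DihedralData T ω 𝔤) (f g : ℤ →₀ 𝔤) :
    loopCocycle G.form f g = - loopCocycle G.form g f := by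
  induction f using Finsupp.induction_linear with
  | zero => simp
  | add a b ha hb => simp only [map_add, LinearMap.add_apply, ha, hb]; abel
  | single m x =>
  induction g using Finsupp.induction_linear with
  | zero => simp
  | add a b ha hb => simp only [map_add, LinearMap.add_apply, ha, hb]; abel
  | single n y =>
    simp only [loopCocycle_single, add_comm n m, G.form_symm y x]
    split_ifs with h
    · have : (n : ℂ) = - m := by
        rw [← Int.cast_neg]; congr 1; omega
      rw [this]; ring
    · simp

theorem loopCocycle_jacobi (G : DihedralData T ω 𝔤) (f g h : ℤ →₀ 𝔤) :
    loopCocycle G.form f (loopBracket 𝔤 g h) =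
      loopCocycle G.form (loopBracket 𝔤 f g) h + loopCocycle G.form g (loopBracket 𝔤 f h) := by
  induction f using Finsupp.induction_linear with
  | zero => simp
  | add a b ha hb => simp only [map_add, LinearMap.add_apply, ha, hb]; abel
  | single m x =>
  induction g using Finsupp.induction_linear with
  | zero => simp
  | add a b ha hb => simp only [map_add, LinearMap.add_apply, ha, hb]; abel
  | single n y =>
  induction h using Finsupp.induction_linear with
  | zero => simp
  | add a b ha hb => simp only [map_add, LinearMap.add_apply, ha, hb]; abel
  | single p z =>
    simp only [loopBracket_single, loopCocycle_single]
    rw [show n + (m + p) = m + (n + p) by ring, show m + n + p = m + (n + p) by ring]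
    split_ifs with h
    · have e : G.form y ⁅x, z⁆ = - G.form x ⁅y, z⁆ := by
        rw [← G.form_lie, ← lie_skew, map_neg, LinearMap.neg_apply, G.form_lie]
      rw [G.form_lie, e]; push_cast; ring
    · simp

theorem loopCocycle_degree (G : DihedralData T ω 𝔤) (f g : ℤ →₀ 𝔤) :
    loopCocycle G.form (loopDegree 𝔤 f) g + loopCocycle G.form f (loopDegree 𝔤 g) = 0 := by
  induction f using Finsupp.induction_linear with
  | zero => simp
  | add a b ha hb =>
    simp only [map_add, LinearMap.add_apply]
    linear_combination ha + hb
  | single m x =>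
  induction g using Finsupp.induction_linear with
  | zero => simp
  | add a b ha hb =>
    simp only [map_add]
    linear_combination ha + hb
  | single n y =>
    simp only [loopDegree_single, map_smul, LinearMap.smul_apply, loopCocycle_single, smul_eq_mul]
    split_ifs with h
    · have : (n : ℂ) = - m := by
        rw [← Int.cast_neg]; congr 1; omega
      rw [this]; ring
    · simp

theorem loopBracket_self (f : ℤ →₀ 𝔤) : loopBracket 𝔤 f f = 0 := by
  have h := loopBracket_skew f f
  have h2 : (2 : ℂ) • loopBracket 𝔤 f f = 0 := by
    rw [two_smul]; nth_rewrite 1 [h]; simp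
  exact (smul_eq_zero.mp h2).resolve_left two_ne_zero

theorem loopCocycle_self (G : DihedralData T ω 𝔤) (f : ℤ →₀ 𝔤) :
    loopCocycle G.form f f = 0 := by
  have h := loopCocycle_skew G f f
  linear_combination h / 2

namespace Affine
variable {G : DihedralData T ω 𝔤}
instance : LieRing (Affine G) where
  add_lie X Y Z := by
    apply ext' <;> simp [lie_def]; module
  lie_add X Y Z := by
    apply ext' <;> simp [lie_def]; module
  lie_self X := by
    apply ext' <;> simp [lie_def, loopBracket_self, loopCocycle_self]
  leibniz_lie X Y Z := by
    apply ext'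
    · simp only [lie_def, add_loop, map_add, map_sub, map_smul, LinearMap.add_apply, LinearMap.sub_apply,
        LinearMap.smul_apply, loopBracket_jacobi X.loop Y.loop Z.loop, loopDegree_bracket]
      rw [loopBracket_skew Y.loop (loopDegree 𝔤 X.loop)]
      module
    · simp only [lie_def, add_k, map_add, map_sub, map_smul, LinearMap.add_apply, LinearMap.sub_apply,
        LinearMap.smul_apply, loopCocycle_jacobi G X.loop Y.loop Z.loop, smul_eq_mul]
      have h1 := loopCocycle_degree G X.loop Y.loop
      have h2 := loopCocycle_degree G X.loop Z.loop
      have h3 := loopCocycle_degree G Y.loop Z.loop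
      have h4 := loopCocycle_skew G Y.loop (loopDegree 𝔤 X.loop)
      linear_combination -Z.d * h1 + Y.d * h2 - X.d * h3 + Z.d * h4
    · simp [lie_def]

instance : LieAlgebra ℂ (Affine G) where
  lie_smul c X Y := by
    apply ext' <;> simp [lie_def]; module
end Affine

namespace Affine
variable {G : DihedralData T ω 𝔤}

/-- The element `x ⊗ t ^ n` of the affine algebra. -/
def gen (G : DihedralData T ω 𝔤) (n : ℤ) (x : 𝔤) : Affine G := ⟨Finsupp.single n x, 0, 0⟩

/-- The central element `K`. -/
def K (G : DihedralData T ω 𝔤) : Affine G := ⟨0, 1, 0⟩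

/-- The derivation element `D`. -/
def D (G : DihedralData T ω 𝔤) : Affine G := ⟨0, 0, 1⟩

/-- `σ (x ⊗ t ^ n) = σ x ⊗ t ^ n`, `σ K = K`, `σ D = D`. -/
def sigma : Affine G →ₗ[ℂ] Affine G where
  toFun X := ⟨X.loop.mapRange G.σ (map_zero _), X.k, X.d⟩
  map_add' X Y := by
    apply ext' <;> simp [Finsupp.mapRange_add]
  map_smul' c X := by
    apply ext' <;> simp [Finsupp.mapRange_smul]

/-- `τ (x ⊗ t ^ n) = τ x ⊗ t ^ (-n)`, `τ K = -K`, `τ D = -D`, extended antilinearly. -/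
def tau : Affine G →ₛₗ[starRingEnd ℂ] Affine G where
  toFun X := ⟨(X.loop.mapRange G.τ (map_zero _)).equivMapDomain (Equiv.neg ℤ), -conj X.k, -conj X.d⟩
  map_add' X Y := by
    apply ext'
    · ext n; simp
    · simp [add_comm]
    · simp [add_comm]
  map_smul' c X := by
    apply ext'
    · ext n; simp
    · simp
    · simp

theorem sigma_loop (X : Affine G) : (sigma X).loop = X.loop.mapRange G.σ (map_zero _) := rfl
theorem tau_loop (X : Affine G) :
    (tau X).loop = (X.loop.mapRange G.τ (map_zero _)).equivMapDomain (Equiv.neg ℤ) := rfl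

theorem ext_lin {f g : Affine G → Affine G} (hf : ∀ X Y, f (X + Y) = f X + f Y)
    (hg : ∀ X Y, g (X + Y) = g X + g Y) (h1 : ∀ n x, f (gen G n x) = g (gen G n x))
    (h2 : ∀ a : ℂ, f (a • K G) = g (a • K G)) (h3 : ∀ a : ℂ, f (a • D G) = g (a • D G)) (X : Affine G) :
    f X = g X := by
  have hX : X = ⟨X.loop, 0, 0⟩ + (X.k • K G + X.d • D G) := by
    apply ext' <;> simp [K, D]
  have key : ∀ l : ℤ →₀ 𝔤, f ⟨l, 0, 0⟩ = g ⟨l, 0, 0⟩ := by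
    intro l
    induction l using Finsupp.induction_linear with
    | zero => simpa [gen] using h1 0 0
    | add a b ha hb =>
      have e : (⟨a + b, 0, 0⟩ : Affine G) = ⟨a, 0, 0⟩ + ⟨b, 0, 0⟩ := by apply ext' <;> simp
      rw [e, hf, hg, ha, hb]
    | single n x => exact h1 n x
  rw [hX]
  simp only [hf, hg, key, h2, h3]

@[simp] theorem lie_gen_gen (m n : ℤ) (x y : 𝔤) :
    ⁅gen G m x, gen G n y⁆ = gen G (m + n) ⁅x, y⁆ +
      (if m + n = 0 then (m : ℂ) * G.form x y else 0) • K G := by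
  split_ifs with h <;> apply ext' <;> simp [lie_def, gen, K, h]

@[simp] theorem lie_K (X : Affine G) : ⁅X, K G⁆ = 0 := by
  apply ext' <;> simp [lie_def, K]

@[simp] theorem K_lie (X : Affine G) : ⁅K G, X⁆ = 0 := by
  apply ext' <;> simp [lie_def, K]

@[simp] theorem D_lie_gen (n : ℤ) (x : 𝔤) : ⁅D G, gen G n x⁆ = (n : ℂ) • gen G n x := by
  apply ext' <;> simp [lie_def, D, gen]

@[simp] theorem gen_lie_D (n : ℤ) (x : 𝔤) : ⁅gen G n x, D G⁆ = -((n : ℂ) • gen G n x) := by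
  rw [← lie_skew, D_lie_gen]

@[simp] theorem sigma_gen (n : ℤ) (x : 𝔤) : sigma (gen G n x) = gen G n (G.σ x) := by
  apply ext' <;> simp [sigma, gen]
@[simp] theorem sigma_K : sigma (K G) = K G := by
  apply ext' <;> simp [sigma, K]
@[simp] theorem sigma_D : sigma (D G) = D G := by
  apply ext' <;> simp [sigma, D]
@[simp] theorem tau_gen (n : ℤ) (x : 𝔤) : tau (gen G n x) = gen G (-n) (G.τ x) := by
  apply ext' <;> simp [tau, gen, Finsupp.equivMapDomain_single]
@[simp] theorem tau_K : tau (K G) = -K G := by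
  apply ext'
  · ext; simp [tau, K]
  · simp [tau, K]
  · simp [tau, K]
@[simp] theorem tau_D : tau (D G) = -D G := by
  apply ext'
  · ext; simp [tau, D]
  · simp [tau, D]
  · simp [tau, D]

theorem sigma_lie (X Y : Affine G) : sigma ⁅X, Y⁆ = ⁅sigma X, sigma Y⁆ := by
  refine ext_lin (f := fun X => sigma ⁅X, Y⁆) (g := fun X => ⁅sigma X, sigma Y⁆)
    (by simp) (by simp) (fun m x => ?_) (fun a => ?_) (fun a => ?_) X
  · refine ext_lin (f := fun Y => sigma ⁅gen G m x, Y⁆) (g := fun Y => ⁅sigma (gen G m x), sigma Y⁆)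
      (by simp) (by simp) (fun n y => ?_) (fun a => ?_) (fun a => ?_) Y
    · simp only [lie_gen_gen, map_add, map_smul, sigma_gen, sigma_K, LieHom.map_lie, G.form_sigma]
    · simp
    · simp
  · simp
  · refine ext_lin (f := fun Y => sigma ⁅a • D G, Y⁆) (g := fun Y => ⁅sigma (a • D G), sigma Y⁆)
      (by simp) (by simp) (fun n y => ?_) (fun a => ?_) (fun a => ?_) Y <;> simp

theorem tau_lie (X Y : Affine G) : tau ⁅X, Y⁆ = ⁅tau X, tau Y⁆ := by
  refine ext_lin (f := fun X => tau ⁅X, Y⁆) (g := fun X => ⁅tau X, tau Y⁆)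
    (by simp) (by simp) (fun m x => ?_) (fun a => ?_) (fun a => ?_) X
  · refine ext_lin (f := fun Y => tau ⁅gen G m x, Y⁆) (g := fun Y => ⁅tau (gen G m x), tau Y⁆)
      (by simp) (by simp) (fun n y => ?_) (fun a => ?_) (fun a => ?_) Y
    · have e : (-m + -n = 0) ↔ (m + n = 0) := by omega
      simp only [lie_gen_gen, map_add, map_smulₛₗ, tau_gen, tau_K, G.tau_lie, e, G.form_tau]
      split_ifs
      · simp [add_comm]
      · simp [add_comm]
    · simp
    · simp
  · simp
  · refine ext_lin (f := fun Y => tau ⁅a • D G, Y⁆) (g := fun Y => ⁅tau (a • D G), tau Y⁆)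
      (by simp) (by simp) (fun n y => ?_) (fun a => ?_) (fun a => ?_) Y <;> simp

/-- The descending filtration `F_n = 𝔤 ⊗ t ^ n ℂ[t]`. -/
def fil (G : DihedralData T ω 𝔤) (n : ℕ) : Submodule ℂ (Affine G) where
  carrier := {X | X.k = 0 ∧ X.d = 0 ∧ ∀ m : ℤ, m < n → X.loop m = 0}
  add_mem' {X Y} hX hY := by
    refine ⟨by simp [hX.1, hY.1], by simp [hX.2.1, hY.2.1], fun m hm => ?_⟩
    simp [hX.2.2 m hm, hY.2.2 m hm]
  zero_mem' := by simp
  smul_mem' c X hX := by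
    refine ⟨by simp [hX.1], by simp [hX.2.1], fun m hm => ?_⟩
    simp [hX.2.2 m hm]

/-- The opposite descending filtration `𝔤 ⊗ t ^ (-n) ℂ[t⁻¹]`. -/
def filBar (G : DihedralData T ω 𝔤) (n : ℕ) : Submodule ℂ (Affine G) where
  carrier := {X | X.k = 0 ∧ X.d = 0 ∧ ∀ m : ℤ, -(n : ℤ) < m → X.loop m = 0}
  add_mem' {X Y} hX hY := by
    refine ⟨by simp [hX.1, hY.1], by simp [hX.2.1, hY.2.1], fun m hm => ?_⟩
    simp [hX.2.2 m hm, hY.2.2 m hm]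
  zero_mem' := by simp
  smul_mem' c X hX := by
    refine ⟨by simp [hX.1], by simp [hX.2.1], fun m hm => ?_⟩
    simp [hX.2.2 m hm]

theorem fil_anti {m n : ℕ} (h : m ≤ n) : fil G n ≤ fil G m := by
  rintro X ⟨h1, h2, h3⟩
  exact ⟨h1, h2, fun p hp => h3 p (by omega)⟩

theorem filBar_anti {m n : ℕ} (h : m ≤ n) : filBar G n ≤ filBar G m := by
  rintro X ⟨h1, h2, h3⟩
  exact ⟨h1, h2, fun p hp => h3 p (by omega)⟩

/-- The projection onto the subspace `{X | σ X = ω ^ j X}`. -/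
def eigenProj (G : DihedralData T ω 𝔤) (j : ℤ) : Affine G →ₗ[ℂ] Affine G :=
  (T : ℂ)⁻¹ • ∑ k ∈ Finset.range T, (ω ^ (-(k * j : ℤ))) • sigma ^ k

end Affine

/-- `𝔤̃ ⊗ ℂ[ε] / (ε ^ n)`; the function `Y` stands for `∑ p, Y p ⊗ ε ^ p`. -/
def Takiff (G : DihedralData T ω 𝔤) (n : ℕ) : Type _ := Fin n → Affine G

namespace Takiff
variable {G : DihedralData T ω 𝔤} {n : ℕ}

instance : AddCommGroup (Takiff G n) := inferInstanceAs (AddCommGroup (Fin n → Affine G))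
instance : Module ℂ (Takiff G n) := inferInstanceAs (Module ℂ (Fin n → Affine G))

@[simp] theorem add_apply (X Y : Takiff G n) (p : Fin n) : (X + Y) p = X p + Y p := rfl
@[simp] theorem zero_apply (p : Fin n) : (0 : Takiff G n) p = 0 := rfl
@[simp] theorem smul_apply (c : ℂ) (X : Takiff G n) (p : Fin n) : (c • X) p = c • X p := rfl

instance : Bracket (Takiff G n) (Takiff G n) where
  bracket X Y p := ∑ i : Fin n, ∑ j : Fin n, if (i : ℕ) + j = p then ⁅X i, Y j⁆ else 0

theorem lie_apply (X Y : Takiff G n) (p : Fin n) :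
    ⁅X, Y⁆ p = ∑ i : Fin n, ∑ j : Fin n, if (i : ℕ) + j = p then ⁅X i, Y j⁆ else 0 := rfl

theorem sum_aux {M : Type*} [AddCommMonoid M] (a b : ℕ) (p : Fin n) (c : M) :
    (∑ s : Fin n, if a + (s : ℕ) = p then (if b = s then c else 0) else 0)
      = if a + b = p then c else 0 := by
  by_cases h : a + b = p
  · have hb : b < n := by have := p.2; omega
    rw [Finset.sum_eq_single ⟨b, hb⟩]
    · simp [h]
    · intro s _ hs
      have : b ≠ s := fun e => hs (Fin.ext e.symm)
      simp [this]
    · simp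
  · rw [if_neg h]
    refine Finset.sum_eq_zero fun s _ => ?_
    split_ifs with h1 h2
    · omega
    · rfl
    · rfl

theorem lie_lie_apply (X Y Z : Takiff G n) (p : Fin n) :
    ⁅X, ⁅Y, Z⁆⁆ p = ∑ i : Fin n, ∑ j : Fin n, ∑ k : Fin n,
      if (i : ℕ) + (j + k) = p then ⁅X i, ⁅Y j, Z k⁆⁆ else 0 := by
  rw [lie_apply]
  refine Finset.sum_congr rfl fun i _ => ?_
  have : ∀ s : Fin n, (if (i : ℕ) + s = p then ⁅X i, ⁅Y, Z⁆ s⁆ else 0) =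
      ∑ j : Fin n, ∑ k : Fin n,
        if (i : ℕ) + s = p then (if (j : ℕ) + k = s then ⁅X i, ⁅Y j, Z k⁆⁆ else 0) else 0 := by
    intro s
    split_ifs with h
    · rw [lie_apply, lie_sum]
      refine Finset.sum_congr rfl fun j _ => ?_
      rw [lie_sum]
      refine Finset.sum_congr rfl fun k _ => ?_
      split_ifs <;> simp
    · simp
  simp only [this]
  rw [Finset.sum_comm]
  refine Finset.sum_congr rfl fun j _ => ?_
  rw [Finset.sum_comm]
  exact Finset.sum_congr rfl fun k _ => sum_aux _ _ _ _

theorem lie_skew_aux (X Y : Takiff G n) : ⁅X, Y⁆ = -⁅Y, X⁆ := by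
  funext p
  change _ = -(⁅Y, X⁆ p)
  rw [lie_apply, lie_apply, Finset.sum_comm, ← Finset.sum_neg_distrib]
  refine Finset.sum_congr rfl fun i _ => ?_
  rw [← Finset.sum_neg_distrib]
  refine Finset.sum_congr rfl fun j _ => ?_
  rw [add_comm]
  split_ifs
  · rw [lie_skew]
  · simp

theorem lie_add_aux (X Y Z : Takiff G n) : ⁅X, Y + Z⁆ = ⁅X, Y⁆ + ⁅X, Z⁆ := by
  funext p
  simp only [lie_apply, add_apply, lie_add, ← Finset.sum_add_distrib]
  refine Finset.sum_congr rfl fun i _ => Finset.sum_congr rfl fun j _ => ?_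
  split_ifs <;> simp

instance : LieRing (Takiff G n) where
  add_lie X Y Z := by
    rw [lie_skew_aux, lie_add_aux, lie_skew_aux Z X, lie_skew_aux Z Y, neg_add, neg_neg, neg_neg]
  lie_add := lie_add_aux
  lie_self X := by
    have h2 : (2 : ℂ) • ⁅X, X⁆ = 0 := by
      rw [two_smul]; nth_rewrite 1 [lie_skew_aux]; simp
    exact (smul_eq_zero.mp h2).resolve_left two_ne_zero
  leibniz_lie X Y Z := by
    have h1 : ⁅⁅X, Y⁆, Z⁆ = -⁅Z, ⁅X, Y⁆⁆ := lie_skew_aux _ _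
    rw [h1]
    funext p
    change _ = -(⁅Z, ⁅X, Y⁆⁆ p) + ⁅Y, ⁅X, Z⁆⁆ p
    rw [lie_lie_apply, lie_lie_apply, lie_lie_apply]
    have h3 : (∑ i : Fin n, ∑ j : Fin n, ∑ k : Fin n,
        if (i : ℕ) + (j + k) = p then ⁅Z i, ⁅X j, Y k⁆⁆ else 0) =
        ∑ i : Fin n, ∑ j : Fin n, ∑ k : Fin n,
        if (i : ℕ) + (j + k) = p then ⁅Z k, ⁅X i, Y j⁆⁆ else 0 := by
      rw [Finset.sum_comm]
      refine Finset.sum_congr rfl fun i _ => ?_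
      rw [Finset.sum_comm]
      refine Finset.sum_congr rfl fun j _ => Finset.sum_congr rfl fun k _ => ?_
      congr 1
      apply propext; omega
    have h4 : (∑ i : Fin n, ∑ j : Fin n, ∑ k : Fin n,
        if (i : ℕ) + (j + k) = p then ⁅Y i, ⁅X j, Z k⁆⁆ else 0) =
        ∑ i : Fin n, ∑ j : Fin n, ∑ k : Fin n,
        if (i : ℕ) + (j + k) = p then ⁅Y j, ⁅X i, Z k⁆⁆ else 0 := by
      rw [Finset.sum_comm]
      refine Finset.sum_congr rfl fun i _ => Finset.sum_congr rfl fun j _ =>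
        Finset.sum_congr rfl fun k _ => ?_
      congr 1
      apply propext; omega
    rw [h3, h4]
    simp only [← Finset.sum_neg_distrib, ← Finset.sum_add_distrib]
    refine Finset.sum_congr rfl fun i _ => Finset.sum_congr rfl fun j _ =>
        Finset.sum_congr rfl fun k _ => ?_
    split_ifs
    · rw [leibniz_lie, lie_skew]
    · simp

instance : LieAlgebra ℂ (Takiff G n) where
  lie_smul c X Y := by
    funext p
    simp only [lie_apply, smul_apply, lie_smul, Finset.smul_sum]
    refine Finset.sum_congr rfl fun i _ => Finset.sum_congr rfl fun j _ => ?_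
    split_ifs <;> simp

instance : LieAlgebra ℝ (Takiff G n) where
  lie_smul c X Y := by
    rw [← Complex.coe_smul, lie_smul, Complex.coe_smul]

/-- The element `X ⊗ ε ^ p`, which is zero for `n ≤ p`. -/
def single (n p : ℕ) (X : Affine G) : Takiff G n := fun q => if (q : ℕ) = p then X else 0

/-- The automorphism `∑ X_p ⊗ ε ^ p ↦ ∑ σ ^ k X_p ⊗ (ζ ^ k ε) ^ p`. -/
def rot (ζ : ℂ) (k : ℕ) (Y : Takiff G n) : Takiff G n :=
  fun p => ζ ^ (k * (p : ℕ)) • (Affine.sigma ^ k) (Y p)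

/-- The antilinear automorphism `∑ X_p ⊗ ε ^ p ↦ ∑ σ ^ k τ X_p ⊗ (ζ ^ k ε) ^ p`. -/
def refl (ζ : ℂ) (k : ℕ) (Y : Takiff G n) : Takiff G n :=
  fun p => ζ ^ (k * (p : ℕ)) • (Affine.sigma ^ k) (Affine.tau (Y p))

theorem rot_add (ζ : ℂ) (k : ℕ) (X Y : Takiff G n) : rot ζ k (X + Y) = rot ζ k X + rot ζ k Y := by
  funext p; simp [rot]

theorem refl_add (ζ : ℂ) (k : ℕ) (X Y : Takiff G n) :
    refl ζ k (X + Y) = refl ζ k X + refl ζ k Y := by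
  funext p; simp [refl]

theorem rot_smul (ζ : ℂ) (k : ℕ) (c : ℂ) (X : Takiff G n) : rot ζ k (c • X) = c • rot ζ k X := by
  funext p; simp [rot, smul_comm c]

theorem refl_smul (ζ : ℂ) (k : ℕ) (c : ℂ) (X : Takiff G n) :
    refl ζ k (c • X) = conj c • refl ζ k X := by
  funext p; simp [refl, smul_comm (conj c)]

theorem rot_zero (ζ : ℂ) (k : ℕ) : rot ζ k (0 : Takiff G n) = 0 := by
  funext p; simp [rot]

theorem refl_zero (ζ : ℂ) (k : ℕ) : refl ζ k (0 : Takiff G n) = 0 := by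
  funext p; simp [refl]

theorem sigma_pow_lie (k : ℕ) (X Y : Affine G) :
    (Affine.sigma ^ k) ⁅X, Y⁆ = ⁅(Affine.sigma ^ k) X, (Affine.sigma ^ k) Y⁆ := by
  induction k with
  | zero => simp
  | succ k ih => simp only [pow_succ', Module.End.mul_apply, ih, Affine.sigma_lie]

theorem rot_lie (ζ : ℂ) (k : ℕ) (X Y : Takiff G n) : rot ζ k ⁅X, Y⁆ = ⁅rot ζ k X, rot ζ k Y⁆ := by
  funext p
  simp only [rot, lie_apply, map_sum, Finset.smul_sum]
  refine Finset.sum_congr rfl fun i _ => Finset.sum_congr rfl fun j _ => ?_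
  split_ifs with h
  · rw [sigma_pow_lie, smul_lie, lie_smul, smul_smul, ← pow_add, ← mul_add, h]
  · simp

theorem refl_lie (ζ : ℂ) (k : ℕ) (X Y : Takiff G n) :
    refl ζ k ⁅X, Y⁆ = ⁅refl ζ k X, refl ζ k Y⁆ := by
  funext p
  simp only [refl, lie_apply, map_sum, Finset.smul_sum]
  refine Finset.sum_congr rfl fun i _ => Finset.sum_congr rfl fun j _ => ?_
  split_ifs with h
  · rw [Affine.tau_lie, sigma_pow_lie, smul_lie, lie_smul, smul_smul, ← pow_add, ← mul_add, h]
  · simp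

end Takiff

/-- An effective divisor `∑ n_x x` supported on a finite set of points of `ℂ` together with `∞`.
The dihedral group acts by `z ↦ ω z` and `z ↦ conj z`, and distinct points of the support have
disjoint orbits. -/
structure Divisor (ω : ℂ) where
  z : Finset ℂ
  mult : ℂ → ℕ
  multInf : ℕ
  mult_pos : ∀ a ∈ z, 1 ≤ mult a
  multInf_pos : 1 ≤ multInf
  disjoint : ∀ a ∈ z, ∀ b ∈ z, a ≠ b → ∀ k : ℕ, ω ^ k * a ≠ b ∧ ω ^ k * conj a ≠ b

namespace Divisor

/-- The points of the support; `none` is the point at infinity. -/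
abbrev Pt (P : Divisor ω) : Type := Option {a : ℂ // a ∈ P.z}

variable {P : Divisor ω}

/-- The multiplicity of a point. -/
def order : P.Pt → ℕ
  | none => P.multInf
  | some a => P.mult a

/-- The root of unity by which the rotation rescales the local coordinate. -/
def zeta : P.Pt → ℂ
  | none => ω
  | some _ => ω⁻¹

/-- The point is fixed by the rotation `z ↦ ω ^ k z`. -/
def RotFixes : P.Pt → ℕ → Prop
  | none, _ => True
  | some a, k => ω ^ k * (a : ℂ) = a

/-- The point is fixed by the reflection `z ↦ ω ^ k conj z`. -/
def ReflFixes : P.Pt → ℕ → Prop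
  | none, _ => True
  | some a, k => ω ^ k * conj (a : ℂ) = a

/-- The point lies on no mirror of the dihedral group. -/
def IsComplex (x : P.Pt) : Prop := ∀ k, ¬ ReflFixes x k

open Classical in
/-- The least `k` such that the point is fixed by `z ↦ ω ^ k conj z`. -/
def reflIndex (x : P.Pt) : ℕ := if h : ∃ k, ReflFixes x k then Nat.find h else 0

end Divisor
open Divisor

section Observables
variable (G : DihedralData T ω 𝔤) (P : Divisor ω)
variable {P}

/-- The elements of the Takiff algebra at `x` which are invariant under the rotations fixing `x`;
at infinity there is no term of degree zero in `ε`. -/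
def takiffRot (x : P.Pt) : Submodule ℂ (Takiff G (order x)) where
  carrier := {Y | (x = none → ∀ p : Fin (order x), (p : ℕ) = 0 → Y p = 0) ∧
    ∀ k, RotFixes x k → Takiff.rot (zeta x) k Y = Y}
  add_mem' {X Y} hX hY :=
    ⟨fun h p hp => by rw [Takiff.add_apply, hX.1 h p hp, hY.1 h p hp, add_zero],
      fun k hk => by rw [Takiff.rot_add, hX.2 k hk, hY.2 k hk]⟩
  zero_mem' := ⟨fun _ _ _ => rfl, fun _ _ => Takiff.rot_zero _ _⟩
  smul_mem' c X hX :=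
    ⟨fun h p hp => by rw [Takiff.smul_apply, hX.1 h p hp, smul_zero],
      fun k hk => by rw [Takiff.rot_smul, hX.2 k hk]⟩

/-- The real Takiff algebra attached to the point `x`: the invariants under the stabiliser of `x`
in the dihedral group. -/
def takiffReal (x : P.Pt) : LieSubalgebra ℝ (Takiff G (order x)) where
  carrier := {Y | Y ∈ takiffRot G x ∧ ∀ k, ReflFixes x k → Takiff.refl (zeta x) k Y = Y}
  add_mem' {X Y} hX hY :=
    ⟨(takiffRot G x).add_mem hX.1 hY.1,
      fun k hk => by rw [Takiff.refl_add, hX.2 k hk, hY.2 k hk]⟩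
  zero_mem' := ⟨(takiffRot G x).zero_mem, fun _ _ => Takiff.refl_zero _ _⟩
  smul_mem' c X hX := by
    rw [← Complex.coe_smul]
    exact ⟨(takiffRot G x).smul_mem _ hX.1,
      fun k hk => by rw [Takiff.refl_smul, hX.2 k hk, Complex.conj_ofReal]⟩
  lie_mem' {X Y} hX hY := by
    refine ⟨⟨fun h p hp => ?_, fun k hk => ?_⟩, fun k hk => ?_⟩
    · rw [Takiff.lie_apply]
      refine Finset.sum_eq_zero fun i _ => Finset.sum_eq_zero fun j _ => ?_
      split_ifs with hij
      · rw [hX.1.1 h i (by omega), zero_lie]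
      · rfl
    · rw [Takiff.rot_lie, hX.1.2 k hk, hY.1.2 k hk]
    · rw [Takiff.refl_lie, hX.2 k hk, hY.2 k hk]

variable (P)

/-- The real Lie algebra `⊕_x (T_x)^{Π_x}`. -/
abbrev RealObs : Type _ := DirectSum P.Pt fun x => takiffReal G x

/-- Its complexification. -/
abbrev CplxObs : Type _ := ℂ ⊗[ℝ] RealObs G P

variable {P}

open Classical in
/-- The element `a ⊗ Y` for `Y` in the real Takiff algebra at `x` (and `0` for other `Y`). -/
def scaled (x : P.Pt) (a : ℂ) (Y : Takiff G (order x)) : CplxObs G P :=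
  if h : Y ∈ takiffReal G x then
    a ⊗ₜ[ℝ] DirectSum.lof ℝ P.Pt (fun x => takiffReal G x) x ⟨Y, h⟩
  else 0

open Classical in
/-- The embedding `Y ↦ Y^(x)` of the complex Takiff algebra at `x` in the complexification. -/
def emb (x : P.Pt) (Y : Takiff G (order x)) : CplxObs G P :=
  if IsComplex x then
    scaled G x (1 / 2) Y - scaled G x (Complex.I / 2) (Complex.I • Y)
  else
    scaled G x (1 / 2) (Y + Takiff.refl (zeta x) (reflIndex x) Y)
      - scaled G x (Complex.I / 2) (Complex.I • (Y - Takiff.refl (zeta x) (reflIndex x) Y))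

/-- The antilinear embedding `Y ↦ Y^(conj x)` attached to the conjugate of a complex point `x`. -/
def embBar (x : P.Pt) (Y : Takiff G (order x)) : CplxObs G P :=
  scaled G x (1 / 2) Y + scaled G x (Complex.I / 2) (Complex.I • Y)

/-- `X^(x)_p` -/
def obs (x : P.Pt) (p : ℕ) (X : Affine G) : CplxObs G P := emb G x (Takiff.single _ p X)

/-- `X^(conj x)_p` -/
def obsBar (x : P.Pt) (p : ℕ) (X : Affine G) : CplxObs G P := embBar G x (Takiff.single _ p X)

variable (P)

/-- Complex conjugation on the complexification. -/
def conjObs : CplxObs G P →ₗ[ℝ] CplxObs G P :=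
  LinearMap.rTensor (RealObs G P) Complex.conjAe.toLinearMap

/-- The filtration on the complexification. -/
def filObs (n : ℕ) : Submodule ℂ (CplxObs G P) :=
  Submodule.span ℂ
    ({v | ∃ x : P.Pt, ∃ Y ∈ takiffRot G x, (∀ p, Y p ∈ Affine.fil G n) ∧ v = emb G x Y} ∪
     {v | ∃ x : P.Pt, IsComplex x ∧ ∃ Y ∈ takiffRot G x,
        (∀ p, Y p ∈ Affine.filBar G n) ∧ v = embBar G x Y})

theorem filObs_anti {m n : ℕ} (h : m ≤ n) : filObs G P n ≤ filObs G P m := by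
  refine Submodule.span_mono ?_
  rintro v (⟨x, Y, hY, hp, rfl⟩ | ⟨x, hx, Y, hY, hp, rfl⟩)
  · exact Or.inl ⟨x, Y, hY, fun p => Affine.fil_anti h (hp p), rfl⟩
  · exact Or.inr ⟨x, hx, Y, hY, fun p => Affine.filBar_anti h (hp p), rfl⟩

/-- The algebra of observables before completion. -/
abbrev Obs : Type _ := SymmetricAlgebra ℂ (CplxObs G P)

end Observables

section Poisson
variable (L : Type*) [LieRing L] [LieAlgebra ℂ L]

/-- The algebra map `S → S[δ] / (δ ^ 2)` which sends `v` to `v + φ v δ`. -/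
def derivLift (φ : L →ₗ[ℂ] SymmetricAlgebra ℂ L) :
    SymmetricAlgebra ℂ L →ₐ[ℂ] DualNumber (SymmetricAlgebra ℂ L) :=
  SymmetricAlgebra.lift
    ((TrivSqZeroExt.inlAlgHom ℂ (SymmetricAlgebra ℂ L) (SymmetricAlgebra ℂ L)).toLinearMap ∘ₗ
        SymmetricAlgebra.ι ℂ L +
      (TrivSqZeroExt.inrHom (SymmetricAlgebra ℂ L) (SymmetricAlgebra ℂ L)).restrictScalars ℂ ∘ₗ φ)

theorem derivLift_ι (φ : L →ₗ[ℂ] SymmetricAlgebra ℂ L) (v : L) :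
    derivLift L φ (SymmetricAlgebra.ι ℂ L v) =
      TrivSqZeroExt.inl (SymmetricAlgebra.ι ℂ L v) + TrivSqZeroExt.inr (φ v) := by
  simp [derivLift]

theorem derivLift_fst (φ : L →ₗ[ℂ] SymmetricAlgebra ℂ L) (f : SymmetricAlgebra ℂ L) :
    (derivLift L φ f).fst = f := by
  have h : (TrivSqZeroExt.fstHom ℂ (SymmetricAlgebra ℂ L) (SymmetricAlgebra ℂ L)).comp
      (derivLift L φ) = AlgHom.id ℂ _ := by
    apply SymmetricAlgebra.algHom_ext
    ext v
    simp [derivLift_ι]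
  exact DFunLike.congr_fun h f

/-- The value on `f` of the derivation which extends the linear map `φ` on generators. -/
def derivFun (φ : L →ₗ[ℂ] SymmetricAlgebra ℂ L) :
    Derivation ℂ (SymmetricAlgebra ℂ L) (SymmetricAlgebra ℂ L) :=
  Derivation.mk'
    (((TrivSqZeroExt.sndHom (SymmetricAlgebra ℂ L) (SymmetricAlgebra ℂ L)).restrictScalars ℂ) ∘ₗ
      (derivLift L φ).toLinearMap) (fun f g => by
        simp only [LinearMap.coe_comp, Function.comp_apply, AlgHom.toLinearMap_apply, map_mul,
          LinearMap.coe_restrictScalars, TrivSqZeroExt.sndHom_apply, TrivSqZeroExt.snd_mul,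
          derivLift_fst, smul_eq_mul, op_smul_eq_smul])

theorem derivFun_ι (φ : L →ₗ[ℂ] SymmetricAlgebra ℂ L) (v : L) :
    derivFun L φ (SymmetricAlgebra.ι ℂ L v) = φ v := by
  simp [derivFun, derivLift_ι]

theorem deriv_ext_ι {d e : Derivation ℂ (SymmetricAlgebra ℂ L) (SymmetricAlgebra ℂ L)}
    (h : ∀ v, d (SymmetricAlgebra.ι ℂ L v) = e (SymmetricAlgebra.ι ℂ L v)) : d = e := by
  ext f
  induction f using SymmetricAlgebra.induction with
  | algebraMap r => simp
  | ι v => exact h v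
  | mul a b ha hb => simp [ha, hb]
  | add a b ha hb => simp [ha, hb]

/-- The derivation of the symmetric algebra which extends a linear map on generators. -/
def derivExt : (L →ₗ[ℂ] SymmetricAlgebra ℂ L) →ₗ[ℂ]
    Derivation ℂ (SymmetricAlgebra ℂ L) (SymmetricAlgebra ℂ L) where
  toFun φ := derivFun L φ
  map_add' φ ψ := deriv_ext_ι L fun v => by simp [derivFun_ι]
  map_smul' c φ := deriv_ext_ι L fun v => by simp [derivFun_ι]

@[simp] theorem derivExt_ι (φ : L →ₗ[ℂ] SymmetricAlgebra ℂ L) (v : L) :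
    derivExt L φ (SymmetricAlgebra.ι ℂ L v) = φ v := derivFun_ι L φ v

/-- The derivation `{v, ·}` for `v` in the Lie algebra. -/
def adDeriv : L →ₗ[ℂ] Derivation ℂ (SymmetricAlgebra ℂ L) (SymmetricAlgebra ℂ L) where
  toFun v := derivExt L (SymmetricAlgebra.ι ℂ L ∘ₗ (LieModule.toEnd ℂ L L v))
  map_add' v w := deriv_ext_ι L fun u => by simp
  map_smul' c v := deriv_ext_ι L fun u => by simp

/-- The linear map `v ↦ {f, v}` on generators. -/
def hamMap : SymmetricAlgebra ℂ L →ₗ[ℂ] L →ₗ[ℂ] SymmetricAlgebra ℂ L :=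
  LinearMap.mk₂ ℂ (fun f v => -(adDeriv L v f))
    (fun f g v => by rw [map_add, neg_add]) (fun c f v => by rw [Derivation.map_smul, smul_neg])
    (fun f v w => by rw [map_add, Derivation.add_apply, neg_add])
    (fun c f v => by rw [map_smul, Derivation.smul_apply, smul_neg])

/-- The Poisson bracket on the symmetric algebra of a Lie algebra: the biderivation which extends
the Lie bracket. -/
def poisson : SymmetricAlgebra ℂ L →ₗ[ℂ] SymmetricAlgebra ℂ L →ₗ[ℂ] SymmetricAlgebra ℂ L :=
  LinearMap.mk₂ ℂ (fun f g => derivExt L (hamMap L f) g)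
    (fun f g h => by rw [map_add, map_add, Derivation.add_apply])
    (fun c f g => by rw [map_smul, map_smul, Derivation.smul_apply])
    (fun f g h => by rw [map_add])
    (fun c f g => by rw [Derivation.map_smul])

theorem poisson_ι_ι (v w : L) :
    poisson L (SymmetricAlgebra.ι ℂ L v) (SymmetricAlgebra.ι ℂ L w) =
      SymmetricAlgebra.ι ℂ L ⁅v, w⁆ := by
  change derivExt L _ (SymmetricAlgebra.ι ℂ L w) = _
  rw [derivExt_ι]
  change -(derivExt L _ (SymmetricAlgebra.ι ℂ L v)) = _
  rw [derivExt_ι]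
  rw [LinearMap.comp_apply, ← map_neg]
  exact congrArg _ (lie_skew v w)

theorem poisson_mul_right (f g h : SymmetricAlgebra ℂ L) :
    poisson L f (g * h) = g * poisson L f h + h * poisson L f g := by
  change (derivExt L _ : Derivation ℂ _ _) (g * h) = _
  rw [Derivation.leibniz]
  rfl

theorem poisson_ι_left (v : L) (g : SymmetricAlgebra ℂ L) :
    poisson L (SymmetricAlgebra.ι ℂ L v) g = adDeriv L v g := by
  change (derivExt L _ : Derivation ℂ _ _) g = _
  congr 1
  refine deriv_ext_ι L fun w => ?_
  rw [derivExt_ι]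
  change -(derivExt L _ (SymmetricAlgebra.ι ℂ L v)) = derivExt L _ (SymmetricAlgebra.ι ℂ L w)
  rw [derivExt_ι, derivExt_ι, LinearMap.comp_apply, LinearMap.comp_apply, ← map_neg]
  exact congrArg _ (lie_skew v w)

end Poisson

open Divisor

section Completion
variable (G : DihedralData T ω 𝔤) (P : Divisor ω)

/-- The descending filtration of the algebra of observables by ideals. -/
def filAlg (n : ℕ) : Ideal (Obs G P) :=
  Ideal.span (SymmetricAlgebra.ι ℂ (CplxObs G P) '' (filObs G P n)) ⊓
    Ideal.span (SymmetricAlgebra.ι ℂ (CplxObs G P) '' (conjObs G P '' (filObs G P n)))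

theorem filAlg_anti {m n : ℕ} (h : m ≤ n) : filAlg G P n ≤ filAlg G P m := by
  refine inf_le_inf (Ideal.span_mono ?_) (Ideal.span_mono ?_)
  · exact Set.image_mono (filObs_anti G P h)
  · exact Set.image_mono (Set.image_mono (filObs_anti G P h))

/-- The completed algebra of formal observables, the inverse limit of the quotients by the
filtration. -/
def CompObs : Subalgebra ℂ (∀ n, Obs G P ⧸ filAlg G P n) where
  carrier := {s | ∀ (m n : ℕ) (h : m ≤ n), Ideal.Quotient.factor (filAlg_anti G P h) (s n) = s m}
  mul_mem' {s t} hs ht := fun m n h => by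
    simp only [Pi.mul_apply, map_mul, hs m n h, ht m n h]
  add_mem' {s t} hs ht := fun m n h => by
    simp only [Pi.add_apply, map_add, hs m n h, ht m n h]
  algebraMap_mem' r := fun m n h => by
    change Ideal.Quotient.factor (filAlg_anti G P h) (Ideal.Quotient.mk _ (algebraMap ℂ _ r)) = _
    rw [Ideal.Quotient.factor_mk]
    rfl

/-- The canonical map to the completion. -/
def toComp : Obs G P →ₐ[ℂ] CompObs G P where
  toFun f := ⟨fun n => Ideal.Quotient.mk _ f, fun _ _ _ => Ideal.Quotient.factor_mk _ _⟩
  map_one' := rfl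
  map_mul' _ _ := rfl
  map_zero' := rfl
  map_add' _ _ := rfl
  commutes' _ := rfl

variable {G P}

/-- The element of the completion given by a generator. -/
def genComp (v : CplxObs G P) : CompObs G P := toComp G P (SymmetricAlgebra.ι ℂ (CplxObs G P) v)

/-- Convergence of a sequence of observables to an element of the completion. -/
def TendsToComp (f : ℕ → Obs G P) (a : CompObs G P) : Prop :=
  ∀ n, ∀ᶠ k in Filter.atTop, Ideal.Quotient.mk (filAlg G P n) (f k) = a.1 n

/-- `c` is the value at `(a, b)` of the extension by continuity of the Poisson bracket. -/
def IsBracket (a b c : CompObs G P) : Prop :=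
  ∀ f g : ℕ → Obs G P, TendsToComp f a → TendsToComp g b →
    TendsToComp (fun k => poisson (CplxObs G P) (f k) (g k)) c

open Classical in
/-- The extension by continuity of the Poisson bracket to the completion. -/
def bracketComp (a b : CompObs G P) : CompObs G P :=
  if h : ∃ c, IsBracket a b c then h.choose else 0

/-- The ideal of the completion generated by an ideal `J` of the algebra of observables: the
inverse limit of the images of `J` in the quotients by the filtration. -/
def idealComp (J : Ideal (Obs G P)) : Ideal (CompObs G P) :=
  ⨅ n, (J.map (Ideal.Quotient.mk (filAlg G P n))).comap
    ((Pi.evalRingHom (fun n => Obs G P ⧸ filAlg G P n) n).comp (CompObs G P).val.toRingHom)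

theorem mem_idealComp (J : Ideal (Obs G P)) (a : CompObs G P) :
    a ∈ idealComp J ↔ ∀ n, ∃ f ∈ J, Ideal.Quotient.mk (filAlg G P n) f = a.1 n := by
  simp only [idealComp, Ideal.mem_iInf, Ideal.mem_comap]
  refine forall_congr' fun n => ?_
  exact Ideal.mem_map_iff_of_surjective _ Ideal.Quotient.mk_surjective

variable (G P)

/-- The descending filtration on the tensor product of the affine algebra and the observables. -/
def filField (n : ℕ) : Submodule ℂ (Affine G ⊗[ℂ] CplxObs G P) :=
  Submodule.span ℂ
    ({u | ∃ X ∈ Affine.fil G n, ∃ v ∈ filObs G P n, u = X ⊗ₜ[ℂ] conjObs G P v} ∪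
     {u | ∃ X ∈ Affine.filBar G n, ∃ v ∈ filObs G P n, u = X ⊗ₜ[ℂ] v})

theorem filField_anti {m n : ℕ} (h : m ≤ n) : filField G P n ≤ filField G P m := by
  refine Submodule.span_mono ?_
  rintro u (⟨X, hX, v, hv, rfl⟩ | ⟨X, hX, v, hv, rfl⟩)
  · exact Or.inl ⟨X, Affine.fil_anti h hX, v, filObs_anti G P h hv, rfl⟩
  · exact Or.inr ⟨X, Affine.filBar_anti h hX, v, filObs_anti G P h hv, rfl⟩

/-- The space of formal fields, the completion of `𝔤̃ ⊗ 𝔤̃^D_ℂ`. -/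
def FieldSpace : Submodule ℂ (∀ n, (Affine G ⊗[ℂ] CplxObs G P) ⧸ filField G P n) where
  carrier := {s | ∀ (m n : ℕ) (h : m ≤ n), Submodule.factor (filField_anti G P h) (s n) = s m}
  add_mem' {s t} hs ht := fun m n h => by
    simp only [Pi.add_apply, map_add, hs m n h, ht m n h]
  zero_mem' := fun m n h => by simp
  smul_mem' c s hs := fun m n h => by
    simp only [Pi.smul_apply, map_smul, hs m n h]

variable {G P}

/-- The truncation `u₀ + ∑_{|n| < N} u n` of a formal sum. -/
def partialSum (u₀ : Affine G ⊗[ℂ] CplxObs G P) (u : ℤ → Affine G ⊗[ℂ] CplxObs G P) (N : ℕ) :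
    Affine G ⊗[ℂ] CplxObs G P :=
  u₀ + ∑ n ∈ Finset.Ioo (-(N : ℤ)) N, u n

theorem partialSum_compat (u₀ : Affine G ⊗[ℂ] CplxObs G P) (u : ℤ → Affine G ⊗[ℂ] CplxObs G P)
    (hu : ∀ n, u n ∈ filField G P n.natAbs) (m n : ℕ) (h : m ≤ n) :
    Submodule.factor (filField_anti G P h)
      ((filField G P n).mkQ (partialSum u₀ u n)) = (filField G P m).mkQ (partialSum u₀ u m) := by
  change (filField G P m).mkQ (partialSum u₀ u n) = _
  rw [← sub_eq_zero, ← map_sub, Submodule.mkQ_apply, Submodule.Quotient.mk_eq_zero]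
  have hs : Finset.Ioo (-(m : ℤ)) m ⊆ Finset.Ioo (-(n : ℤ)) n :=
    Finset.Ioo_subset_Ioo (by omega) (by omega)
  rw [partialSum, partialSum, ← Finset.sum_sdiff hs]
  have e : ∀ a b c : Affine G ⊗[ℂ] CplxObs G P, a + (b + c) - (a + c) = b := fun a b c => by abel
  rw [e]
  refine Submodule.sum_mem _ fun k hk => filField_anti G P ?_ (hu k)
  simp only [Finset.mem_sdiff, Finset.mem_Ioo] at hk
  omega

open Classical in
/-- The formal sum `u₀ + ∑_{n ∈ ℤ} u n`, for a family `u` which converges. -/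
def formalSum (u₀ : Affine G ⊗[ℂ] CplxObs G P) (u : ℤ → Affine G ⊗[ℂ] CplxObs G P) :
    FieldSpace G P :=
  if hu : ∀ n, u n ∈ filField G P n.natAbs then
    ⟨fun N => (filField G P N).mkQ (partialSum u₀ u N), partialSum_compat u₀ u hu⟩
  else 0

variable [FiniteDimensional ℂ 𝔤]

/-- The formal field `φ I_ã ⊗ ψ I^ã`, for the dual bases `I_{a, -n}, D, K` and `I^a_n, K, D` of the
affine algebra. -/
def formalField (φ : Affine G → Affine G) (ψ : Affine G → CplxObs G P) : FieldSpace G P :=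
  formalSum
    (φ (Affine.D G) ⊗ₜ[ℂ] ψ (Affine.K G) + φ (Affine.K G) ⊗ₜ[ℂ] ψ (Affine.D G))
    (fun n => ∑ a, φ (Affine.gen G (-n) (G.form.dualBasis G.form_nondeg (Module.finBasis ℂ 𝔤) a))
      ⊗ₜ[ℂ] ψ (Affine.gen G n (Module.finBasis ℂ 𝔤 a)))

variable (G P)

open Classical in
/-- The formal Lax matrix, as a rational function of the spectral parameter with values in the space
of formal fields. -/
def lax : RatFunc ℂ ⊗[ℂ] FieldSpace G P :=
  (T : ℂ)⁻¹ • ∑ k ∈ Finset.range T, ∑ x : {a : ℂ // a ∈ P.z}, (if (x : ℂ) = 0 then 0 else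
      ∑ p ∈ Finset.range (P.mult x),
        ((RatFunc.C (ω ^ k)⁻¹ / (RatFunc.C (ω ^ k)⁻¹ * RatFunc.X - RatFunc.C (x : ℂ)) ^ (p + 1))
            ⊗ₜ[ℂ] formalField (Affine.sigma ^ k) (obs G (some x) p) +
          if IsComplex (some x) then
            (RatFunc.C (ω ^ k)⁻¹ /
                (RatFunc.C (ω ^ k)⁻¹ * RatFunc.X - RatFunc.C (conj (x : ℂ))) ^ (p + 1))
              ⊗ₜ[ℂ] formalField (fun X => (Affine.sigma ^ k) (Affine.tau X)) (obsBar G (some x) p)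
          else 0))
  + ∑ x : {a : ℂ // a ∈ P.z}, (if (x : ℂ) = 0 then
      ∑ p ∈ Finset.range (P.mult x), ((RatFunc.X : RatFunc ℂ) ^ (p + 1))⁻¹
        ⊗ₜ[ℂ] formalField id (fun X => obs G (some x) p (Affine.eigenProj G p X))
      else 0)
  - ∑ q ∈ Finset.range (P.multInf - 1), ((RatFunc.X : RatFunc ℂ) ^ q)
      ⊗ₜ[ℂ] formalField id (fun X => obs G none (q + 1) (Affine.eigenProj G (-(q : ℤ) - 1) X))

end Completion

section Residue

/-- The substitution of `w⁻¹` for the variable, from polynomials to Laurent series in `w`. -/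
def invSubst : Polynomial ℂ →+* LaurentSeries ℂ :=
  Polynomial.eval₂RingHom HahnSeries.C (HahnSeries.single (-1 : ℤ) (1 : ℂ))

theorem invSubst_coeff (f : Polynomial ℂ) (i : ℕ) :
    (invSubst f).coeff (-(i : ℤ)) = f.coeff i := by
  induction f using Polynomial.induction_on' with
  | add f g hf hg => simp [hf, hg]
  | monomial n a =>
    rw [invSubst, Polynomial.coe_eval₂RingHom, Polynomial.eval₂_monomial, HahnSeries.single_pow,
      Polynomial.coeff_monomial, HahnSeries.C_mul_eq_smul, HahnSeries.coeff_smul,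
      HahnSeries.coeff_single]
    by_cases h : n = i
    · subst h; simp
    · have h2 : -(i : ℤ) ≠ n • (-1 : ℤ) := by simp; omega
      rw [if_neg h2, if_neg h]; simp

theorem invSubst_injective : Function.Injective invSubst := by
  rw [injective_iff_map_eq_zero]
  intro f hf
  ext i
  rw [← invSubst_coeff, hf]
  simp

/-- The Laurent expansion at infinity of a rational function, in the coordinate `w = z⁻¹`. -/
def expandInfty : RatFunc ℂ →+* LaurentSeries ℂ :=
  RatFunc.liftRingHom invSubst
    (nonZeroDivisors_le_comap_nonZeroDivisors_of_injective _ invSubst_injective)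

theorem expandInfty_algebraMap (f : Polynomial ℂ) :
    expandInfty (algebraMap _ _ f) = invSubst f := by
  have h := RatFunc.liftRingHom_apply_div invSubst
    (nonZeroDivisors_le_comap_nonZeroDivisors_of_injective _ invSubst_injective) f 1
  simpa only [expandInfty, map_one, div_one] using h

/-- The residue at infinity of the differential `f dz`. -/
def resInfty : RatFunc ℂ →ₗ[ℂ] ℂ where
  toFun f := -(expandInfty f).coeff 1
  map_add' f g := by rw [map_add, HahnSeries.coeff_add, neg_add]
  map_smul' c f := by
    rw [RatFunc.smul_eq_C_mul, map_mul, ← RatFunc.algebraMap_C, expandInfty_algebraMap, invSubst,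
      Polynomial.coe_eval₂RingHom, Polynomial.eval₂_C, HahnSeries.C_mul_eq_smul,
      HahnSeries.coeff_smul, RingHom.id_apply, smul_neg]

end Residue

section Constraint
variable (G : DihedralData T ω 𝔤) (P : Divisor ω)

/-- The formal constraint: minus the residue at infinity of the Lax differential. -/
def formalConstraint [FiniteDimensional ℂ 𝔤] : FieldSpace G P :=
  -(TensorProduct.lid ℂ (FieldSpace G P) (LinearMap.rTensor (FieldSpace G P) resInfty (lax G P)))

open Classical in
/-- The constraint `-i ∑ K^(x)_0 + i ∑ K^(conj x)_0`. -/
def constraintK : CplxObs G P :=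
  -Complex.I • ∑ x : {a : ℂ // a ∈ P.z}, obs G (some x) 0 (Affine.K G) +
    Complex.I • ∑ x : {a : ℂ // a ∈ P.z},
      if IsComplex (some x) then obsBar G (some x) 0 (Affine.K G) else 0

open Classical in
/-- The total momentum `-i ∑ D^(x)_0 + i ∑ D^(conj x)_0`. -/
def momentum : CplxObs G P :=
  -Complex.I • ∑ x : {a : ℂ // a ∈ P.z}, obs G (some x) 0 (Affine.D G) +
    Complex.I • ∑ x : {a : ℂ // a ∈ P.z},
      if IsComplex (some x) then obsBar G (some x) 0 (Affine.D G) else 0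

open Classical in
/-- The mode `∑ (y_n)^(x)_0 + ∑ (y_{-n})^(conj x)_0`. -/
def constraintMode (n : ℤ) (y : 𝔤) : CplxObs G P :=
  ∑ x : {a : ℂ // a ∈ P.z}, obs G (some x) 0 (Affine.gen G n y) +
    ∑ x : {a : ℂ // a ∈ P.z},
      if IsComplex (some x) then obsBar G (some x) 0 (Affine.gen G (-n) y) else 0

/-- The real Lie algebra of elements of `𝔤` fixed by `σ` and `τ`. -/
def fixedReal : Submodule ℝ 𝔤 where
  carrier := {x | G.σ x = x ∧ G.τ x = x}
  add_mem' {x y} hx hy := ⟨by rw [map_add, hx.1, hy.1], by rw [map_add, hx.2, hy.2]⟩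
  zero_mem' := ⟨map_zero _, map_zero _⟩
  smul_mem' c x hx := by
    refine ⟨?_, ?_⟩
    · rw [← Complex.coe_smul, map_smul, hx.1]
    · rw [← Complex.coe_smul, map_smulₛₗ, hx.2, Complex.conj_ofReal]

variable {G P}

/-- The ideal of the algebra of observables generated by `𝒦` and the modes of the constraint. -/
def constraintIdeal {ι : Type*} (I : ι → 𝔤) : Ideal (Obs G P) :=
  Ideal.span ({SymmetricAlgebra.ι ℂ _ (constraintK G P)} ∪
    Set.range fun q : ℤ × ι => SymmetricAlgebra.ι ℂ _ (constraintMode G P q.1 (I q.2)))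

/-- The ideal of the completed algebra generated by `𝒦` and the modes of the constraint. -/
def constraintIdealComp (G : DihedralData T ω 𝔤) (P : Divisor ω) {ι : Type*} (I : ι → 𝔤) :
    Ideal (CompObs G P) :=
  idealComp (constraintIdeal I)

end Constraint
end AffineGaudin

end

noncomputable section

namespace AffineGaudin

/-! ### Leibniz rules, antisymmetry and closed ideals for the Poisson bracket of a symmetric algebra
-/

section PoissonAlgebra
variable {L : Type*} [LieRing L] [LieAlgebra ℂ L]

/-! Four independent facts carry the theorem.

Continuity. Bracketing with a fixed element is continuous for the filtration
(`eventually_poisson_mem_filAlg`): by the Leibniz rule this reduces to generators, and there to the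
fact that an affine element has finitely many modes, so it shifts degrees by a bounded amount. The
bound depends on the element, so this alone does not give an extension in both variables. The second
ingredient is that each filtration ideal is closed under the bracket (`poisson_mem_filAlg`).
Splitting a convergent sequence into one fixed term plus an error in the `n`-th ideal, the fixed
term is handled by the first fact and the error by the second (`eventually_poisson_sub_mem`).

Commuting copies. The complexification of a real Takiff algebra at a point `x` is a copy of its
rotation-invariant complex Takiff algebra if `x` is fixed by a reflection, and two commuting copies
exchanged by conjugation otherwise. Thus `emb` is a complex-linear Lie homomorphism on
rotation-invariant elements, `embBar` is an antilinear one at complex points, and their images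
commute with each other (`lieObs_emb_emb`, `lieObs_embBar_emb`, `lieObs_embBar_embBar`). Hence the
diagonal sum `totalObs` of a pair `(X, Y)` turns brackets of pairs into brackets of observables
(`lieObs_totalObs`). The mode of `y` is the image of the pair `(y_n, y_{-n})`, while `𝒦` and `𝒫` are
the images of `(-iK, -iK)` and `(-iD, -iD)`. The relations are then read off from the affine
algebra.

Modes. In the residue at infinity only simple poles count, which leaves the zeroth Takiff modes
(`formalConstraint_eq`). The average over `σ ^ k` projects the canonical element of the affine
algebra to the `σ`-fixed part, where it can be written in the dual real bases; at the origin the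
same projection acts on the second factor. At conjugate points `τ` reverses the degree and the signs
of `K` and `D`, which accounts for `y_{-n}` and for the opposite signs in `𝒦` and `𝒫`. All
truncations are symmetric in `n`, so the identity holds exactly at every level
(`formalConstraint_modes`).

First class. The brackets of the generators are linear combinations of the generators, so the
uncompleted ideal is closed by Leibniz (`poisson_mem_constraintIdeal`). An element of the completed
ideal is a limit of elements of the ideal, so closure passes to the completion
(`bracketComp_mem_idealComp`). -/

theorem hamMap_apply (f : SymmetricAlgebra ℂ L) (v : L) : hamMap L f v = -(adDeriv L v f) := rfl

theorem poisson_eq_derivExt (f g : SymmetricAlgebra ℂ L) :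
    poisson L f g = derivExt L (hamMap L f) g := rfl

/-- The bracket is by construction a derivation in its second argument only. Both sides are
derivations of `h`, so it suffices to compare them on generators `v`, where `hamMap` is minus the
derivation `{v, ·}` of the first argument. -/
theorem poisson_mul_left (f g h : SymmetricAlgebra ℂ L) :
    poisson L (f * g) h = f * poisson L g h + g * poisson L f h := by
  have key : derivExt L (hamMap L (f * g)) =
      f • derivExt L (hamMap L g) + g • derivExt L (hamMap L f) := by
    refine deriv_ext_ι L fun v => ?_
    simp only [derivExt_ι, Derivation.add_apply, Derivation.smul_apply, hamMap_apply,
      Derivation.leibniz, smul_eq_mul]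
    ring
  rw [poisson_eq_derivExt, key]
  rfl

theorem poisson_algebraMap_left (r : ℂ) (h : SymmetricAlgebra ℂ L) :
    poisson L (algebraMap ℂ _ r) h = 0 := by
  have key : derivExt L (hamMap L (algebraMap ℂ (SymmetricAlgebra ℂ L) r)) = 0 := by
    refine deriv_ext_ι L fun v => ?_
    rw [derivExt_ι, hamMap_apply, Derivation.map_algebraMap, neg_zero]
    rfl
  rw [poisson_eq_derivExt, key]
  rfl

theorem poisson_algebraMap_right (r : ℂ) (h : SymmetricAlgebra ℂ L) :
    poisson L h (algebraMap ℂ _ r) = 0 := by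
  rw [poisson_eq_derivExt, Derivation.map_algebraMap]

theorem poisson_skew (f g : SymmetricAlgebra ℂ L) : poisson L f g = -poisson L g f := by
  induction f using SymmetricAlgebra.induction with
  | algebraMap r => rw [poisson_algebraMap_left, poisson_algebraMap_right, neg_zero]
  | ι v =>
    rw [poisson_ι_left, poisson_eq_derivExt, derivExt_ι, hamMap_apply, neg_neg]
  | mul a b ha hb => rw [poisson_mul_left, poisson_mul_right, ha, hb]; ring
  | add a b ha hb => rw [map_add, LinearMap.add_apply, map_add, ha, hb, neg_add]

/-- An ideal is closed under the Poisson bracket if the brackets of its generators lie in it. -/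
theorem poisson_mem_span {s : Set (SymmetricAlgebra ℂ L)}
    (h : ∀ a ∈ s, ∀ b ∈ s, poisson L a b ∈ Ideal.span s) {f g : SymmetricAlgebra ℂ L}
    (hf : f ∈ Ideal.span s) (hg : g ∈ Ideal.span s) : poisson L f g ∈ Ideal.span s := by
  induction hf using Submodule.span_induction with
  | mem a ha =>
    induction hg using Submodule.span_induction with
    | mem b hb => exact h a ha b hb
    | zero => rw [map_zero]; exact zero_mem _
    | add x y _ _ hx hy => rw [map_add]; exact add_mem hx hy
    | smul c x hx hx' =>
      rw [smul_eq_mul, poisson_mul_right]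
      exact add_mem (Ideal.mul_mem_left _ _ hx') (Ideal.mul_mem_right _ _ hx)
  | zero => rw [map_zero]; exact zero_mem _
  | add x y _ _ hx hy => rw [map_add]; exact add_mem hx hy
  | smul c x hx hx' =>
    rw [smul_eq_mul, poisson_mul_left]
    exact add_mem (Ideal.mul_mem_left _ _ hx') (Ideal.mul_mem_right _ _ hx)

/-- In `{v, c x} = c {v, x} + x {v, c}` the second term still contains `x` itself; this is why `A ⊆
B` is needed besides the condition on brackets. -/
theorem poisson_ι_mem_span {A B : Set L} {v : L} (hAB : A ⊆ B) (h : ∀ a ∈ A, ⁅v, a⁆ ∈ B)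
    {f : SymmetricAlgebra ℂ L} (hf : f ∈ Ideal.span (SymmetricAlgebra.ι ℂ L '' A)) :
    poisson L (SymmetricAlgebra.ι ℂ L v) f ∈ Ideal.span (SymmetricAlgebra.ι ℂ L '' B) := by
  induction hf using Submodule.span_induction with
  | mem x hx =>
    obtain ⟨a, ha, rfl⟩ := hx
    rw [poisson_ι_ι]
    exact Ideal.subset_span ⟨_, h a ha, rfl⟩
  | zero => rw [map_zero]; exact zero_mem _
  | add x y _ _ hx hy => rw [map_add]; exact add_mem hx hy
  | smul c x hx hx' =>
    rw [smul_eq_mul, poisson_mul_right]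
    exact add_mem (Ideal.mul_mem_left _ _ hx')
      (Ideal.mul_mem_right _ _ (Ideal.span_mono (Set.image_mono hAB) hx))

/-- Continuity of the bracket with a fixed element, for the ideals generated by a descending
filtration of the Lie algebra. -/
theorem eventually_poisson_mem_span {A : ℕ → Set L} (hA : Antitone A)
    (h : ∀ (v : L) (n : ℕ), ∀ᶠ m in Filter.atTop, ∀ a ∈ A m, ⁅v, a⁆ ∈ A n) (g : SymmetricAlgebra ℂ L) (n : ℕ) :
    ∀ᶠ m in Filter.atTop, ∀ f ∈ Ideal.span (SymmetricAlgebra.ι ℂ L '' A m),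
      poisson L g f ∈ Ideal.span (SymmetricAlgebra.ι ℂ L '' A n) := by
  induction g using SymmetricAlgebra.induction with
  | algebraMap r =>
    refine Filter.Eventually.of_forall fun m f _ => ?_
    rw [poisson_algebraMap_left]; exact zero_mem _
  | ι v =>
    filter_upwards [h v n, Filter.eventually_ge_atTop n] with m hm hmn f hf
    exact poisson_ι_mem_span (hA hmn) hm hf
  -- The Leibniz rule in the first slot keeps `f` inside a single bracket, so an `m` that serves
  -- both factors serves the product.
  | mul a b ha hb =>
    filter_upwards [ha, hb] with m ha hb f hf
    rw [poisson_mul_left]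
    exact add_mem (Ideal.mul_mem_left _ _ (hb f hf)) (Ideal.mul_mem_left _ _ (ha f hf))
  | add a b ha hb =>
    filter_upwards [ha, hb] with m ha hb f hf
    rw [map_add, LinearMap.add_apply]
    exact add_mem (ha f hf) (hb f hf)

theorem poisson_mem_span_of_lie {A : Set L} (h : ∀ a ∈ A, ∀ b ∈ A, ⁅a, b⁆ ∈ A)
    {f g : SymmetricAlgebra ℂ L} (hf : f ∈ Ideal.span (SymmetricAlgebra.ι ℂ L '' A))
    (hg : g ∈ Ideal.span (SymmetricAlgebra.ι ℂ L '' A)) :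
    poisson L f g ∈ Ideal.span (SymmetricAlgebra.ι ℂ L '' A) := by
  refine poisson_mem_span ?_ hf hg
  rintro _ ⟨a, ha, rfl⟩ _ ⟨b, hb, rfl⟩
  rw [poisson_ι_ι]
  exact Ideal.subset_span ⟨_, h a ha b hb, rfl⟩

end PoissonAlgebra

/-! ### The dihedral action on the affine and Takiff algebras, and their filtrations -/

section
open Divisor
variable {T : ℕ} {ω : ℂ} {𝔤 : Type*} [LieRing 𝔤] [LieAlgebra ℂ 𝔤] {G : DihedralData T ω 𝔤}
  {P : Divisor ω}

theorem loopBracket_apply_eq_zero {f g : ℤ →₀ 𝔤} {p : ℤ}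
    (h : ∀ m n, f m ≠ 0 → g n ≠ 0 → m + n ≠ p) : loopBracket 𝔤 f g p = 0 := by
  rw [← Finsupp.sum_single f, ← Finsupp.sum_single g]
  simp only [Finsupp.sum, map_sum, LinearMap.sum_apply, loopBracket_single, Finsupp.finsetSum_apply]
  refine Finset.sum_eq_zero fun n hn => Finset.sum_eq_zero fun m hm => ?_
  rw [Finsupp.single_eq_of_ne]
  exact (h _ _ (Finsupp.mem_support_iff.1 hm) (Finsupp.mem_support_iff.1 hn)).symm

/-- Degrees `m = n = 0` may both occur: the factor `m` of the cocycle kills that term. This is what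
makes level zero of the filtration closed under the bracket. -/
theorem loopCocycle_eq_zero {B : LinearMap.BilinForm ℂ 𝔤} {f g : ℤ →₀ 𝔤}
    (h : ∀ m n, f m ≠ 0 → g n ≠ 0 → m + n = 0 → m = 0) : loopCocycle B f g = 0 := by
  rw [← Finsupp.sum_single f, ← Finsupp.sum_single g]
  simp only [Finsupp.sum, map_sum, LinearMap.sum_apply, loopCocycle_single]
  refine Finset.sum_eq_zero fun m hm => Finset.sum_eq_zero fun n hn => ?_
  split_ifs with e
  · rw [h _ _ (Finsupp.mem_support_iff.1 hn) (Finsupp.mem_support_iff.1 hm) e]; simp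
  · rfl

theorem loopDegree_apply (f : ℤ →₀ 𝔤) (n : ℤ) : loopDegree 𝔤 f n = (n : ℂ) • f n := by
  induction f using Finsupp.induction_linear with
  | zero => simp
  | add a b ha hb => simp [ha, hb]
  | single m x =>
    rw [loopDegree_single, Finsupp.smul_apply]
    by_cases h : n = m
    · subst h; rfl
    · rw [Finsupp.single_eq_of_ne h, smul_zero, smul_zero]

namespace Affine

theorem tau_tau (X : Affine G) : tau (tau X) = X := by
  refine ext_lin (f := fun X => tau (tau X)) (g := id) (by simp) (by simp) (fun n x => ?_)
    (fun a => ?_) (fun a => ?_) X <;> simp [G.tau_tau]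

theorem sigma_tau_sigma (X : Affine G) : sigma (tau (sigma X)) = tau X := by
  refine ext_lin (f := fun X => sigma (tau (sigma X))) (g := tau) (by simp) (by simp)
    (fun n x => ?_) (fun a => ?_) (fun a => ?_) X
  · have := G.sigma_tau (G.τ x)
    rw [G.tau_tau] at this
    simp [this]
  · simp
  · simp

/-- The dihedral relation `σ τ σ = τ`, applied from the inside out: one factor `σ` is peeled off on
each side of `τ`. -/
theorem sigma_pow_tau_sigma_pow (k : ℕ) (X : Affine G) :
    (sigma ^ k) (tau ((sigma ^ k) X)) = tau X := by
  induction k generalizing X with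
  | zero => simp
  | succ k ih =>
    rw [pow_succ, Module.End.mul_apply, ← pow_succ, pow_succ', Module.End.mul_apply,
      sigma_tau_sigma, ih]

theorem sigma_pow_period (X : Affine G) : (sigma ^ T) X = X := by
  have hgen : ∀ (k : ℕ) n x, (sigma ^ k) (gen G n x) = gen G n (G.σ^[k] x) := by
    intro k n x
    induction k with
    | zero => simp
    | succ k ih => rw [pow_succ', Module.End.mul_apply, ih, sigma_gen, Function.iterate_succ_apply']
  have hK : ∀ k : ℕ, (sigma ^ k) (K G) = K G := by
    intro k
    induction k with
    | zero => simp
    | succ k ih => rw [pow_succ', Module.End.mul_apply, ih, sigma_K]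
  have hD : ∀ k : ℕ, (sigma ^ k) (D G) = D G := by
    intro k
    induction k with
    | zero => simp
    | succ k ih => rw [pow_succ', Module.End.mul_apply, ih, sigma_D]
  refine ext_lin (f := fun X => (sigma ^ T) X) (g := id) (by simp) (by simp)
    (fun n x => ?_) (fun a => ?_) (fun a => ?_) X
  · simp [hgen, G.sigma_pow]
  · simp [hK]
  · simp [hD]

theorem sigma_pow_eq_self {X : Affine G} (h : sigma X = X) (k : ℕ) : (sigma ^ k) X = X := by
  induction k with
  | zero => simp
  | succ k ih => rw [pow_succ', Module.End.mul_apply, ih, h]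

/-- Degrees at least `n ≥ 0` add up to at least `n`, and the central term vanishes because two
nonnegative degrees with sum zero are both zero. -/
theorem lie_mem_fil {n : ℕ} {X Y : Affine G} (hX : X ∈ fil G n) (hY : Y ∈ fil G n) :
    ⁅X, Y⁆ ∈ fil G n := by
  have hX' : ∀ m, X.loop m ≠ 0 → (n : ℤ) ≤ m := fun m hm => by
    by_contra h; exact hm (hX.2.2 m (by omega))
  have hY' : ∀ m, Y.loop m ≠ 0 → (n : ℤ) ≤ m := fun m hm => by
    by_contra h; exact hm (hY.2.2 m (by omega))
  refine ⟨loopCocycle_eq_zero fun p q hp hq h => ?_, rfl, fun p hp => ?_⟩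
  · have := hX' p hp; have := hY' q hq; omega
  · change (loopBracket 𝔤 X.loop Y.loop + X.d • loopDegree 𝔤 Y.loop
      - Y.d • loopDegree 𝔤 X.loop) p = 0
    rw [hX.2.1, hY.2.1, zero_smul, zero_smul, sub_zero, add_zero]
    refine loopBracket_apply_eq_zero fun k l hk hl h => ?_
    have := hX' k hk; have := hY' l hl; omega

theorem eventually_lie_mem_fil (X : Affine G) (n : ℕ) :
    ∀ᶠ m in Filter.atTop, ∀ Z ∈ fil G m, ⁅X, Z⁆ ∈ fil G n := by
  obtain ⟨r, hr⟩ := X.loop.support.bddBelow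
  have hX : ∀ m, X.loop m ≠ 0 → r ≤ m := fun m hm => hr (Finsupp.mem_support_iff.2 hm)
  -- The shift by `|r|` compensates the lowest degree `r` of `X`; the extra `1` makes every sum of
  -- degrees positive even for `n = 0`, so that no central term appears.
  filter_upwards [Filter.eventually_ge_atTop (n + r.natAbs + 1)] with m hm Z hZ
  have hZ' : ∀ k, Z.loop k ≠ 0 → (m : ℤ) ≤ k := fun k hk => by
    by_contra h; exact hk (hZ.2.2 k (by omega))
  refine ⟨loopCocycle_eq_zero fun p q hp hq h => ?_, rfl, fun p hp => ?_⟩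
  · have := hX p hp; have := hZ' q hq; omega
  · change (loopBracket 𝔤 X.loop Z.loop + X.d • loopDegree 𝔤 Z.loop
      - Z.d • loopDegree 𝔤 X.loop) p = 0
    rw [hZ.2.1, zero_smul, sub_zero, Finsupp.add_apply, Finsupp.smul_apply, loopDegree_apply,
      hZ.2.2 p (by omega), smul_zero, smul_zero, add_zero]
    refine loopBracket_apply_eq_zero fun k l hk hl h => ?_
    have := hX k hk; have := hZ' l hl; omega

theorem sigma_mem_fil {n : ℕ} {X : Affine G} (hX : X ∈ fil G n) : sigma X ∈ fil G n :=
  ⟨hX.1, hX.2.1, fun m hm => by rw [sigma_loop, Finsupp.mapRange_apply, hX.2.2 m hm, map_zero]⟩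

theorem sigma_mem_filBar {n : ℕ} {X : Affine G} (hX : X ∈ filBar G n) : sigma X ∈ filBar G n :=
  ⟨hX.1, hX.2.1, fun m hm => by rw [sigma_loop, Finsupp.mapRange_apply, hX.2.2 m hm, map_zero]⟩

theorem sigma_pow_mem_fil {n : ℕ} {X : Affine G} (hX : X ∈ fil G n) (k : ℕ) :
    (sigma ^ k) X ∈ fil G n := by
  induction k with
  | zero => simpa using hX
  | succ k ih => rw [pow_succ', Module.End.mul_apply]; exact sigma_mem_fil ih

theorem sigma_pow_mem_filBar {n : ℕ} {X : Affine G} (hX : X ∈ filBar G n) (k : ℕ) :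
    (sigma ^ k) X ∈ filBar G n := by
  induction k with
  | zero => simpa using hX
  | succ k ih => rw [pow_succ', Module.End.mul_apply]; exact sigma_mem_filBar ih

theorem tau_loop_apply (X : Affine G) (m : ℤ) : (tau X).loop m = G.τ (X.loop (-m)) := by
  rw [tau_loop, Finsupp.equivMapDomain_apply, Finsupp.mapRange_apply]
  rfl

theorem tau_mem_filBar {n : ℕ} {X : Affine G} (hX : X ∈ fil G n) : tau X ∈ filBar G n := by
  refine ⟨?_, ?_, fun m hm => ?_⟩
  · change -conj X.k = 0
    rw [hX.1, map_zero, neg_zero]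
  · change -conj X.d = 0
    rw [hX.2.1, map_zero, neg_zero]
  · rw [tau_loop_apply, hX.2.2 _ (by omega), map_zero]

theorem tau_mem_fil {n : ℕ} {X : Affine G} (hX : X ∈ filBar G n) : tau X ∈ fil G n := by
  refine ⟨?_, ?_, fun m hm => ?_⟩
  · change -conj X.k = 0
    rw [hX.1, map_zero, neg_zero]
  · change -conj X.d = 0
    rw [hX.2.1, map_zero, neg_zero]
  · rw [tau_loop_apply, hX.2.2 _ (by omega), map_zero]

/-- The involution `τ` is an automorphism for the bracket and exchanges the two filtrations, so
everything on `filBar` is transported from `fil`. -/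
theorem lie_mem_filBar {n : ℕ} {X Y : Affine G} (hX : X ∈ filBar G n) (hY : Y ∈ filBar G n) :
    ⁅X, Y⁆ ∈ filBar G n := by
  rw [← tau_tau ⁅X, Y⁆, tau_lie]
  exact tau_mem_filBar (lie_mem_fil (tau_mem_fil hX) (tau_mem_fil hY))

theorem eventually_lie_mem_filBar (X : Affine G) (n : ℕ) :
    ∀ᶠ m in Filter.atTop, ∀ Z ∈ filBar G m, ⁅X, Z⁆ ∈ filBar G n := by
  filter_upwards [eventually_lie_mem_fil (tau X) n] with m hm Z hZ
  rw [← tau_tau ⁅X, Z⁆, tau_lie]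
  exact tau_mem_filBar (hm _ (tau_mem_fil hZ))

theorem gen_mem_fil {m : ℤ} {n : ℕ} (h : (n : ℤ) ≤ m) (x : 𝔤) : gen G m x ∈ fil G n :=
  ⟨rfl, rfl, fun k hk => Finsupp.single_eq_of_ne (by omega)⟩

theorem gen_mem_filBar {m : ℤ} {n : ℕ} (h : m ≤ -(n : ℤ)) (x : 𝔤) : gen G m x ∈ filBar G n :=
  ⟨rfl, rfl, fun k hk => Finsupp.single_eq_of_ne (by omega)⟩

end Affine

namespace Takiff
variable {n : ℕ}

theorem lie_apply_mem {F : Submodule ℂ (Affine G)} (hF : ∀ X ∈ F, ∀ Y ∈ F, ⁅X, Y⁆ ∈ F)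
    {Y Z : Takiff G n} (hY : ∀ p, Y p ∈ F) (hZ : ∀ p, Z p ∈ F) (p : Fin n) : ⁅Y, Z⁆ p ∈ F := by
  rw [lie_apply]
  refine Submodule.sum_mem _ fun i _ => Submodule.sum_mem _ fun j _ => ?_
  split_ifs
  · exact hF _ (hY i) _ (hZ j)
  · exact zero_mem _

theorem eventually_lie_apply_mem {F : ℕ → Submodule ℂ (Affine G)}
    (hF : ∀ (X : Affine G) (k : ℕ), ∀ᶠ m in Filter.atTop, ∀ Z ∈ F m, ⁅X, Z⁆ ∈ F k)
    (Y : Takiff G n) (k : ℕ) :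
    ∀ᶠ m in Filter.atTop, ∀ Z : Takiff G n, (∀ p, Z p ∈ F m) → ∀ p, ⁅Y, Z⁆ p ∈ F k := by
  have h : ∀ᶠ m in Filter.atTop, ∀ i : Fin n, ∀ Z ∈ F m, ⁅Y i, Z⁆ ∈ F k :=
    Filter.eventually_all.2 fun i => hF (Y i) k
  filter_upwards [h] with m hm Z hZ p
  rw [lie_apply]
  refine Submodule.sum_mem _ fun i _ => Submodule.sum_mem _ fun j _ => ?_
  split_ifs
  · exact hm i _ (hZ j)
  · exact zero_mem _

/-- The scalar comes out of the antilinear map conjugated, so the two powers of `ζ` cancel since `ζ`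
has modulus one, and `σ ^ k τ` is an involution. -/
theorem refl_refl {ζ : ℂ} (hζ : ζ * conj ζ = 1) (k : ℕ) (Y : Takiff G n) :
    refl ζ k (refl ζ k Y) = Y := by
  funext p
  simp only [refl, map_smulₛₗ, map_pow, smul_smul, ← mul_pow, hζ, one_pow, one_smul,
    Affine.sigma_pow_tau_sigma_pow, Affine.tau_tau, RingHom.id_apply]

theorem rot_refl_rot {ζ : ℂ} (hζ : ζ * conj ζ = 1) (j k : ℕ) (Y : Takiff G n) :
    rot ζ j (refl ζ k (rot ζ j Y)) = refl ζ k Y := by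
  funext p
  simp only [rot, refl, map_smulₛₗ, map_pow, smul_smul, RingHom.id_apply]
  rw [← Module.End.mul_apply, ← pow_add, add_comm j k, pow_add, Module.End.mul_apply,
    Affine.sigma_pow_tau_sigma_pow, mul_left_comm, ← mul_pow, hζ, one_pow, mul_one]

theorem rot_refl (ζ : ℂ) (j k : ℕ) (Y : Takiff G n) : rot ζ j (refl ζ k Y) = refl ζ (j + k) Y := by
  funext p
  simp only [rot, refl, map_smul, smul_smul, ← pow_add, ← add_mul]
  rw [← Module.End.mul_apply, ← pow_add]

theorem rot_single (ζ : ℂ) (k p : ℕ) (X : Affine G) :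
    rot ζ k (single n p X) = single n p (ζ ^ (k * p) • (Affine.sigma ^ k) X) := by
  funext q
  simp only [rot, single]
  split_ifs with h
  · rw [h]
  · simp

theorem refl_single (ζ : ℂ) (k p : ℕ) (X : Affine G) :
    refl ζ k (single n p X) = single n p (ζ ^ (k * p) • (Affine.sigma ^ k) (Affine.tau X)) := by
  funext q
  simp only [refl, single]
  split_ifs with h
  · rw [h]
  · simp

theorem single_add (p : ℕ) (X Y : Affine G) :
    single n p (X + Y) = single n p X + single n p Y := by
  funext q
  simp only [single, add_apply]
  split_ifs <;> simp

theorem single_smul (p : ℕ) (c : ℂ) (X : Affine G) : single n p (c • X) = c • single n p X := by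
  funext q
  simp only [single, smul_apply]
  split_ifs <;> simp

theorem single_mem {F : Submodule ℂ (Affine G)} (p : ℕ) {X : Affine G} (hX : X ∈ F) (q : Fin n) :
    single n p X q ∈ F := by
  simp only [single]
  split_ifs
  · exact hX
  · exact zero_mem _

theorem single_zero_lie_single_zero (X Y : Affine G) :
    ⁅single n 0 X, single n 0 Y⁆ = single n 0 ⁅X, Y⁆ := by
  funext p
  rw [lie_apply]
  have h0 : 0 < n := by have := p.2; omega
  rw [Finset.sum_eq_single ⟨0, h0⟩, Finset.sum_eq_single ⟨0, h0⟩]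
  · simp [single, eq_comm]
  · intro b _ hb
    have : (b : ℕ) ≠ 0 := fun e => hb (Fin.ext e)
    simp [single, this]
  · simp
  · intro b _ hb
    have : (b : ℕ) ≠ 0 := fun e => hb (Fin.ext e)
    simp [single, this]
  · simp

theorem single_K_lie (p : ℕ) (Y : Takiff G n) : ⁅single n p (Affine.K G), Y⁆ = 0 := by
  funext q
  rw [lie_apply]
  refine Finset.sum_eq_zero fun i _ => Finset.sum_eq_zero fun j _ => ?_
  simp only [single]
  split_ifs <;> simp

end Takiff

/-! ### Stabilisers of points and the projection to the real form -/

theorem mul_conj_eq_one_of_isPrimitiveRoot (hT : 0 < T) (hω : IsPrimitiveRoot ω T) :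
    ω * conj ω = 1 := by
  rw [Complex.mul_conj, Complex.normSq_eq_norm_sq, hω.norm'_eq_one hT.ne']
  simp

theorem zeta_mul_conj (hT : 0 < T) (hω : IsPrimitiveRoot ω T) (x : P.Pt) :
    zeta x * conj (zeta x) = 1 := by
  have h := mul_conj_eq_one_of_isPrimitiveRoot hT hω
  cases x with
  | none => exact h
  | some a =>
    change ω⁻¹ * conj ω⁻¹ = 1
    rw [map_inv₀, ← mul_inv, h, inv_one]

theorem reflFixes_reflIndex {x : P.Pt} (hx : ¬ IsComplex x) : ReflFixes x (reflIndex x) := by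
  classical
  have h : ∃ k, ReflFixes x k := by simpa [IsComplex] using hx
  rw [reflIndex, dif_pos h]
  convert Nat.find_spec h

theorem rotFixes_sub {x : P.Pt} {j k : ℕ} (hj : ReflFixes x j) (hk : ReflFixes x (k + j)) :
    RotFixes x k := by
  cases x with
  | none => trivial
  | some a =>
    change ω ^ j * conj (a : ℂ) = a at hj
    change ω ^ (k + j) * conj (a : ℂ) = a at hk
    change ω ^ k * (a : ℂ) = a
    rw [pow_add, mul_assoc, hj] at hk
    exact hk

theorem refl_mem_takiffRot (hT : 0 < T) (hω : IsPrimitiveRoot ω T) {x : P.Pt} (k : ℕ)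
    {Y : Takiff G (order x)} (hY : Y ∈ takiffRot G x) :
    Takiff.refl (zeta x) k Y ∈ takiffRot G x := by
  refine ⟨fun h p hp => ?_, fun j hj => ?_⟩
  · rw [Takiff.refl, hY.1 h p hp, map_zero, map_zero, smul_zero]
  · conv_lhs => rw [← hY.2 j hj]
    exact Takiff.rot_refl_rot (zeta_mul_conj hT hω x) j k Y

/-- Two reflections fixing `x` differ by a rotation fixing `x`, which acts trivially on
rotation-invariant elements. Hence invariance under the single reflection of index `reflIndex x`
already gives invariance under all of them. -/
theorem refl_eq_refl (hT : 0 < T) (hω : IsPrimitiveRoot ω T) {x : P.Pt} {j k : ℕ}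
    (hj : ReflFixes x j) (hk : ReflFixes x k) {Y : Takiff G (order x)} (hY : Y ∈ takiffRot G x) :
    Takiff.refl (zeta x) j Y = Takiff.refl (zeta x) k Y := by
  wlog h : j ≤ k generalizing j k
  · exact (this hk hj (le_of_not_ge h)).symm
  · obtain ⟨l, rfl⟩ := Nat.exists_eq_add_of_le' h
    rw [← Takiff.rot_refl]
    exact ((refl_mem_takiffRot hT hω j hY).2 l (rotFixes_sub hj hk)).symm

theorem lie_mem_takiffRot {x : P.Pt} {X Y : Takiff G (order x)} (hX : X ∈ takiffRot G x)
    (hY : Y ∈ takiffRot G x) : ⁅X, Y⁆ ∈ takiffRot G x := by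
  refine ⟨fun h p hp => ?_, fun k hk => ?_⟩
  · rw [Takiff.lie_apply]
    refine Finset.sum_eq_zero fun i _ => Finset.sum_eq_zero fun j _ => ?_
    split_ifs with hij
    · rw [hX.1 h i (by omega), zero_lie]
    · rfl
  · rw [Takiff.rot_lie, hX.2 k hk, hY.2 k hk]

theorem mem_takiffReal_of_isComplex {x : P.Pt} (hx : IsComplex x) {Y : Takiff G (order x)}
    (hY : Y ∈ takiffRot G x) : Y ∈ takiffReal G x :=
  ⟨hY, fun k hk => absurd hk (hx k)⟩

open Classical in
/-- Twice the projection to the real form at a real point, the identity at a complex point. -/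
def realProj (G : DihedralData T ω 𝔤) (x : P.Pt) (Y : Takiff G (order x)) : Takiff G (order x) :=
  if IsComplex x then Y else Y + Takiff.refl (zeta x) (reflIndex x) Y

theorem realProj_mem (hT : 0 < T) (hω : IsPrimitiveRoot ω T) {x : P.Pt} {Y : Takiff G (order x)}
    (hY : Y ∈ takiffRot G x) : realProj G x Y ∈ takiffReal G x := by
  unfold realProj
  split_ifs with hx
  · exact mem_takiffReal_of_isComplex hx hY
  · refine ⟨add_mem hY (refl_mem_takiffRot hT hω _ hY), fun k hk => ?_⟩
    rw [refl_eq_refl hT hω hk (reflFixes_reflIndex hx)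
      (add_mem hY (refl_mem_takiffRot hT hω _ hY)), Takiff.refl_add,
      Takiff.refl_refl (zeta_mul_conj hT hω x), add_comm]

theorem realProj_add (x : P.Pt) (Y Z : Takiff G (order x)) :
    realProj G x (Y + Z) = realProj G x Y + realProj G x Z := by
  unfold realProj
  split_ifs
  · rfl
  · rw [Takiff.refl_add]; abel

theorem realProj_real_smul (x : P.Pt) (r : ℝ) (Y : Takiff G (order x)) :
    realProj G x ((r : ℂ) • Y) = r • realProj G x Y := by
  unfold realProj
  split_ifs
  · exact Complex.coe_smul _ _
  · rw [Takiff.refl_smul, Complex.conj_ofReal, ← smul_add, Complex.coe_smul]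

/-- An element of the real form is fixed by the reflection, so its adjoint action commutes with that
reflection. -/
theorem realProj_lie {x : P.Pt} {Y Z : Takiff G (order x)} (hY : Y ∈ takiffReal G x) :
    realProj G x ⁅Y, Z⁆ = ⁅Y, realProj G x Z⁆ := by
  unfold realProj
  split_ifs with hx
  · rfl
  · rw [Takiff.refl_lie, hY.2 _ (reflFixes_reflIndex hx), lie_add]

theorem realProj_refl (hT : 0 < T) (hω : IsPrimitiveRoot ω T) {x : P.Pt} (hx : ¬ IsComplex x)
    (Y : Takiff G (order x)) :
    realProj G x (Takiff.refl (zeta x) (reflIndex x) Y) = realProj G x Y := by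
  rw [realProj, realProj, if_neg hx, if_neg hx, Takiff.refl_refl (zeta_mul_conj hT hω x), add_comm]

/-- This recovers `Y` from its real and imaginary parts: at a real point the two reflected terms
cancel because the reflection is antilinear. It is used to pass from brackets with real elements to
brackets of `emb`. -/
theorem realProj_sub_I (x : P.Pt) (Y : Takiff G (order x)) :
    realProj G x Y - Complex.I • realProj G x (Complex.I • Y) = (2 : ℂ) • Y := by
  unfold realProj
  split_ifs
  · rw [smul_smul, Complex.I_mul_I, two_smul, neg_one_smul, sub_neg_eq_add]
  · rw [Takiff.refl_smul, smul_add, smul_smul, smul_smul, Complex.I_mul_I, Complex.conj_I, mul_neg,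
      Complex.I_mul_I, two_smul, neg_neg, one_smul, neg_one_smul]
    abel

/-! ### Pure tensors, Lie bracket and conjugation in the complexification -/

open Classical in
/-- `a ⊗ Y` as a function of an element of the real Takiff algebra. -/
def tmulReal (x : P.Pt) (a : ℂ) : takiffReal G x →ₗ[ℝ] CplxObs G P :=
  (TensorProduct.mk ℝ ℂ (RealObs G P) a) ∘ₗ DirectSum.lof ℝ P.Pt (fun x => takiffReal G x) x

theorem scaled_of_mem {x : P.Pt} (a : ℂ) {Y : Takiff G (order x)} (h : Y ∈ takiffReal G x) :
    scaled G x a Y = tmulReal x a ⟨Y, h⟩ := by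
  rw [scaled, dif_pos h]
  rfl

theorem scaled_add_right {x : P.Pt} (a : ℂ) {Y Z : Takiff G (order x)} (hY : Y ∈ takiffReal G x)
    (hZ : Z ∈ takiffReal G x) : scaled G x a (Y + Z) = scaled G x a Y + scaled G x a Z := by
  rw [scaled_of_mem a hY, scaled_of_mem a hZ, scaled_of_mem a (add_mem hY hZ), ← map_add]
  rfl

theorem scaled_real_smul {x : P.Pt} (a : ℂ) (r : ℝ) {Y : Takiff G (order x)}
    (hY : Y ∈ takiffReal G x) : scaled G x a (r • Y) = scaled G x (r * a) Y := by
  rw [scaled_of_mem a ((takiffReal G x).smul_mem r hY), scaled_of_mem (r * a) hY]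
  change tmulReal x a (r • ⟨Y, hY⟩) = _
  rw [map_smul]
  change r • (a ⊗ₜ[ℝ] _) = (r * a) ⊗ₜ[ℝ] _
  rw [TensorProduct.smul_tmul', Complex.real_smul]

theorem smul_scaled {x : P.Pt} (a b : ℂ) (Y : Takiff G (order x)) :
    b • scaled G x a Y = scaled G x (b * a) Y := by
  unfold scaled
  split_ifs
  · exact TensorProduct.smul_tmul' _ _ _
  · rw [smul_zero]

theorem conjObs_scaled {x : P.Pt} (a : ℂ) (Y : Takiff G (order x)) :
    conjObs G P (scaled G x a Y) = scaled G x (conj a) Y := by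
  unfold scaled
  split_ifs
  · exact LinearMap.rTensor_tmul _ _ _ _
  · rw [map_zero]

variable (G P) in
/-- The Lie bracket of the complexified observables, as a bilinear map. -/
def lieObs : CplxObs G P →ₗ[ℂ] CplxObs G P →ₗ[ℂ] CplxObs G P :=
  (LieModule.toEnd ℂ (CplxObs G P) (CplxObs G P) : CplxObs G P →ₗ[ℂ] Module.End ℂ (CplxObs G P))

theorem lieObs_tmul (a b : ℂ) (X Y : RealObs G P) :
    lieObs G P (a ⊗ₜ[ℝ] X) (b ⊗ₜ[ℝ] Y) = (a * b) ⊗ₜ[ℝ] ⁅X, Y⁆ := rfl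

theorem poisson_ι_eq_lieObs (u v : CplxObs G P) :
    poisson (CplxObs G P) (SymmetricAlgebra.ι ℂ _ u) (SymmetricAlgebra.ι ℂ _ v) =
      SymmetricAlgebra.ι ℂ _ (lieObs G P u v) := poisson_ι_ι _ u v

theorem lieObs_skew (u v : CplxObs G P) : lieObs G P u v = -lieObs G P v u :=
  (lie_skew u v).symm

open Classical in
theorem lieObs_tmul_scaled (a b : ℂ) (x : P.Pt) (Y : takiffReal G x) {Z : Takiff G (order x)}
    (hZ : Z ∈ takiffReal G x) :
    lieObs G P (a ⊗ₜ[ℝ] DirectSum.lof ℝ P.Pt (fun x => takiffReal G x) x Y) (scaled G x b Z) =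
      scaled G x (a * b) ⁅(Y : Takiff G (order x)), Z⁆ := by
  rw [scaled_of_mem b hZ, scaled_of_mem _ ((takiffReal G x).lie_mem Y.2 hZ)]
  refine (lieObs_tmul _ _ _ _).trans ?_
  change _ = (a * b) ⊗ₜ[ℝ] DirectSum.lof ℝ P.Pt (fun x => takiffReal G x) x
    ⁅Y, (⟨Z, hZ⟩ : takiffReal G x)⁆
  congr 1
  exact DirectSum.lie_of_same (fun x => takiffReal G x) Y ⟨Z, hZ⟩

open Classical in
theorem lieObs_tmul_scaled_of_ne {x y : P.Pt} (hxy : x ≠ y) (a b : ℂ) (Y : takiffReal G x)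
    (Z : Takiff G (order y)) :
    lieObs G P (a ⊗ₜ[ℝ] DirectSum.lof ℝ P.Pt (fun x => takiffReal G x) x Y)
      (scaled G y b Z) = 0 := by
  by_cases hZ : Z ∈ takiffReal G y
  · rw [scaled_of_mem b hZ]
    refine (lieObs_tmul _ _ _ _).trans ?_
    refine (congrArg (fun u => (a * b) ⊗ₜ[ℝ] u) ?_).trans (TensorProduct.tmul_zero _ _)
    exact DirectSum.lie_of_of_ne (fun x => takiffReal G x) hxy _ _
  · rw [scaled, dif_neg hZ, map_zero]

theorem lieObs_scaled_of_ne {x y : P.Pt} (hxy : x ≠ y) (a b : ℂ) (Y : Takiff G (order x))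
    (Z : Takiff G (order y)) : lieObs G P (scaled G x a Y) (scaled G y b Z) = 0 := by
  by_cases hY : Y ∈ takiffReal G x
  · rw [scaled_of_mem a hY]
    exact lieObs_tmul_scaled_of_ne hxy a b ⟨Y, hY⟩ Z
  · rw [scaled, dif_neg hY, map_zero, LinearMap.zero_apply]

theorem conjObs_tmul (a : ℂ) (X : RealObs G P) : conjObs G P (a ⊗ₜ[ℝ] X) = conj a ⊗ₜ[ℝ] X := rfl

theorem conj_half : conj (1 / 2 : ℂ) = 1 / 2 := by
  rw [map_div₀, map_one, map_ofNat]

theorem conj_I_half : conj (Complex.I / 2 : ℂ) = -(Complex.I / 2) := by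
  rw [map_div₀, Complex.conj_I, map_ofNat, neg_div]

theorem scaled_neg_left {x : P.Pt} (a : ℂ) (Y : Takiff G (order x)) :
    scaled G x (-a) Y = -scaled G x a Y := by
  rw [← neg_one_smul ℂ (scaled G x a Y), smul_scaled, neg_one_mul]

theorem conjObs_smul (c : ℂ) (u : CplxObs G P) :
    conjObs G P (c • u) = conj c • conjObs G P u := by
  induction u using TensorProduct.induction_on with
  | zero => simp
  | add u v hu hv => rw [smul_add, map_add, map_add, hu, hv, smul_add]
  | tmul a X =>
    rw [TensorProduct.smul_tmul']
    change conj (c * a) ⊗ₜ[ℝ] X = conj c • (conj a ⊗ₜ[ℝ] X)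
    rw [TensorProduct.smul_tmul', map_mul]
    rfl

theorem conjObs_conjObs (u : CplxObs G P) : conjObs G P (conjObs G P u) = u := by
  induction u using TensorProduct.induction_on with
  | zero => simp
  | add u v hu hv => rw [map_add, map_add, hu, hv]
  | tmul a X =>
    change conj (conj a) ⊗ₜ[ℝ] X = _
    rw [Complex.conj_conj]

theorem conjObs_lieObs (u v : CplxObs G P) :
    conjObs G P (lieObs G P u v) = lieObs G P (conjObs G P u) (conjObs G P v) := by
  induction u using TensorProduct.induction_on with
  | zero => simp
  | add u v hu hv => simp only [map_add, LinearMap.add_apply, hu, hv]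
  | tmul a X =>
    induction v using TensorProduct.induction_on with
    | zero => simp
    | add u v hu hv => simp only [map_add, hu, hv]
    | tmul b Y =>
      rw [lieObs_tmul, conjObs_tmul, conjObs_tmul, conjObs_tmul, lieObs_tmul, map_mul]

/-! ### The embeddings of the Takiff algebras -/

/-- One formula for both kinds of points: by antilinearity of the reflection `w`, `i (Y - w Y) = i Y
+ w (i Y)`. Later arguments need no case distinction between real and complex points. -/
theorem emb_eq (x : P.Pt) (Y : Takiff G (order x)) :
    emb G x Y = scaled G x (1 / 2) (realProj G x Y)
      - scaled G x (Complex.I / 2) (realProj G x (Complex.I • Y)) := by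
  unfold emb realProj
  split_ifs
  · rfl
  · rw [Takiff.refl_smul, Complex.conj_I, neg_smul, ← sub_eq_add_neg, ← smul_sub]

theorem conjObs_emb_of_isComplex {x : P.Pt} (hx : IsComplex x) (Y : Takiff G (order x)) :
    conjObs G P (emb G x Y) = embBar G x Y := by
  rw [emb, if_pos hx, embBar, map_sub, conjObs_scaled, conjObs_scaled, conj_half, conj_I_half,
    scaled_neg_left, sub_neg_eq_add]

theorem conjObs_embBar {x : P.Pt} (hx : IsComplex x) (Y : Takiff G (order x)) :
    conjObs G P (embBar G x Y) = emb G x Y := by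
  rw [← conjObs_emb_of_isComplex hx, conjObs_conjObs]

theorem scaled_neg_right {x : P.Pt} (a : ℂ) {Y : Takiff G (order x)} (hY : Y ∈ takiffReal G x) :
    scaled G x a (-Y) = -scaled G x a Y := by
  have h := scaled_real_smul a (-1) hY
  rw [neg_one_smul] at h
  rw [h, Complex.ofReal_neg, Complex.ofReal_one, neg_one_mul, scaled_neg_left]

theorem realProj_neg (x : P.Pt) (Y : Takiff G (order x)) :
    realProj G x (-Y) = -realProj G x Y := by
  have h := realProj_real_smul (G := G) x (-1) Y
  rwa [Complex.ofReal_neg, Complex.ofReal_one, neg_one_smul, neg_one_smul] at h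

section
variable (hT : 0 < T) (hω : IsPrimitiveRoot ω T)
include hT hω

theorem emb_add {x : P.Pt} {Y Z : Takiff G (order x)} (hY : Y ∈ takiffRot G x)
    (hZ : Z ∈ takiffRot G x) : emb G x (Y + Z) = emb G x Y + emb G x Z := by
  rw [emb_eq, emb_eq, emb_eq, smul_add, realProj_add, realProj_add,
    scaled_add_right _ (realProj_mem hT hω hY) (realProj_mem hT hω hZ),
    scaled_add_right _ (realProj_mem hT hω ((takiffRot G x).smul_mem _ hY))
      (realProj_mem hT hω ((takiffRot G x).smul_mem _ hZ))]
  abel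

theorem emb_real_smul {x : P.Pt} (r : ℝ) {Y : Takiff G (order x)} (hY : Y ∈ takiffRot G x) :
    emb G x ((r : ℂ) • Y) = (r : ℂ) • emb G x Y := by
  rw [emb_eq, emb_eq, smul_comm, realProj_real_smul, realProj_real_smul,
    scaled_real_smul _ _ (realProj_mem hT hω hY),
    scaled_real_smul _ _ (realProj_mem hT hω ((takiffRot G x).smul_mem _ hY)), smul_sub,
    smul_scaled, smul_scaled]

theorem emb_I_smul {x : P.Pt} {Y : Takiff G (order x)} (hY : Y ∈ takiffRot G x) :
    emb G x (Complex.I • Y) = Complex.I • emb G x Y := by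
  rw [emb_eq, emb_eq, smul_smul, Complex.I_mul_I, neg_one_smul, realProj_neg,
    scaled_neg_right _ (realProj_mem hT hω hY), smul_sub, smul_scaled, smul_scaled,
    show Complex.I * (Complex.I / 2) = -(1 / 2) by linear_combination Complex.I_mul_I / 2,
    scaled_neg_left, show Complex.I * (1 / 2) = Complex.I / 2 by ring]
  abel

theorem emb_smul {x : P.Pt} (c : ℂ) {Y : Takiff G (order x)} (hY : Y ∈ takiffRot G x) :
    emb G x (c • Y) = c • emb G x Y := by
  have h1 := (takiffRot G x).smul_mem (c.re : ℂ) hY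
  have h2 := (takiffRot G x).smul_mem Complex.I hY
  have h3 := (takiffRot G x).smul_mem (c.im : ℂ) h2
  conv_lhs => rw [← Complex.re_add_im c]
  conv_rhs => rw [← Complex.re_add_im c]
  rw [add_smul, mul_smul, emb_add hT hω h1 h3, emb_real_smul hT hω _ hY, emb_real_smul hT hω _ h2,
    emb_I_smul hT hω hY, add_smul, mul_smul]

-- `realProj` commutes with the adjoint action of the real element `Y`, so the defining formula of
-- `emb` is carried along unchanged.
open Classical in
theorem lieObs_tmul_emb (a : ℂ) (x : P.Pt) (Y : takiffReal G x) {Z : Takiff G (order x)}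
    (hZ : Z ∈ takiffRot G x) :
    lieObs G P (a ⊗ₜ[ℝ] DirectSum.lof ℝ P.Pt (fun x => takiffReal G x) x Y) (emb G x Z) =
      a • emb G x ⁅(Y : Takiff G (order x)), Z⁆ := by
  rw [emb_eq, emb_eq, map_sub, lieObs_tmul_scaled _ _ _ _ (realProj_mem hT hω hZ),
    lieObs_tmul_scaled _ _ _ _ (realProj_mem hT hω ((takiffRot G x).smul_mem _ hZ)),
    ← realProj_lie Y.2, ← realProj_lie Y.2, lie_smul, smul_sub, smul_scaled, smul_scaled]

omit hT hω in
open Classical in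
theorem lieObs_tmul_emb_of_ne {x y : P.Pt} (hxy : x ≠ y) (a : ℂ) (Y : takiffReal G x)
    (Z : Takiff G (order y)) :
    lieObs G P (a ⊗ₜ[ℝ] DirectSum.lof ℝ P.Pt (fun x => takiffReal G x) x Y) (emb G y Z) = 0 := by
  rw [emb_eq, map_sub, lieObs_tmul_scaled_of_ne hxy, lieObs_tmul_scaled_of_ne hxy, sub_zero]

open Classical in
theorem lieObs_tmul_embBar {x : P.Pt} (hx : IsComplex x) (a : ℂ) (Y : takiffReal G x)
    {Z : Takiff G (order x)} (hZ : Z ∈ takiffRot G x) :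
    lieObs G P (a ⊗ₜ[ℝ] DirectSum.lof ℝ P.Pt (fun x => takiffReal G x) x Y) (embBar G x Z) =
      a • embBar G x ⁅(Y : Takiff G (order x)), Z⁆ := by
  rw [← conjObs_emb_of_isComplex hx, ← conjObs_emb_of_isComplex hx, ← Complex.conj_conj a,
    ← conjObs_tmul, ← conjObs_lieObs, lieObs_tmul_emb hT hω _ _ _ hZ, conjObs_smul]

omit hT hω in
open Classical in
theorem lieObs_tmul_embBar_of_ne {x y : P.Pt} (hxy : x ≠ y) (a : ℂ) (Y : takiffReal G x)
    (Z : Takiff G (order y)) :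
    lieObs G P (a ⊗ₜ[ℝ] DirectSum.lof ℝ P.Pt (fun x => takiffReal G x) x Y) (embBar G y Z) = 0 := by
  rw [embBar, map_add, lieObs_tmul_scaled_of_ne hxy, lieObs_tmul_scaled_of_ne hxy, add_zero]

theorem lieObs_scaled_emb {x : P.Pt} (a : ℂ) {Y Z : Takiff G (order x)} (hY : Y ∈ takiffReal G x)
    (hZ : Z ∈ takiffRot G x) :
    lieObs G P (scaled G x a Y) (emb G x Z) = a • emb G x ⁅Y, Z⁆ := by
  rw [scaled_of_mem a hY]
  exact lieObs_tmul_emb hT hω a x ⟨Y, hY⟩ hZ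

/-- Expanding only the first argument leaves real elements acting on `emb G x Z`. Linearity of `emb`
then reassembles the two brackets through `realProj_sub_I`. -/
theorem lieObs_emb_emb {x : P.Pt} {Y Z : Takiff G (order x)} (hY : Y ∈ takiffRot G x)
    (hZ : Z ∈ takiffRot G x) : lieObs G P (emb G x Y) (emb G x Z) = emb G x ⁅Y, Z⁆ := by
  have hA := realProj_mem hT hω hY
  have hB := realProj_mem hT hω ((takiffRot G x).smul_mem Complex.I hY)
  have hAZ := lie_mem_takiffRot hA.1 hZ
  have hBZ := lie_mem_takiffRot hB.1 hZ
  rw [emb_eq x Y, map_sub, LinearMap.sub_apply, lieObs_scaled_emb hT hω _ hA hZ,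
    lieObs_scaled_emb hT hω _ hB hZ]
  have h2 : emb G x ((2 : ℂ) • ⁅Y, Z⁆) = emb G x ⁅realProj G x Y, Z⁆ +
      (-Complex.I) • emb G x ⁅realProj G x (Complex.I • Y), Z⁆ := by
    rw [← smul_lie, ← realProj_sub_I, sub_lie, smul_lie, sub_eq_add_neg, ← neg_smul,
      emb_add hT hω hAZ ((takiffRot G x).smul_mem _ hBZ), emb_smul hT hω _ hBZ]
  rw [emb_smul hT hω _ (lie_mem_takiffRot hY hZ)] at h2
  have h3 : emb G x ⁅Y, Z⁆ = (1 / 2 : ℂ) • ((2 : ℂ) • emb G x ⁅Y, Z⁆) := by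
    rw [smul_smul]; norm_num
  rw [h3, h2]
  module

omit hT hω in
theorem lieObs_emb_emb_of_ne {x y : P.Pt} (hxy : x ≠ y) (Y : Takiff G (order x))
    (Z : Takiff G (order y)) : lieObs G P (emb G x Y) (emb G y Z) = 0 := by
  simp only [emb_eq, map_sub, LinearMap.sub_apply, lieObs_scaled_of_ne hxy, sub_zero]

omit hT hω in
theorem lieObs_embBar_emb_of_ne {x y : P.Pt} (hxy : x ≠ y) (Y : Takiff G (order x))
    (Z : Takiff G (order y)) : lieObs G P (embBar G x Y) (emb G y Z) = 0 := by
  simp only [emb_eq, embBar, map_sub, map_add, LinearMap.add_apply, lieObs_scaled_of_ne hxy,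
    sub_zero, add_zero]

/-- At a complex point every rotation-invariant element is real, so the two terms of `embBar` act on
`emb G x Z` with total coefficient `1/2 + (i/2) i = 0`: the holomorphic and antiholomorphic copies
commute. -/
theorem lieObs_embBar_emb {x : P.Pt} (hx : IsComplex x) {Y Z : Takiff G (order x)}
    (hY : Y ∈ takiffRot G x) (hZ : Z ∈ takiffRot G x) :
    lieObs G P (embBar G x Y) (emb G x Z) = 0 := by
  have hA := mem_takiffReal_of_isComplex hx hY
  have hB := mem_takiffReal_of_isComplex hx ((takiffRot G x).smul_mem Complex.I hY)
  rw [embBar, map_add, LinearMap.add_apply, lieObs_scaled_emb hT hω _ hA hZ,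
    lieObs_scaled_emb hT hω _ hB hZ, smul_lie, emb_smul hT hω _ (lie_mem_takiffRot hY hZ),
    smul_smul, ← add_smul]
  have : (1 / 2 : ℂ) + Complex.I / 2 * Complex.I = 0 := by
    linear_combination Complex.I_mul_I / 2
  rw [this, zero_smul]

theorem lieObs_embBar_embBar {x : P.Pt} (hx : IsComplex x) {Y Z : Takiff G (order x)}
    (hY : Y ∈ takiffRot G x) (hZ : Z ∈ takiffRot G x) :
    lieObs G P (embBar G x Y) (embBar G x Z) = embBar G x ⁅Y, Z⁆ := by
  rw [← conjObs_emb_of_isComplex hx, ← conjObs_emb_of_isComplex hx, ← conjObs_lieObs,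
    lieObs_emb_emb hT hω hY hZ, conjObs_emb_of_isComplex hx]

omit hT hω in
theorem lieObs_embBar_embBar_of_ne {x y : P.Pt} (hxy : x ≠ y) (Y : Takiff G (order x))
    (Z : Takiff G (order y)) : lieObs G P (embBar G x Y) (embBar G y Z) = 0 := by
  simp only [embBar, map_add, LinearMap.add_apply, lieObs_scaled_of_ne hxy, add_zero]

theorem embBar_add {x : P.Pt} (hx : IsComplex x) {Y Z : Takiff G (order x)}
    (hY : Y ∈ takiffRot G x) (hZ : Z ∈ takiffRot G x) :
    embBar G x (Y + Z) = embBar G x Y + embBar G x Z := by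
  rw [← conjObs_emb_of_isComplex hx, emb_add hT hω hY hZ, map_add, conjObs_emb_of_isComplex hx,
    conjObs_emb_of_isComplex hx]

theorem embBar_smul {x : P.Pt} (hx : IsComplex x) (c : ℂ) {Y : Takiff G (order x)}
    (hY : Y ∈ takiffRot G x) : embBar G x (c • Y) = conj c • embBar G x Y := by
  rw [← conjObs_emb_of_isComplex hx, emb_smul hT hω c hY, conjObs_smul,
    conjObs_emb_of_isComplex hx]

/-- At a real point conjugation preserves the single copy and acts there as the reflection. Since
the reflection involves `τ`, it exchanges `fil` and `filBar`. -/
theorem conjObs_emb_of_not_isComplex {x : P.Pt} (hx : ¬ IsComplex x) {Y : Takiff G (order x)}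
    (hY : Y ∈ takiffRot G x) :
    conjObs G P (emb G x Y) = emb G x (Takiff.refl (zeta x) (reflIndex x) Y) := by
  have hI : Complex.I • Takiff.refl (zeta x) (reflIndex x) Y =
      -Takiff.refl (zeta x) (reflIndex x) (Complex.I • Y) := by
    rw [Takiff.refl_smul, Complex.conj_I, neg_smul, neg_neg]
  rw [emb_eq, emb_eq, map_sub, conjObs_scaled, conjObs_scaled, hI, realProj_neg,
    realProj_refl hT hω hx, realProj_refl hT hω hx,
    scaled_neg_right _ (realProj_mem hT hω ((takiffRot G x).smul_mem _ hY)), conj_half, conj_I_half,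
    scaled_neg_left]

end

/-! ### The filtration of the observables and the Lie and Poisson brackets -/

theorem emb_mem_filObs {n : ℕ} {x : P.Pt} {Y : Takiff G (order x)} (hY : Y ∈ takiffRot G x)
    (h : ∀ p, Y p ∈ Affine.fil G n) : emb G x Y ∈ filObs G P n :=
  Submodule.subset_span (Or.inl ⟨x, Y, hY, h, rfl⟩)

theorem embBar_mem_filObs {n : ℕ} {x : P.Pt} (hx : IsComplex x) {Y : Takiff G (order x)}
    (hY : Y ∈ takiffRot G x) (h : ∀ p, Y p ∈ Affine.filBar G n) : embBar G x Y ∈ filObs G P n :=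
  Submodule.subset_span (Or.inr ⟨x, hx, Y, hY, h, rfl⟩)

section
variable (hT : 0 < T) (hω : IsPrimitiveRoot ω T)
include hT hω

/-- The copies attached to distinct points, or to a complex point and its conjugate, commute. Within
one copy the claim is closure of `fil` or `filBar`. -/
theorem lieObs_mem_filObs {n : ℕ} {u v : CplxObs G P} (hu : u ∈ filObs G P n)
    (hv : v ∈ filObs G P n) : lieObs G P u v ∈ filObs G P n := by
  classical
  induction hu using Submodule.span_induction with
  | zero => rw [map_zero]; exact zero_mem _
  | add a b _ _ ha hb => rw [map_add]; exact add_mem ha hb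
  | smul c a _ ha => rw [map_smul]; exact Submodule.smul_mem _ c ha
  | mem u hu =>
  induction hv using Submodule.span_induction with
  | zero => rw [map_zero]; exact zero_mem _
  | add a b _ _ ha hb => rw [map_add]; exact add_mem ha hb
  | smul c a _ ha => rw [map_smul]; exact Submodule.smul_mem _ c ha
  | mem v hv =>
  have hfil := fun X hX Y hY => Affine.lie_mem_fil (G := G) (n := n) (X := X) (Y := Y) hX hY
  have hbar := fun X hX Y hY => Affine.lie_mem_filBar (G := G) (n := n) (X := X) (Y := Y) hX hY
  rcases hu with ⟨x, Y, hY, hp, rfl⟩ | ⟨x, hx, Y, hY, hp, rfl⟩ <;>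
    rcases hv with ⟨y, Z, hZ, hq, rfl⟩ | ⟨y, hy, Z, hZ, hq, rfl⟩ <;>
    rcases eq_or_ne x y with rfl | hxy
  · rw [lieObs_emb_emb hT hω hY hZ]
    exact emb_mem_filObs (lie_mem_takiffRot hY hZ) (Takiff.lie_apply_mem hfil hp hq)
  · rw [lieObs_emb_emb_of_ne hxy]; exact zero_mem _
  · rw [lieObs_skew, lieObs_embBar_emb hT hω hy hZ hY, neg_zero]; exact zero_mem _
  · rw [lieObs_skew, lieObs_embBar_emb_of_ne hxy.symm, neg_zero]; exact zero_mem _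
  · rw [lieObs_embBar_emb hT hω hx hY hZ]; exact zero_mem _
  · rw [lieObs_embBar_emb_of_ne hxy]; exact zero_mem _
  · rw [lieObs_embBar_embBar hT hω hx hY hZ]
    exact embBar_mem_filObs hx (lie_mem_takiffRot hY hZ) (Takiff.lie_apply_mem hbar hp hq)
  · rw [lieObs_embBar_embBar_of_ne hxy]; exact zero_mem _

/-- An observable is a finite sum of pure tensors `a ⊗ Y` supported at one point, and such a tensor
has finitely many affine modes. The level `m` must depend on `v`, since arbitrary degrees occur. -/
theorem eventually_lieObs_mem_filObs (v : CplxObs G P) (n : ℕ) :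
    ∀ᶠ m in Filter.atTop, ∀ u ∈ filObs G P m, lieObs G P v u ∈ filObs G P n := by
  classical
  induction v using TensorProduct.induction_on with
  | zero =>
    refine Filter.Eventually.of_forall fun m u _ => ?_
    rw [map_zero]; exact zero_mem _
  | add a b ha hb =>
    filter_upwards [ha, hb] with m ha hb u hu
    rw [map_add]; exact add_mem (ha u hu) (hb u hu)
  | tmul a R =>
  induction R using DirectSum.induction_on with
  | zero =>
    refine Filter.Eventually.of_forall fun m u _ => ?_
    rw [TensorProduct.tmul_zero, map_zero]; exact zero_mem _
  | add X Y hX hY =>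
    filter_upwards [hX, hY] with m hX hY u hu
    rw [TensorProduct.tmul_add, map_add]; exact add_mem (hX u hu) (hY u hu)
  | of x Y =>
    filter_upwards [Takiff.eventually_lie_apply_mem Affine.eventually_lie_mem_fil (Y : Takiff G (order x)) n,
      Takiff.eventually_lie_apply_mem Affine.eventually_lie_mem_filBar (Y : Takiff G (order x)) n]
      with m h1 h2 u hu
    change lieObs G P (a ⊗ₜ[ℝ] DirectSum.lof ℝ P.Pt (fun x => takiffReal G x) x Y) u ∈ _
    induction hu using Submodule.span_induction with
    | zero => rw [map_zero]; exact zero_mem _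
    | add a b _ _ ha hb => rw [map_add]; exact add_mem ha hb
    | smul c a _ ha => rw [map_smul]; exact Submodule.smul_mem _ c ha
    | mem u hu =>
    rcases hu with ⟨y, Z, hZ, hq, rfl⟩ | ⟨y, hy, Z, hZ, hq, rfl⟩ <;>
      rcases eq_or_ne x y with rfl | hxy
    · refine (congrArg (· ∈ filObs G P n) (lieObs_tmul_emb hT hω a x Y hZ)).mpr ?_
      exact Submodule.smul_mem _ _ (emb_mem_filObs (lie_mem_takiffRot Y.2.1 hZ) (h1 Z hq))
    · refine (congrArg (· ∈ filObs G P n) (lieObs_tmul_emb_of_ne hxy a Y Z)).mpr ?_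
      exact zero_mem _
    · refine (congrArg (· ∈ filObs G P n) (lieObs_tmul_embBar hT hω hy a Y hZ)).mpr ?_
      exact Submodule.smul_mem _ _ (embBar_mem_filObs hy (lie_mem_takiffRot Y.2.1 hZ) (h2 Z hq))
    · refine (congrArg (· ∈ filObs G P n) (lieObs_tmul_embBar_of_ne hxy a Y Z)).mpr ?_
      exact zero_mem _

omit hT hω in
theorem antitone_filObs : Antitone fun n => (filObs G P n : Set (CplxObs G P)) :=
  fun _ _ h => filObs_anti G P h

omit hT hω in
theorem antitone_conj_filObs :
    Antitone fun n => conjObs G P '' (filObs G P n : Set (CplxObs G P)) :=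
  fun _ _ h => Set.image_mono (filObs_anti G P h)

theorem eventually_poisson_mem_filAlg (g : Obs G P) (n : ℕ) :
    ∀ᶠ m in Filter.atTop, ∀ f ∈ filAlg G P m, poisson (CplxObs G P) g f ∈ filAlg G P n := by
  have h1 := eventually_poisson_mem_span (antitone_filObs (G := G) (P := P))
    (eventually_lieObs_mem_filObs hT hω) g n
  have h2 := eventually_poisson_mem_span (antitone_conj_filObs (G := G) (P := P))
    (fun v k => by
      -- Conjugation respects the bracket, so bracketing a conjugated filtration with `v` is the
      -- conjugate of bracketing the filtration with the conjugate of `v`.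
      filter_upwards [eventually_lieObs_mem_filObs hT hω (conjObs G P v) k] with m hm
      rintro _ ⟨u, hu, rfl⟩
      refine ⟨_, hm u hu, ?_⟩
      rw [conjObs_lieObs, conjObs_conjObs]
      rfl) g n
  filter_upwards [h1, h2] with m h1 h2 f hf
  exact ⟨h1 f hf.1, h2 f hf.2⟩

theorem poisson_mem_filAlg {n : ℕ} {f g : Obs G P} (hf : f ∈ filAlg G P n)
    (hg : g ∈ filAlg G P n) : poisson (CplxObs G P) f g ∈ filAlg G P n := by
  refine ⟨poisson_mem_span_of_lie (fun a ha b hb => lieObs_mem_filObs hT hω ha hb) hf.1 hg.1,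
    poisson_mem_span_of_lie ?_ hf.2 hg.2⟩
  rintro _ ⟨u, hu, rfl⟩ _ ⟨v, hv, rfl⟩
  exact ⟨_, lieObs_mem_filObs hT hω hu hv, conjObs_lieObs u v⟩

/-! ### The extension of the bracket to the completion -/

omit hT hω in
theorem TendsToComp.eventually_sub_mem {f g : ℕ → Obs G P} {a : CompObs G P}
    (hf : TendsToComp f a) (hg : TendsToComp g a) (n : ℕ) :
    ∀ᶠ K in Filter.atTop, ∀ k ≥ K, ∀ l ≥ K, f k - g l ∈ filAlg G P n := by
  obtain ⟨K, hK⟩ := Filter.eventually_atTop.1 ((hf n).and (hg n))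
  filter_upwards [Filter.eventually_ge_atTop K] with K' hK' k hk l hl
  rw [← Ideal.Quotient.eq, (hK k (hK'.trans hk)).1, (hK l (hK'.trans hl)).2]

/-- The Cauchy property of the brackets and their independence of the approximating sequences, in
one statement. -/
theorem eventually_poisson_sub_mem {f f' g g' : ℕ → Obs G P} {a b : CompObs G P}
    (hf : TendsToComp f a) (hf' : TendsToComp f' a) (hg : TendsToComp g b)
    (hg' : TendsToComp g' b) (n : ℕ) :
    ∃ K, ∀ k ≥ K, ∀ l ≥ K, poisson (CplxObs G P) (f k) (g k) -
      poisson (CplxObs G P) (f' l) (g' l) ∈ filAlg G P n := by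
  -- The order of choices matters. `K₀` fixes the representatives `g K₀` and `f' K₀`; `m` is chosen
  -- for these two elements only; `K` then makes the differences small at level `m`. The remaining
  -- errors `g k - g K₀` and `f' l - f' K₀` lie in level `n`, which is closed under the bracket.
  obtain ⟨K₀, h₁, h₂⟩ := ((hg.eventually_sub_mem hg n).and (hf'.eventually_sub_mem hf' n)).exists
  obtain ⟨m, ⟨h₃, h₄⟩, hnm⟩ := (((eventually_poisson_mem_filAlg hT hω (g K₀) n).and
    (eventually_poisson_mem_filAlg hT hω (f' K₀) n)).and (Filter.eventually_ge_atTop n)).exists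
  obtain ⟨K, ⟨h₅, h₆⟩, hK⟩ := (((hf.eventually_sub_mem hf' m).and
    (hg.eventually_sub_mem hg' m)).and (Filter.eventually_ge_atTop K₀)).exists
  refine ⟨K, fun k hk l hl => ?_⟩
  have e : poisson (CplxObs G P) (f k) (g k) - poisson (CplxObs G P) (f' l) (g' l) =
      (-poisson (CplxObs G P) (g K₀) (f k - f' l)
        + poisson (CplxObs G P) (f k - f' l) (g k - g K₀))
      + (poisson (CplxObs G P) (f' K₀) (g k - g' l)
        + poisson (CplxObs G P) (f' l - f' K₀) (g k - g' l)) := by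
    rw [← poisson_skew]
    simp only [map_sub, LinearMap.sub_apply]
    abel
  rw [e]
  have a1 := h₅ k hk l hl
  have a2 := h₆ k hk l hl
  exact add_mem
    (add_mem (neg_mem (h₃ _ a1)) (poisson_mem_filAlg hT hω (filAlg_anti G P hnm a1)
      (h₁ k (hK.trans hk) K₀ le_rfl)))
    (add_mem (h₄ _ a2) (poisson_mem_filAlg hT hω (h₂ l (hK.trans hl) K₀ le_rfl)
      (filAlg_anti G P hnm a2)))

omit hT hω in
theorem tendsToComp_of_mk_eq {f : ℕ → Obs G P} {a : CompObs G P}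
    (h : ∀ k, Ideal.Quotient.mk (filAlg G P k) (f k) = a.1 k) : TendsToComp f a := by
  intro n
  filter_upwards [Filter.eventually_ge_atTop n] with k hk
  rw [← a.2 n k hk, ← h k, Ideal.Quotient.factor_mk]

omit hT hω in
theorem exists_tendsToComp (a : CompObs G P) : ∃ f : ℕ → Obs G P, TendsToComp f a := by
  choose f hf using fun k => Ideal.Quotient.mk_surjective (a.1 k)
  exact ⟨f, tendsToComp_of_mk_eq hf⟩

omit hT hω in
theorem tendsToComp_const (f : Obs G P) : TendsToComp (fun _ => f) (toComp G P f) :=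
  fun _ => Filter.Eventually.of_forall fun _ => rfl

omit hT hω in
theorem TendsToComp.unique {f : ℕ → Obs G P} {a b : CompObs G P} (ha : TendsToComp f a)
    (hb : TendsToComp f b) : a = b := by
  apply Subtype.ext
  funext n
  obtain ⟨k, h1, h2⟩ := ((ha n).and (hb n)).exists
  rw [← h1, h2]

theorem exists_isBracket (a b : CompObs G P) : ∃ c, IsBracket a b c := by
  obtain ⟨f, hf⟩ := exists_tendsToComp a
  obtain ⟨g, hg⟩ := exists_tendsToComp b
  -- The limit is represented at level `n` by the bracket at the threshold `K n`; different
  -- thresholds are compared through a common later index.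
  choose K hK using eventually_poisson_sub_mem hT hω hf hf hg hg
  let q : ℕ → Obs G P := fun n => poisson (CplxObs G P) (f (K n)) (g (K n))
  have hq : ∀ m n, m ≤ n → q n - q m ∈ filAlg G P m := by
    intro m n h
    have h1 := filAlg_anti G P h (hK n (K n) le_rfl (max (K m) (K n)) (le_max_right _ _))
    have h2 := hK m (max (K m) (K n)) (le_max_left _ _) (K m) le_rfl
    simpa [q] using add_mem h1 h2
  refine ⟨⟨fun n => Ideal.Quotient.mk _ (q n), fun m n h => ?_⟩, fun f' g' hf' hg' n => ?_⟩
  · rw [Ideal.Quotient.factor_mk, Ideal.Quotient.eq]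
    exact hq m n h
  · obtain ⟨K', hK'⟩ := eventually_poisson_sub_mem hT hω hf' hf hg' hg n
    filter_upwards [Filter.eventually_ge_atTop K'] with k hk
    rw [Ideal.Quotient.eq]
    have h1 := hK' k hk (max K' (K n)) (le_max_left _ _)
    have h2 := hK n (max K' (K n)) (le_max_right _ _) (K n) le_rfl
    simpa [q] using add_mem h1 h2

theorem isBracket_bracketComp (a b : CompObs G P) : IsBracket a b (bracketComp a b) := by
  have h := exists_isBracket hT hω a b
  rw [bracketComp, dif_pos h]
  exact h.choose_spec

theorem bracketComp_genComp (u v : CplxObs G P) :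
    bracketComp (genComp u) (genComp v) = genComp (lieObs G P u v) := by
  have h := isBracket_bracketComp hT hω (genComp u) (genComp v) _ _ (tendsToComp_const _)
    (tendsToComp_const _)
  refine h.unique ?_
  rw [poisson_ι_eq_lieObs]
  exact tendsToComp_const _

/-- A derivation that vanishes on generators is zero, so every approximating bracket is already zero
before completion. -/
theorem bracketComp_genComp_of_central {u : CplxObs G P} (hu : ∀ v, lieObs G P u v = 0)
    (a : CompObs G P) : bracketComp (genComp u) a = 0 := by
  obtain ⟨f, hf⟩ := exists_tendsToComp a
  have h := isBracket_bracketComp hT hω (genComp u) a _ _ (tendsToComp_const _) hf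
  refine h.unique ?_
  have h0 : adDeriv (CplxObs G P) u = 0 := by
    refine deriv_ext_ι _ fun v => ?_
    rw [← poisson_ι_left, poisson_ι_eq_lieObs, hu, map_zero]
    rfl
  have : (fun k => poisson (CplxObs G P) (SymmetricAlgebra.ι ℂ (CplxObs G P) u) (f k)) =
      fun _ => 0 := by
    funext k
    rw [poisson_ι_left, h0]
    rfl
  rw [this, ← map_zero (toComp G P)]
  exact tendsToComp_const _

/-- Each component of an element of the completed ideal lifts to `J`, and these lifts converge to
the element. Their brackets stay in `J` and eventually represent the bracket at each level. -/
theorem bracketComp_mem_idealComp {J : Ideal (Obs G P)}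
    (hJ : ∀ f ∈ J, ∀ g ∈ J, poisson (CplxObs G P) f g ∈ J) {a b : CompObs G P}
    (ha : a ∈ idealComp J) (hb : b ∈ idealComp J) : bracketComp a b ∈ idealComp J := by
  rw [mem_idealComp] at *
  choose f hf hfa using ha
  choose g hg hgb using hb
  intro n
  obtain ⟨k, hk⟩ := (isBracket_bracketComp hT hω a b f g (tendsToComp_of_mk_eq hfa)
    (tendsToComp_of_mk_eq hgb) n).exists
  exact ⟨_, hJ _ (hf k) _ (hg k), hk⟩

end

/-! ### The algebra of the constraints -/

theorem single_zero_mem_takiffRot (a : {a : ℂ // a ∈ P.z}) {X : Affine G}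
    (hX : Affine.sigma X = X) :
    Takiff.single (order (some a : P.Pt)) 0 X ∈ takiffRot G (some a : P.Pt) := by
  refine ⟨fun h => absurd h (by simp), fun k _ => ?_⟩
  rw [Takiff.rot_single, mul_zero, pow_zero, one_smul, Affine.sigma_pow_eq_self hX]

/-- A rotation that fixes a nonzero number is the identity, so its exponent is a multiple of `T` and
`σ` to that power is trivial. -/
theorem mem_takiffRot_of_ne_zero (hω : IsPrimitiveRoot ω T)
    {a : {a : ℂ // a ∈ P.z}} (ha : (a : ℂ) ≠ 0) (Y : Takiff G (order (some a : P.Pt))) :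
    Y ∈ takiffRot G (some a : P.Pt) := by
  refine ⟨fun h => absurd h (by simp), fun k hk => ?_⟩
  change ω ^ k * (a : ℂ) = a at hk
  have hk1 : ω ^ k = 1 := mul_right_cancel₀ ha (by rw [hk, one_mul])
  obtain ⟨l, rfl⟩ := (hω.pow_eq_one_iff_dvd k).1 hk1
  have hs : ∀ X : Affine G, (Affine.sigma ^ (T * l)) X = X := by
    intro X
    induction l with
    | zero => simp
    | succ l ih =>
      rw [mul_add, pow_add, mul_one, Module.End.mul_apply, Affine.sigma_pow_period]
      exact ih (by rw [pow_mul, hω.pow_eq_one, one_pow, one_mul])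
        (by rw [pow_mul, hω.pow_eq_one, one_pow])
  funext p
  change (ω⁻¹) ^ (T * l * (p : ℕ)) • (Affine.sigma ^ (T * l)) (Y p) = Y p
  rw [hs, inv_pow, pow_mul, hk1, one_pow, inv_one, one_smul]

theorem ne_zero_of_isComplex {a : {a : ℂ // a ∈ P.z}} (h : IsComplex (some a : P.Pt)) :
    (a : ℂ) ≠ 0 := fun h0 => h 0 (by change ω ^ 0 * conj (a : ℂ) = a; rw [h0]; simp)

theorem lieObs_scaled_eq_zero {x : P.Pt} {Z : Takiff G (order x)} (hZ : ∀ Y : Takiff G (order x), ⁅Y, Z⁆ = 0) (b : ℂ)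
    (v : CplxObs G P) : lieObs G P v (scaled G x b Z) = 0 := by
  classical
  by_cases hZr : Z ∈ takiffReal G x
  swap
  · rw [scaled, dif_neg hZr, map_zero]
  induction v using TensorProduct.induction_on with
  | zero => rw [map_zero]; rfl
  | add a b ha hb => rw [map_add, LinearMap.add_apply, ha, hb, add_zero]
  | tmul a R =>
  induction R using DirectSum.induction_on with
  | zero => rw [TensorProduct.tmul_zero, map_zero]; rfl
  | add X Y hX hY => rw [TensorProduct.tmul_add, map_add, LinearMap.add_apply, hX, hY, add_zero]
  | of y Y =>
    rcases eq_or_ne y x with rfl | hxy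
    · refine (lieObs_tmul_scaled a b y Y hZr).trans ?_
      rw [hZ, scaled_of_mem _ (zero_mem _)]
      exact map_zero _
    · exact lieObs_tmul_scaled_of_ne hxy a b Y Z

/-- The reflection is a bijective map compatible with brackets, so it sends central elements to
central elements. -/
theorem lie_realProj_eq_zero (hT : 0 < T) (hω : IsPrimitiveRoot ω T) {x : P.Pt}
    {Z : Takiff G (order x)} (hZ : ∀ Y : Takiff G (order x), ⁅Y, Z⁆ = 0) (Y : Takiff G (order x)) :
    ⁅Y, realProj G x Z⁆ = 0 := by
  unfold realProj
  split_ifs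
  · exact hZ Y
  · rw [lie_add, hZ, zero_add, ← Takiff.refl_refl (zeta_mul_conj hT hω x) (reflIndex x) Y,
      ← Takiff.refl_lie, hZ, Takiff.refl_zero]

theorem lieObs_emb_eq_zero (hT : 0 < T) (hω : IsPrimitiveRoot ω T) {x : P.Pt}
    {Z : Takiff G (order x)} (hZ : ∀ Y : Takiff G (order x), ⁅Y, Z⁆ = 0) (v : CplxObs G P) :
    lieObs G P v (emb G x Z) = 0 := by
  have hZ' : ∀ Y : Takiff G (order x), ⁅Y, Complex.I • Z⁆ = 0 := fun Y => by rw [lie_smul, hZ, smul_zero]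
  rw [emb_eq, map_sub, lieObs_scaled_eq_zero (lie_realProj_eq_zero hT hω hZ),
    lieObs_scaled_eq_zero (lie_realProj_eq_zero hT hω hZ'), sub_zero]

theorem lieObs_embBar_eq_zero {x : P.Pt}
    {Z : Takiff G (order x)} (hZ : ∀ Y : Takiff G (order x), ⁅Y, Z⁆ = 0) (v : CplxObs G P) :
    lieObs G P v (embBar G x Z) = 0 := by
  have hZ' : ∀ Y : Takiff G (order x), ⁅Y, Complex.I • Z⁆ = 0 := fun Y => by rw [lie_smul, hZ, smul_zero]
  rw [embBar, map_add, lieObs_scaled_eq_zero hZ, lieObs_scaled_eq_zero hZ', add_zero]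

theorem lieObs_constraintK (hT : 0 < T) (hω : IsPrimitiveRoot ω T) (v : CplxObs G P) :
    lieObs G P (constraintK G P) v = 0 := by
  have hK : ∀ n p (Y : Takiff G n), ⁅Y, Takiff.single n p (Affine.K G)⁆ = 0 := fun n p Y => by
    rw [← lie_skew, Takiff.single_K_lie, neg_zero]
  rw [lieObs_skew, constraintK, map_add, map_smul, map_smul, map_sum, map_sum,
    Finset.sum_eq_zero, Finset.sum_eq_zero, smul_zero, smul_zero, add_zero, neg_zero]
  · intro x _
    split_ifs
    · exact lieObs_embBar_eq_zero (hK _ _) v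
    · exact map_zero _
  · intro x _
    exact lieObs_emb_eq_zero hT hω (hK _ _) v

open Classical in
variable (P) in
/-- The diagonal sum `∑ X^(x)_0 + ∑ Y^(conj x)_0` over the finite points. -/
def totalObs (X Y : Affine G) : CplxObs G P :=
  ∑ x : {a : ℂ // a ∈ P.z}, obs G (some x) 0 X +
    ∑ x : {a : ℂ // a ∈ P.z}, if IsComplex (some x) then obsBar G (some x) 0 Y else 0

theorem constraintMode_eq (n : ℤ) (y : 𝔤) :
    constraintMode G P n y = totalObs P (Affine.gen G n y) (Affine.gen G (-n) y) := rfl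

section
variable (hT : 0 < T) (hω : IsPrimitiveRoot ω T)
include hT hω

theorem totalObs_add {X Y X' Y' : Affine G} (hX : Affine.sigma X = X)
    (hX' : Affine.sigma X' = X') :
    totalObs P (X + X') (Y + Y') = totalObs P X Y + totalObs P X' Y' := by
  have h1 : ∀ x : {a : ℂ // a ∈ P.z}, obs G (some x : P.Pt) 0 (X + X') =
      obs G (some x) 0 X + obs G (some x) 0 X' := fun x => by
    rw [obs, Takiff.single_add, emb_add hT hω (single_zero_mem_takiffRot x hX)
      (single_zero_mem_takiffRot x hX')]
    rfl
  have h2 : ∀ x : {a : ℂ // a ∈ P.z}, IsComplex (some x : P.Pt) →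
      obsBar G (some x : P.Pt) 0 (Y + Y') =
        obsBar G (some x) 0 Y + obsBar G (some x) 0 Y' := fun x hx => by
    have h := mem_takiffRot_of_ne_zero (G := G) hω (ne_zero_of_isComplex hx)
    rw [obsBar, Takiff.single_add, embBar_add hT hω hx (h _) (h _)]
    rfl
  unfold totalObs
  rw [add_add_add_comm]
  simp only [h1, Finset.sum_add_distrib]
  congr 1
  rw [← Finset.sum_add_distrib]
  refine Finset.sum_congr rfl fun x _ => ?_
  split_ifs with hx
  · exact h2 x hx
  · rw [add_zero]

/-- The conjugate in the second slot reflects the antilinearity of `embBar`. The condition on `X` is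
there for the origin, where only `σ`-fixed zeroth modes are rotation-invariant; complex points are
never the origin, so `Y` is free. -/
theorem totalObs_smul (c : ℂ) {X : Affine G} (Y : Affine G) (hX : Affine.sigma X = X) :
    totalObs P (c • X) (conj c • Y) = c • totalObs P X Y := by
  unfold totalObs
  rw [smul_add, Finset.smul_sum, Finset.smul_sum]
  congr 1
  · refine Finset.sum_congr rfl fun x _ => ?_
    rw [obs, Takiff.single_smul, emb_smul hT hω _ (single_zero_mem_takiffRot x hX)]
    rfl
  · refine Finset.sum_congr rfl fun x _ => ?_
    split_ifs with hx
    · have h := mem_takiffRot_of_ne_zero (G := G) hω (ne_zero_of_isComplex hx)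
      rw [obsBar, Takiff.single_smul, embBar_smul hT hω hx _ (h _), Complex.conj_conj]
      rfl
    · rw [smul_zero]

/-- All cross terms vanish because distinct copies commute. In each copy the zeroth Takiff modes
form a subalgebra isomorphic to their affine coefficients, so only the diagonal terms remain. -/
theorem lieObs_totalObs {X Y X' Y' : Affine G} (hX : Affine.sigma X = X)
    (hX' : Affine.sigma X' = X') :
    lieObs G P (totalObs P X Y) (totalObs P X' Y') = totalObs P ⁅X, X'⁆ ⁅Y, Y'⁆ := by
  have hne : ∀ {x y : {a : ℂ // a ∈ P.z}}, x ≠ y → (some x : P.Pt) ≠ some y :=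
    fun h e => h (Option.some_injective _ e)
  have hmem := fun x (hx : IsComplex (some x : P.Pt)) =>
    mem_takiffRot_of_ne_zero (G := G) hω (ne_zero_of_isComplex hx)
  have h1 : ∀ x y, lieObs G P (obs G (some x) 0 X) (obs G (some y) 0 X') =
      if x = y then obs G (some x) 0 ⁅X, X'⁆ else 0 := by
    intro x y
    split_ifs with h
    · subst h
      rw [obs, obs, lieObs_emb_emb hT hω (single_zero_mem_takiffRot x hX)
        (single_zero_mem_takiffRot x hX'), Takiff.single_zero_lie_single_zero]
      rfl
    · exact lieObs_emb_emb_of_ne (hne h) _ _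
  have h2 : ∀ x y, IsComplex (some x : P.Pt) →
      lieObs G P (obsBar G (some x) 0 Y) (obs G (some y) 0 X') = 0 := by
    intro x y hx
    rcases eq_or_ne x y with rfl | h
    · exact lieObs_embBar_emb hT hω hx (hmem x hx _) (single_zero_mem_takiffRot x hX')
    · exact lieObs_embBar_emb_of_ne (hne h) _ _
  have h3 : ∀ x y, IsComplex (some y : P.Pt) →
      lieObs G P (obs G (some x) 0 X) (obsBar G (some y) 0 Y') = 0 := by
    intro x y hy
    rw [lieObs_skew]
    rcases eq_or_ne y x with rfl | h
    · rw [obs, obsBar, lieObs_embBar_emb hT hω hy (hmem y hy _) (single_zero_mem_takiffRot y hX),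
        neg_zero]
    · rw [obs, obsBar, lieObs_embBar_emb_of_ne (hne h), neg_zero]
  have h4 : ∀ x y, IsComplex (some x : P.Pt) →
      lieObs G P (obsBar G (some x) 0 Y) (obsBar G (some y) 0 Y') =
      if x = y then obsBar G (some x) 0 ⁅Y, Y'⁆ else 0 := by
    intro x y hx
    split_ifs with h
    · subst h
      rw [obsBar, obsBar, lieObs_embBar_embBar hT hω hx (hmem x hx _) (hmem x hx _),
        Takiff.single_zero_lie_single_zero]
      rfl
    · exact lieObs_embBar_embBar_of_ne (hne h) _ _
  unfold totalObs
  rw [map_add, map_add, LinearMap.add_apply, LinearMap.add_apply, add_assoc]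
  simp only [map_sum, LinearMap.sum_apply]
  congr 1
  · simp only [h1]
    refine Finset.sum_congr rfl fun x _ => ?_
    simp
  · rw [Finset.sum_eq_zero, zero_add, Finset.sum_eq_zero, zero_add]
    · refine Finset.sum_congr rfl fun x _ => ?_
      rw [Finset.sum_eq_single x]
      · split_ifs with hx
        · rw [h4 x x hx, if_pos rfl]
        · rw [map_zero]
      · intro y _ hxy
        by_cases hx : IsComplex (some x : P.Pt) <;> by_cases hy : IsComplex (some y : P.Pt) <;>
          simp only [hx, hy, if_true, if_false, map_zero, LinearMap.zero_apply]
        rw [h4 _ _ hy, if_neg hxy]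
      · simp
    · intro x _
      refine Finset.sum_eq_zero fun y _ => ?_
      split_ifs with hx
      · exact h3 _ _ hx
      · exact map_zero _
    · intro x _
      refine Finset.sum_eq_zero fun y _ => ?_
      split_ifs with hx
      · exact h2 _ _ hx
      · rw [map_zero]; rfl

end

/-! ### Dual bases of the fixed subalgebra -/

section
variable {ι : Type*} [Fintype ι] [DecidableEq ι] {I Id : Module.Basis ι ℝ (fixedReal G)}
  (hI : ∀ α β, G.form (I α : 𝔤) (Id β : 𝔤) = if α = β then 1 else 0)
include hI

omit [Fintype ι] in
theorem dual_symm (α β : ι) : G.form (Id α : 𝔤) (I β : 𝔤) = if α = β then 1 else 0 := by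
  rw [G.form_symm, hI]
  simp only [eq_comm]

/-- Pairing the real expansion in the basis `Id` with `I α` isolates one coordinate; in particular
the form takes real values here. -/
theorem fixedReal_expand {z : 𝔤} (hz : z ∈ fixedReal G) :
    z = ∑ α, G.form z (I α : 𝔤) • (Id α : 𝔤) := by
  have h : z = ∑ β, ((Id.repr ⟨z, hz⟩ β : ℝ) : ℂ) • (Id β : 𝔤) := by
    have := congrArg (fun y : fixedReal G => (y : 𝔤)) (Id.sum_repr ⟨z, hz⟩)
    simpa only [Submodule.coe_sum, Submodule.coe_smul, Complex.coe_smul] using this.symm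
  have hc : ∀ α, G.form z (I α : 𝔤) = ((Id.repr ⟨z, hz⟩ α : ℝ) : ℂ) := by
    intro α
    conv_lhs => rw [h]
    rw [map_sum, LinearMap.sum_apply]
    simp only [map_smul, LinearMap.smul_apply, dual_symm hI, smul_eq_mul, mul_ite, mul_one, mul_zero,
      Finset.sum_ite_eq', Finset.mem_univ, if_true]
  simp only [hc]
  exact h

theorem fixed_expand {z : 𝔤} (hz : G.σ z = z) :
    z = ∑ α, G.form z (I α : 𝔤) • (Id α : 𝔤) := by
  have hτ : G.σ (G.τ z) = G.τ z := by
    have h := G.sigma_tau (G.τ z)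
    rwa [G.tau_tau, hz] at h
  have hhalf : conj (1 / 2 : ℂ) = 1 / 2 := conj_half
  -- The next two elements are the real and imaginary parts of `z` with respect to `τ`; together
  -- they show that the `σ`-fixed subspace is the complexification of `fixedReal G`.
  have hu : (1 / 2 : ℂ) • (z + G.τ z) ∈ fixedReal G := by
    refine ⟨by rw [map_smul, map_add, hz, hτ], ?_⟩
    rw [map_smulₛₗ, map_add, G.tau_tau, hhalf, add_comm]
  have hv : (-(Complex.I / 2) : ℂ) • (z - G.τ z) ∈ fixedReal G := by
    refine ⟨by rw [map_smul, map_sub, hz, hτ], ?_⟩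
    rw [map_smulₛₗ, map_sub, G.tau_tau, map_neg, conj_I_half, neg_neg, neg_smul, ← smul_neg, neg_sub]
  have e : z = (1 / 2 : ℂ) • (z + G.τ z) + Complex.I • ((-(Complex.I / 2) : ℂ) • (z - G.τ z)) := by
    rw [smul_smul, show Complex.I * (-(Complex.I / 2)) = 1 / 2 by
      linear_combination -Complex.I_mul_I / 2]
    module
  have h1 := fixedReal_expand hI hu
  have h2 := fixedReal_expand hI hv
  generalize (1 / 2 : ℂ) • (z + G.τ z) = u at *
  generalize (-(Complex.I / 2) : ℂ) • (z - G.τ z) = v at *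
  rw [e]
  conv_lhs => rw [h1, h2]
  rw [Finset.smul_sum, ← Finset.sum_add_distrib]
  refine Finset.sum_congr rfl fun α _ => ?_
  rw [map_add, map_smul, LinearMap.add_apply, LinearMap.smul_apply, add_smul, smul_smul, smul_eq_mul]

end

theorem conj_form_of_fixed {x y : 𝔤} (hx : G.τ x = x) (hy : G.τ y = y) :
    conj (G.form x y) = G.form x y := by
  rw [← G.form_tau, hx, hy]

theorem Affine.gen_add (n : ℤ) (x y : 𝔤) :
    Affine.gen G n (x + y) = Affine.gen G n x + Affine.gen G n y := by
  apply Affine.ext' <;> simp [Affine.gen]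

theorem Affine.gen_smul (n : ℤ) (c : ℂ) (x : 𝔤) :
    Affine.gen G n (c • x) = c • Affine.gen G n x := by
  apply Affine.ext' <;> simp [Affine.gen]

/-- `x ↦ x ⊗ t ^ n` as a linear map. -/
def Affine.genₗ (G : DihedralData T ω 𝔤) (n : ℤ) : 𝔤 →ₗ[ℂ] Affine G where
  toFun := Affine.gen G n
  map_add' := Affine.gen_add n
  map_smul' := Affine.gen_smul n

theorem Affine.gen_zero (n : ℤ) : Affine.gen G n (0 : 𝔤) = 0 := (Affine.genₗ G n).map_zero

theorem Affine.genₗ_apply (n : ℤ) (x : 𝔤) : Affine.genₗ G n x = Affine.gen G n x := rfl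

/-! ### The bracket relations between the constraints and the momentum -/

section
variable (hT : 0 < T) (hω : IsPrimitiveRoot ω T)
include hT hω

theorem totalObs_gen_sum {ι : Type*} (s : Finset ι) (c : ι → ℂ) (y : ι → 𝔤) (n : ℤ)
    (hc : ∀ i, conj (c i) = c i) (hy : ∀ i, G.σ (y i) = y i) :
    totalObs P (Affine.gen G n (∑ i ∈ s, c i • y i)) (Affine.gen G (-n) (∑ i ∈ s, c i • y i)) =
      ∑ i ∈ s, c i • constraintMode G P n (y i) := by
  have hσ : ∀ {z : 𝔤}, G.σ z = z → Affine.sigma (Affine.gen G n z) = Affine.gen G n z :=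
    fun h => by rw [Affine.sigma_gen, h]
  classical
  induction s using Finset.induction_on with
  | empty =>
    rw [Finset.sum_empty, Finset.sum_empty, Affine.gen_zero, Affine.gen_zero]
    have h := totalObs_smul (P := P) hT hω 0 (X := (0 : Affine G)) 0 (map_zero _)
    rwa [smul_zero, smul_zero, zero_smul] at h
  | insert i s hi ih =>
    have h1 : G.σ (c i • y i) = c i • y i := by rw [map_smul, hy]
    have h2 : G.σ (∑ i ∈ s, c i • y i) = ∑ i ∈ s, c i • y i := by
      rw [map_sum]; exact Finset.sum_congr rfl fun i _ => by rw [map_smul, hy]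
    rw [Finset.sum_insert hi, Finset.sum_insert hi, Affine.gen_add, Affine.gen_add,
      totalObs_add hT hω (hσ h1) (hσ h2), ih, Affine.gen_smul, Affine.gen_smul]
    -- The coefficient in the second slot must be exhibited as a conjugate for `totalObs_smul` to
    -- apply; this is where reality of the coefficients enters.
    nth_rewrite 2 [← hc i]
    rw [totalObs_smul hT hω _ _ (hσ (hy i))]
    rfl

/-- The same coefficient `-i` serves both slots, since antilinearity of `embBar` turns it into the
`+i` of the definition at conjugate points. -/
theorem constraintK_eq :
    constraintK G P = totalObs P (-Complex.I • Affine.K G) (-Complex.I • Affine.K G) := by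
  unfold totalObs constraintK
  rw [Finset.smul_sum, Finset.smul_sum]
  congr 1
  · refine Finset.sum_congr rfl fun x _ => ?_
    rw [obs, obs, Takiff.single_smul,
      emb_smul hT hω _ (single_zero_mem_takiffRot x Affine.sigma_K)]
  · refine Finset.sum_congr rfl fun x _ => ?_
    split_ifs with hx
    · rw [obsBar, obsBar, Takiff.single_smul, embBar_smul hT hω hx _
        (single_zero_mem_takiffRot x Affine.sigma_K), map_neg, Complex.conj_I, neg_neg]
    · rw [smul_zero]

theorem momentum_eq :
    momentum G P = totalObs P (-Complex.I • Affine.D G) (-Complex.I • Affine.D G) := by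
  unfold totalObs momentum
  rw [Finset.smul_sum, Finset.smul_sum]
  congr 1
  · refine Finset.sum_congr rfl fun x _ => ?_
    rw [obs, obs, Takiff.single_smul,
      emb_smul hT hω _ (single_zero_mem_takiffRot x Affine.sigma_D)]
  · refine Finset.sum_congr rfl fun x _ => ?_
    split_ifs with hx
    · rw [obsBar, obsBar, Takiff.single_smul, embBar_smul hT hω hx _
        (single_zero_mem_takiffRot x Affine.sigma_D), map_neg, Complex.conj_I, neg_neg]
    · rw [smul_zero]

/-- On the pair `(y_n, y_{-n})` the pair `(-iD, -iD)` acts by `-in` and `in`. These scalars are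
conjugate, so `totalObs_smul` extracts the common factor. -/
theorem lieObs_momentum_constraintMode (n : ℤ) {y : 𝔤} (hy : G.σ y = y) :
    lieObs G P (momentum G P) (constraintMode G P n y) =
      (-Complex.I * n) • constraintMode G P n y := by
  have hσ : Affine.sigma (Affine.gen G n y) = Affine.gen G n y := by rw [Affine.sigma_gen, hy]
  rw [momentum_eq hT hω, constraintMode_eq, lieObs_totalObs hT hω
    (by rw [map_smul, Affine.sigma_D]) hσ, ← totalObs_smul hT hω _ _ hσ, smul_lie, smul_lie,
    Affine.D_lie_gen, Affine.D_lie_gen, smul_smul, smul_smul]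
  congr 2
  rw [map_mul, map_neg, Complex.conj_I, Int.cast_neg, map_intCast]
  ring

/-- The two slots have central terms `m ⟨I α, I β⟩ K` and `-m ⟨I α, I β⟩ K`. Written as multiples of
`-iK`, their coefficients are `i m ⟨I α, I β⟩` and its conjugate, the form being real on the fixed
algebra; so they combine to a multiple of `𝒦`. The structure constants are real for the same reason.
-/
theorem lieObs_constraintMode_constraintMode {ι : Type*} [Fintype ι] [DecidableEq ι]
    {I Id : Module.Basis ι ℝ (fixedReal G)}
    (hI : ∀ α β, G.form (I α : 𝔤) (Id β : 𝔤) = if α = β then 1 else 0) (m n : ℤ) (α β : ι) :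
    lieObs G P (constraintMode G P m (I α : 𝔤)) (constraintMode G P n (I β : 𝔤)) =
      ∑ γ, G.form ⁅(I α : 𝔤), (I β : 𝔤)⁆ (Id γ : 𝔤) • constraintMode G P (m + n) (I γ : 𝔤) +
        (if m + n = 0 then Complex.I * m * G.form (I α : 𝔤) (I β : 𝔤) else 0) •
          constraintK G P := by
  have hσ : ∀ (k : ℤ) {z : 𝔤}, G.σ z = z → Affine.sigma (Affine.gen G k z) = Affine.gen G k z :=
    fun k z h => by rw [Affine.sigma_gen, h]
  have hfix : G.σ ⁅(I α : 𝔤), (I β : 𝔤)⁆ = ⁅(I α : 𝔤), (I β : 𝔤)⁆ := by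
    rw [LieHom.map_lie, (I α).2.1, (I β).2.1]
  have hfix' : G.τ ⁅(I α : 𝔤), (I β : 𝔤)⁆ = ⁅(I α : 𝔤), (I β : 𝔤)⁆ := by
    rw [G.tau_lie, (I α).2.2, (I β).2.2]
  have hexp := fixed_expand (dual_symm hI) hfix
  have hsum := totalObs_gen_sum (P := P) hT hω Finset.univ
    (fun γ => G.form ⁅(I α : 𝔤), (I β : 𝔤)⁆ (Id γ : 𝔤)) (fun γ => (I γ : 𝔤)) (m + n)
    (fun γ => conj_form_of_fixed hfix' (Id γ).2.2) (fun γ => (I γ).2.1)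
  rw [← hexp] at hsum
  rw [constraintMode_eq, constraintMode_eq, lieObs_totalObs hT hω (hσ m (I α).2.1) (hσ n (I β).2.1),
    Affine.lie_gen_gen, Affine.lie_gen_gen, totalObs_add hT hω (hσ _ hfix)
      (by rw [map_smul, Affine.sigma_K]), ← neg_add, hsum, constraintK_eq hT hω,
    ← totalObs_smul hT hω _ _ (by rw [map_smul, Affine.sigma_K]), smul_smul, smul_smul]
  have hr := conj_form_of_fixed (G := G) (I α).2.2 (I β).2.2
  simp only [neg_eq_zero]
  congr 3
  · split_ifs
    · linear_combination (m : ℂ) * G.form (I α : 𝔤) (I β : 𝔤) * Complex.I_mul_I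
    · rw [zero_mul]
  · split_ifs
    · rw [map_mul, map_mul, hr, Complex.conj_I, map_intCast, Int.cast_neg]
      linear_combination (m : ℂ) * G.form (I α : 𝔤) (I β : 𝔤) * -Complex.I_mul_I
    · rw [map_zero, zero_mul]

theorem poisson_mem_constraintIdeal {ι : Type*} [Fintype ι] [DecidableEq ι]
    {I Id : Module.Basis ι ℝ (fixedReal G)}
    (hI : ∀ α β, G.form (I α : 𝔤) (Id β : 𝔤) = if α = β then 1 else 0) :
    ∀ f ∈ constraintIdeal (P := P) (fun α => (I α : 𝔤)),
      ∀ g ∈ constraintIdeal (P := P) (fun α => (I α : 𝔤)),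
        poisson (CplxObs G P) f g ∈ constraintIdeal (P := P) (fun α => (I α : 𝔤)) := by
  intro f hf g hg
  refine poisson_mem_span ?_ hf hg
  rintro a ha b hb
  rcases ha with rfl | ⟨⟨m, α⟩, rfl⟩
  · rcases hb with rfl | ⟨⟨n, β⟩, rfl⟩
    all_goals
      rw [poisson_ι_eq_lieObs, lieObs_constraintK hT hω, map_zero]
      exact zero_mem _
  · rcases hb with rfl | ⟨⟨n, β⟩, rfl⟩
    · rw [poisson_ι_eq_lieObs, lieObs_skew, lieObs_constraintK hT hω, neg_zero, map_zero]
      exact zero_mem _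
    · dsimp only
      rw [poisson_ι_eq_lieObs, lieObs_constraintMode_constraintMode hT hω hI, map_add, map_sum,
        map_smul]
      refine add_mem (sum_mem fun γ _ => ?_) ?_
      · rw [map_smul, Algebra.smul_def]
        exact Ideal.mul_mem_left _ _ (Ideal.subset_span (Or.inr ⟨(m + n, γ), rfl⟩))
      · rw [Algebra.smul_def]
        exact Ideal.mul_mem_left _ _ (Ideal.subset_span (Or.inl rfl))

end

end

section
open Divisor

/-! ### Residues at infinity -/

theorem expandInfty_C (c : ℂ) : expandInfty (RatFunc.C c) = HahnSeries.C c := by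
  rw [← RatFunc.algebraMap_C, expandInfty_algebraMap, invSubst, Polynomial.coe_eval₂RingHom,
    Polynomial.eval₂_C]

theorem expandInfty_X : expandInfty RatFunc.X = HahnSeries.single (-1 : ℤ) (1 : ℂ) := by
  rw [← RatFunc.algebraMap_X, expandInfty_algebraMap, invSubst, Polynomial.coe_eval₂RingHom,
    Polynomial.eval₂_X]

/-- With `w = z⁻¹` one has `(c w⁻¹ - a)⁻¹ = w (c - a w)⁻¹`, and the second factor is a power series
because `c ≠ 0`. -/
theorem expandInfty_inv_linear {c : ℂ} (hc : c ≠ 0) (a : ℂ) :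
    (expandInfty (RatFunc.C c * RatFunc.X - RatFunc.C a))⁻¹ =
      HahnSeries.ofPowerSeries ℤ ℂ
        (PowerSeries.X * (PowerSeries.C c - PowerSeries.C a * PowerSeries.X)⁻¹) := by
  refine inv_eq_of_mul_eq_one_left ?_
  have hX : HahnSeries.ofPowerSeries ℤ ℂ PowerSeries.X * HahnSeries.single (-1 : ℤ) (1 : ℂ) = 1 := by
    rw [HahnSeries.ofPowerSeries_X, HahnSeries.single_mul_single]
    simp
  have h1 : (PowerSeries.C c - PowerSeries.C a * PowerSeries.X : PowerSeries ℂ)⁻¹ *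
      (PowerSeries.C c - PowerSeries.C a * PowerSeries.X) = 1 :=
    PowerSeries.inv_mul_cancel _ (by simpa using hc)
  have h2 := congrArg (HahnSeries.ofPowerSeries ℤ ℂ) h1
  rw [map_one, map_mul, map_sub, map_mul, HahnSeries.ofPowerSeries_C,
    HahnSeries.ofPowerSeries_C] at h2
  rw [map_sub, map_mul expandInfty, expandInfty_C, expandInfty_C, expandInfty_X, map_mul]
  linear_combination HahnSeries.ofPowerSeries ℤ ℂ
    (PowerSeries.C c - PowerSeries.C a * PowerSeries.X)⁻¹ * HahnSeries.C c * hX + h2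

theorem resInfty_pole {c : ℂ} (hc : c ≠ 0) (a : ℂ) (p : ℕ) :
    resInfty (RatFunc.C c / (RatFunc.C c * RatFunc.X - RatFunc.C a) ^ (p + 1)) =
      if p = 0 then -1 else 0 := by
  change -(expandInfty _).coeff 1 = _
  rw [map_div₀, map_pow, div_eq_mul_inv, ← inv_pow, expandInfty_inv_linear hc, expandInfty_C,
    ← HahnSeries.ofPowerSeries_C, ← map_pow, ← map_mul]
  have h := HahnSeries.ofPowerSeries_apply_coeff (Γ := ℤ) (PowerSeries.C c * (PowerSeries.X *
    (PowerSeries.C c - PowerSeries.C a * PowerSeries.X)⁻¹) ^ (p + 1) : PowerSeries ℂ) 1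
  rw [Nat.cast_one] at h
  -- The expansion starts with `w ^ (p + 1)`, so the coefficient of `w` is nonzero only for `p = 0`,
  -- where it is the constant term `c * c⁻¹ = 1`.
  rw [h, mul_pow, mul_left_comm, PowerSeries.coeff_X_pow_mul']
  split_ifs with h1 h2 h2
  · subst h2
    simp [hc]
  · omega
  · omega
  · rw [neg_zero]

theorem resInfty_X_pow_inv (p : ℕ) :
    resInfty ((RatFunc.X : RatFunc ℂ) ^ (p + 1))⁻¹ = if p = 0 then -1 else 0 := by
  have h := resInfty_pole one_ne_zero 0 p
  rwa [map_one, map_zero, sub_zero, one_mul, one_div] at h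

theorem resInfty_X_pow (q : ℕ) : resInfty ((RatFunc.X : RatFunc ℂ) ^ q) = 0 := by
  change -(expandInfty _).coeff 1 = _
  rw [map_pow, expandInfty_X, HahnSeries.single_pow, HahnSeries.coeff_single_of_ne, neg_zero]
  simp
  omega

section
variable {M : Type*} [AddCommGroup M] [Module ℂ M]

variable (M) in
/-- The coefficient-wise residue at infinity. -/
def residue : RatFunc ℂ ⊗[ℂ] M →ₗ[ℂ] M :=
  (TensorProduct.lid ℂ M).toLinearMap ∘ₗ LinearMap.rTensor M resInfty

theorem residue_tmul (f : RatFunc ℂ) (F : M) : residue M (f ⊗ₜ[ℂ] F) = resInfty f • F := by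
  simp [residue]

theorem residue_sum_pole {n : ℕ} (hn : 1 ≤ n) {c : ℂ} (hc : c ≠ 0) (a : ℂ) (F : ℕ → M) :
    ∑ p ∈ Finset.range n, residue M
      ((RatFunc.C c / (RatFunc.C c * RatFunc.X - RatFunc.C a) ^ (p + 1)) ⊗ₜ[ℂ] F p) = -F 0 := by
  simp only [residue_tmul, resInfty_pole hc]
  rw [Finset.sum_eq_single 0]
  · simp
  · intro b _ hb; rw [if_neg hb, zero_smul]
  · intro h; exact absurd (Finset.mem_range.2 hn) h

theorem residue_sum_X_pow_inv {n : ℕ} (hn : 1 ≤ n) (F : ℕ → M) :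
    ∑ p ∈ Finset.range n, residue M (((RatFunc.X : RatFunc ℂ) ^ (p + 1))⁻¹ ⊗ₜ[ℂ] F p) = -F 0 := by
  simp only [residue_tmul, resInfty_X_pow_inv]
  rw [Finset.sum_eq_single 0]
  · simp
  · intro b _ hb; rw [if_neg hb, zero_smul]
  · intro h; exact absurd (Finset.mem_range.2 hn) h

-- The residue acts only on the rational factor, so the coefficients may lie in any module. Simple
-- poles contribute with residue `-1` at infinity wherever they are; higher poles and nonnegative
-- powers contribute nothing.
open Classical in
theorem residue_lax {ω : ℂ} (hω0 : ω ≠ 0) (T : ℕ) (P : Divisor ω)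
    (A B : ℕ → {a : ℂ // a ∈ P.z} → ℕ → M) (C : {a : ℂ // a ∈ P.z} → ℕ → M) (E : ℕ → M) :
    -residue M ((T : ℂ)⁻¹ • ∑ k ∈ Finset.range T, ∑ x : {a : ℂ // a ∈ P.z}, (if (x : ℂ) = 0 then 0 else
      ∑ p ∈ Finset.range (P.mult x),
        ((RatFunc.C (ω ^ k)⁻¹ / (RatFunc.C (ω ^ k)⁻¹ * RatFunc.X - RatFunc.C (x : ℂ)) ^ (p + 1))
            ⊗ₜ[ℂ] A k x p +
          if IsComplex (some x) then
            (RatFunc.C (ω ^ k)⁻¹ /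
                (RatFunc.C (ω ^ k)⁻¹ * RatFunc.X - RatFunc.C (conj (x : ℂ))) ^ (p + 1))
              ⊗ₜ[ℂ] B k x p
          else 0))
      + ∑ x : {a : ℂ // a ∈ P.z}, (if (x : ℂ) = 0 then
        ∑ p ∈ Finset.range (P.mult x), ((RatFunc.X : RatFunc ℂ) ^ (p + 1))⁻¹ ⊗ₜ[ℂ] C x p else 0)
      - ∑ q ∈ Finset.range (P.multInf - 1), ((RatFunc.X : RatFunc ℂ) ^ q) ⊗ₜ[ℂ] E q) =
    (T : ℂ)⁻¹ • ∑ k ∈ Finset.range T, ∑ x : {a : ℂ // a ∈ P.z}, (if (x : ℂ) = 0 then 0 else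
        (A k x 0 + if IsComplex (some x) then B k x 0 else 0))
      + ∑ x : {a : ℂ // a ∈ P.z}, (if (x : ℂ) = 0 then C x 0 else 0) := by
  have hk : ∀ k : ℕ, (ω ^ k)⁻¹ ≠ 0 := fun k => inv_ne_zero (pow_ne_zero k hω0)
  have hp : ∀ x : {a : ℂ // a ∈ P.z}, 1 ≤ P.mult x := fun x => P.mult_pos x x.2
  have h3 : ∑ q ∈ Finset.range (P.multInf - 1),
      residue M (((RatFunc.X : RatFunc ℂ) ^ q) ⊗ₜ[ℂ] E q) = 0 :=
    Finset.sum_eq_zero fun q _ => by rw [residue_tmul, resInfty_X_pow, zero_smul]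
  rw [map_sub, map_add, map_smul, map_sum, map_sum, map_sum]
  rw [h3, sub_zero, neg_eq_iff_eq_neg, neg_add, ← smul_neg, ← Finset.sum_neg_distrib,
    ← Finset.sum_neg_distrib]
  congr 1
  · congr 1
    refine Finset.sum_congr rfl fun k _ => ?_
    rw [map_sum, ← Finset.sum_neg_distrib]
    refine Finset.sum_congr rfl fun x _ => ?_
    split_ifs with hx hc
    · rw [map_zero, neg_zero]
    · simp only [map_sum, map_add]
      rw [Finset.sum_add_distrib, residue_sum_pole (hp x) (hk k), residue_sum_pole (hp x) (hk k),
        neg_add]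
    · simp only [map_sum, add_zero]
      rw [residue_sum_pole (hp x) (hk k)]
  · refine Finset.sum_congr rfl fun x _ => ?_
    split_ifs with hx
    · rw [map_sum, residue_sum_X_pow_inv (hp x)]
    · rw [map_zero, neg_zero]

end

variable {T : ℕ} {ω : ℂ} {𝔤 : Type*} [LieRing 𝔤] [LieAlgebra ℂ 𝔤] (G : DihedralData T ω 𝔤)
  (P : Divisor ω)

open Classical in
theorem formalConstraint_eq [FiniteDimensional ℂ 𝔤] (hω0 : ω ≠ 0) :
    formalConstraint G P =
      (T : ℂ)⁻¹ • ∑ k ∈ Finset.range T, ∑ x : {a : ℂ // a ∈ P.z}, (if (x : ℂ) = 0 then 0 else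
        (formalField (Affine.sigma ^ k) (obs G (some x) 0) +
          if IsComplex (some x) then
            formalField (fun X => (Affine.sigma ^ k) (Affine.tau X)) (obsBar G (some x) 0)
          else 0))
      + ∑ x : {a : ℂ // a ∈ P.z}, (if (x : ℂ) = 0 then
          formalField id (fun X => obs G (some x) 0 (Affine.eigenProj G (0 : ℕ) X)) else 0) := by
  exact residue_lax hω0 T P
    (fun k x p => formalField (Affine.sigma ^ k) (obs G (some x) p))
    (fun k x p => formalField (fun X => (Affine.sigma ^ k) (Affine.tau X)) (obsBar G (some x) p))
    (fun x p => formalField id (fun X => obs G (some x) p (Affine.eigenProj G p X)))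
    (fun q => formalField id (fun X => obs G none (q + 1) (Affine.eigenProj G (-(q : ℤ) - 1) X)))

end

section
open Divisor
variable {T : ℕ} {ω : ℂ} {𝔤 : Type*} [LieRing 𝔤] [LieAlgebra ℂ 𝔤] {G : DihedralData T ω 𝔤}
  {P : Divisor ω}

/-! ### The projection onto the fixed subalgebra -/

namespace Affine

theorem eigenProj_zero_apply (X : Affine G) :
    eigenProj G 0 X = (T : ℂ)⁻¹ • ∑ k ∈ Finset.range T, (sigma ^ k) X := by
  simp [eigenProj]

theorem sigma_eigenProj_zero (X : Affine G) : sigma (eigenProj G 0 X) = eigenProj G 0 X := by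
  rw [eigenProj_zero_apply, map_smul, map_sum]
  congr 1
  have h : ∀ k, sigma ((sigma ^ k) X) = (sigma ^ (k + 1)) X := fun k => by
    rw [pow_succ', Module.End.mul_apply]
  simp only [h]
  -- The sum over `k ≤ T` is split at its last and at its first term; these agree because `σ ^ T =
  -- 1`.
  have h1 := Finset.sum_range_succ (fun k => (sigma ^ k) X) T
  rw [Finset.sum_range_succ', sigma_pow_period, pow_zero, Module.End.one_apply] at h1
  exact add_right_cancel h1

theorem eigenProj_zero_of_fixed (hT : 0 < T) {X : Affine G} (hX : sigma X = X) :
    eigenProj G 0 X = X := by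
  have hT' : (T : ℂ) ≠ 0 := Nat.cast_ne_zero.2 hT.ne'
  rw [eigenProj_zero_apply]
  simp only [sigma_pow_eq_self hX, Finset.sum_const, Finset.card_range]
  rw [← Nat.cast_smul_eq_nsmul ℂ, smul_smul, inv_mul_cancel₀ hT', one_smul]

theorem eigenProj_zero_mem {F : Submodule ℂ (Affine G)} (hF : ∀ X ∈ F, ∀ k : ℕ, (sigma ^ k) X ∈ F)
    {X : Affine G} (hX : X ∈ F) : eigenProj G 0 X ∈ F := by
  rw [eigenProj_zero_apply]
  exact F.smul_mem _ (F.sum_mem fun k _ => hF X hX k)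

end Affine

variable (G) in
/-- The average over the powers of `σ`. -/
def fixedProj (z : 𝔤) : 𝔤 := (T : ℂ)⁻¹ • ∑ k ∈ Finset.range T, G.σ^[k] z

theorem sigma_pow_gen (k : ℕ) (n : ℤ) (z : 𝔤) :
    (Affine.sigma ^ k) (Affine.gen G n z) = Affine.gen G n (G.σ^[k] z) := by
  induction k with
  | zero => simp
  | succ k ih =>
    rw [pow_succ', Module.End.mul_apply, ih, Affine.sigma_gen, Function.iterate_succ_apply']

theorem eigenProj_gen (n : ℤ) (z : 𝔤) :
    Affine.eigenProj G 0 (Affine.gen G n z) = Affine.gen G n (fixedProj G z) := by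
  rw [Affine.eigenProj_zero_apply, fixedProj, ← Affine.genₗ_apply n (_ • _), map_smul, map_sum]
  simp only [sigma_pow_gen, Affine.genₗ_apply]

theorem sigma_fixedProj (z : 𝔤) : G.σ (fixedProj G z) = fixedProj G z := by
  have h := Affine.sigma_eigenProj_zero (Affine.gen G 0 z)
  rw [eigenProj_gen, Affine.sigma_gen] at h
  have h2 := congrArg (fun X : Affine G => X.loop 0) h
  simpa [Affine.gen] using h2

/-- Since `σ` is an isometry, each `σ ^ k z` has the same pairing with a `σ`-fixed vector as `z`. -/
theorem form_fixedProj (hT : 0 < T) {y : 𝔤} (hy : G.σ y = y) (z : 𝔤) :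
    G.form (fixedProj G z) y = G.form z y := by
  have hT' : (T : ℂ) ≠ 0 := Nat.cast_ne_zero.2 hT.ne'
  have h : ∀ k : ℕ, G.form (G.σ^[k] z) y = G.form z y := by
    intro k
    induction k with
    | zero => rfl
    | succ k ih =>
      rw [Function.iterate_succ_apply']
      conv_lhs => rw [← hy]
      rw [G.form_sigma, ih]
  rw [fixedProj, map_smul, map_sum, LinearMap.smul_apply, LinearMap.sum_apply]
  simp only [h, Finset.sum_const, Finset.card_range]
  rw [nsmul_eq_mul, smul_eq_mul, ← mul_assoc, inv_mul_cancel₀ hT', one_mul]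

theorem eigenProj_gen_expand (hT : 0 < T) {ι : Type*} [Fintype ι] [DecidableEq ι]
    {I Id : Module.Basis ι ℝ (fixedReal G)}
    (hI : ∀ α β, G.form (I α : 𝔤) (Id β : 𝔤) = if α = β then 1 else 0) (n : ℤ) (z : 𝔤) :
    Affine.eigenProj G 0 (Affine.gen G n z) =
      ∑ α, G.form z (I α : 𝔤) • Affine.gen G n (Id α : 𝔤) := by
  rw [eigenProj_gen, fixed_expand hI (sigma_fixedProj z), ← Affine.genₗ_apply, map_sum]
  refine Finset.sum_congr rfl fun α _ => ?_
  rw [map_smul, form_fixedProj hT (I α).2.1, Affine.genₗ_apply]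

section
variable [FiniteDimensional ℂ 𝔤]

theorem sum_form_dualBasis (y : 𝔤) :
    ∑ a, G.form (G.form.dualBasis G.form_nondeg (Module.finBasis ℂ 𝔤) a) y •
      Module.finBasis ℂ 𝔤 a = y := by
  conv_rhs => rw [← (Module.finBasis ℂ 𝔤).sum_repr y]
  refine Finset.sum_congr rfl fun a _ => ?_
  congr 1
  conv_lhs => rw [← (Module.finBasis ℂ 𝔤).sum_repr y]
  rw [map_sum]
  simp only [map_smul, LinearMap.BilinForm.apply_dualBasis_left, smul_eq_mul, mul_ite, mul_one,
    mul_zero, Finset.sum_ite_eq', Finset.mem_univ, if_true]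

theorem sum_form_basis (y : 𝔤) :
    ∑ a, G.form (Module.finBasis ℂ 𝔤 a) y •
      G.form.dualBasis G.form_nondeg (Module.finBasis ℂ 𝔤) a = y := by
  conv_rhs => rw [← (G.form.dualBasis G.form_nondeg (Module.finBasis ℂ 𝔤)).sum_repr y]
  refine Finset.sum_congr rfl fun a _ => ?_
  rw [LinearMap.BilinForm.dualBasis_repr_apply, G.form_symm]

/-! ### Modes of formal fields -/

/-- The truncation of the formal field `φ I_ã ⊗ ψ I^ã`. -/
def fieldSum (φ : Affine G → Affine G) (ψ : Affine G → CplxObs G P) (N : ℕ) :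
    Affine G ⊗[ℂ] CplxObs G P :=
  partialSum (φ (Affine.D G) ⊗ₜ[ℂ] ψ (Affine.K G) + φ (Affine.K G) ⊗ₜ[ℂ] ψ (Affine.D G))
    (fun n => ∑ a, φ (Affine.gen G (-n) (G.form.dualBasis G.form_nondeg (Module.finBasis ℂ 𝔤) a))
      ⊗ₜ[ℂ] ψ (Affine.gen G n (Module.finBasis ℂ 𝔤 a))) N

variable (G P) in
/-- The component of a formal field at level `N`. -/
def evalField (N : ℕ) : FieldSpace G P →ₗ[ℂ] (Affine G ⊗[ℂ] CplxObs G P) ⧸ filField G P N :=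
  (LinearMap.proj N) ∘ₗ (FieldSpace G P).subtype

/-- The hypothesis supplies the convergence condition of `formalSum`, which is zero by default
otherwise. -/
theorem evalField_formalField {φ : Affine G → Affine G} {ψ : Affine G → CplxObs G P}
    (h : ∀ (n : ℤ) x y, φ (Affine.gen G (-n) x) ⊗ₜ[ℂ] ψ (Affine.gen G n y) ∈
      filField G P n.natAbs) (N : ℕ) :
    evalField G P N (formalField φ ψ) = (filField G P N).mkQ (fieldSum φ ψ N) := by
  change (formalField φ ψ).1 N = _
  rw [formalField, formalSum, dif_pos fun n => Submodule.sum_mem _ fun a _ => h n _ _]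
  rfl

theorem fieldSum_comp (f : Affine G →ₗ[ℂ] Affine G) (φ : Affine G → Affine G)
    (ψ : Affine G → CplxObs G P) (N : ℕ) :
    fieldSum (fun X => f (φ X)) ψ N = LinearMap.rTensor (CplxObs G P) f (fieldSum φ ψ N) := by
  simp only [fieldSum, partialSum, map_add, map_sum, LinearMap.rTensor_tmul]

theorem fieldSum_average (φ : Affine G → Affine G) (ψ : Affine G → CplxObs G P) (N : ℕ) :
    (T : ℂ)⁻¹ • ∑ k ∈ Finset.range T, fieldSum (fun X => (Affine.sigma ^ k) (φ X)) ψ N =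
      fieldSum (fun X => Affine.eigenProj G 0 (φ X)) ψ N := by
  have h : Affine.eigenProj G 0 = (T : ℂ)⁻¹ • ∑ k ∈ Finset.range T, Affine.sigma ^ k :=
    LinearMap.ext fun X => by
      rw [Affine.eigenProj_zero_apply, LinearMap.smul_apply, LinearMap.sum_apply]
  have e : LinearMap.rTensor (CplxObs G P) (Affine.eigenProj G 0) =
      (T : ℂ)⁻¹ • ∑ k ∈ Finset.range T, LinearMap.rTensor (CplxObs G P) (Affine.sigma (G := G) ^ k) := by
    rw [h, LinearMap.rTensor_smul]
    congr 1
    exact map_sum (LinearMap.rTensorHom (CplxObs G P)) _ _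
  rw [fieldSum_comp, e, LinearMap.smul_apply, LinearMap.sum_apply]
  simp only [fieldSum_comp]

omit [FiniteDimensional ℂ 𝔤] in
theorem tmul_mem_filField_of_fil {n : ℕ} {X : Affine G} {v : CplxObs G P}
    (hX : X ∈ Affine.fil G n) (hv : conjObs G P v ∈ filObs G P n) : X ⊗ₜ[ℂ] v ∈ filField G P n :=
  Submodule.subset_span (Or.inl ⟨X, hX, _, hv, by rw [conjObs_conjObs]⟩)

omit [FiniteDimensional ℂ 𝔤] in
theorem tmul_mem_filField_of_filBar {n : ℕ} {X : Affine G} {v : CplxObs G P}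
    (hX : X ∈ Affine.filBar G n) (hv : v ∈ filObs G P n) : X ⊗ₜ[ℂ] v ∈ filField G P n :=
  Submodule.subset_span (Or.inr ⟨X, hX, _, hv, rfl⟩)

section
variable {ι : Type*} [Fintype ι] [DecidableEq ι] {I Id : Module.Basis ι ℝ (fixedReal G)}
  (hI : ∀ α β, G.form (I α : 𝔤) (Id β : 𝔤) = if α = β then 1 else 0) (hT : 0 < T)
include hI hT

/-- The projection of `I_a` has coordinates `⟨I_a, I α⟩` in the basis `Id`. Moving these scalars
across the tensor product and through `ψ` reassembles `I α` from the basis `I^a`. -/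
theorem fieldSum_eigenProj (ψ : Affine G →ₗ[ℂ] CplxObs G P) (N : ℕ) :
    fieldSum (fun X => Affine.eigenProj G 0 X) ψ N =
      partialSum (Affine.D G ⊗ₜ[ℂ] ψ (Affine.K G) + Affine.K G ⊗ₜ[ℂ] ψ (Affine.D G))
        (fun n => ∑ α, Affine.gen G (-n) (Id α : 𝔤) ⊗ₜ[ℂ] ψ (Affine.gen G n (I α : 𝔤))) N := by
  rw [fieldSum, Affine.eigenProj_zero_of_fixed hT Affine.sigma_D,
    Affine.eigenProj_zero_of_fixed hT Affine.sigma_K]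
  congr 1
  funext n
  simp only [eigenProj_gen_expand hT hI, TensorProduct.sum_tmul]
  rw [Finset.sum_comm]
  refine Finset.sum_congr rfl fun α _ => ?_
  have h := congrArg (fun y => ψ (Affine.genₗ G n y)) (sum_form_dualBasis (G := G) (I α : 𝔤))
  simp only [map_sum, map_smul, Affine.genₗ_apply] at h
  rw [← h, TensorProduct.tmul_sum]
  refine Finset.sum_congr rfl fun a _ => ?_
  rw [TensorProduct.smul_tmul]

/-- The coordinates of `τ I_a` are the conjugates of those of `I_a`, exactly what is needed to move
them through the antilinear `ψ`. The reversal of degree by `τ` puts degree `n` in both factors. -/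
theorem fieldSum_eigenProj_tau (ψ : Affine G →ₛₗ[starRingEnd ℂ] CplxObs G P) (N : ℕ) :
    fieldSum (fun X => Affine.eigenProj G 0 (Affine.tau X)) ψ N =
      partialSum (-(Affine.D G ⊗ₜ[ℂ] ψ (Affine.K G) + Affine.K G ⊗ₜ[ℂ] ψ (Affine.D G)))
        (fun n => ∑ α, Affine.gen G n (Id α : 𝔤) ⊗ₜ[ℂ] ψ (Affine.gen G n (I α : 𝔤))) N := by
  rw [fieldSum, Affine.tau_D, Affine.tau_K, map_neg, map_neg,
    Affine.eigenProj_zero_of_fixed hT Affine.sigma_D,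
    Affine.eigenProj_zero_of_fixed hT Affine.sigma_K, TensorProduct.neg_tmul,
    TensorProduct.neg_tmul, neg_add]
  congr 1
  funext n
  have hτ : ∀ (y : 𝔤) (α : ι), G.form (G.τ y) (I α : 𝔤) = conj (G.form y (I α : 𝔤)) := by
    intro y α
    conv_lhs => rw [← (I α).2.2]
    rw [G.form_tau]
  simp only [Affine.tau_gen, neg_neg, eigenProj_gen_expand hT hI, TensorProduct.sum_tmul, hτ]
  rw [Finset.sum_comm]
  refine Finset.sum_congr rfl fun α _ => ?_
  have h := congrArg (fun y => ψ (Affine.genₗ G n y)) (sum_form_dualBasis (G := G) (I α : 𝔤))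
  simp only [map_sum, map_smul, map_smulₛₗ, Affine.genₗ_apply] at h
  rw [← h, TensorProduct.tmul_sum]
  refine Finset.sum_congr rfl fun a _ => ?_
  rw [TensorProduct.smul_tmul]

/-- The case of the origin: the projection sits in the second factor, and the roles of the two dual
bases are exchanged. -/
theorem fieldSum_id (ψ : Affine G →ₗ[ℂ] CplxObs G P)
    (hψ : ∀ X, ψ (Affine.eigenProj G 0 X) = ψ X) (N : ℕ) :
    fieldSum id ψ N =
      partialSum (Affine.D G ⊗ₜ[ℂ] ψ (Affine.K G) + Affine.K G ⊗ₜ[ℂ] ψ (Affine.D G))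
        (fun n => ∑ α, Affine.gen G (-n) (Id α : 𝔤) ⊗ₜ[ℂ] ψ (Affine.gen G n (I α : 𝔤))) N := by
  rw [fieldSum]
  simp only [id_eq]
  congr 1
  funext n
  have h1 : ∀ y : 𝔤, ψ (Affine.gen G n y) =
      ∑ α, G.form y (Id α : 𝔤) • ψ (Affine.gen G n (I α : 𝔤)) := by
    intro y
    rw [← hψ, eigenProj_gen_expand hT (dual_symm hI), map_sum]
    simp only [map_smul]
  have h2 : ∀ a, ψ (Affine.gen G n (Module.finBasis ℂ 𝔤 a)) = _ := fun a => h1 _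
  simp only [h2, TensorProduct.tmul_sum]
  rw [Finset.sum_comm]
  refine Finset.sum_congr rfl fun α _ => ?_
  have h := congrArg (fun y => Affine.genₗ G (-n) y) (sum_form_basis (G := G) (Id α : 𝔤))
  simp only [map_sum, map_smul, Affine.genₗ_apply] at h
  conv_rhs => rw [← h, TensorProduct.sum_tmul]
  refine Finset.sum_congr rfl fun a _ => ?_
  rw [TensorProduct.smul_tmul]

end
end

/-! ### Contributions of the individual points to the formal constraint -/

open Classical in
theorem map_sum_by_points {M M' : Type*} [AddCommGroup M] [Module ℂ M] [AddCommGroup M']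
    [Module ℂ M'] (T : ℕ) (P : Divisor ω) (f : M →ₗ[ℂ] M') (A B : ℕ → {a : ℂ // a ∈ P.z} → M)
    (C : {a : ℂ // a ∈ P.z} → M) :
    f ((T : ℂ)⁻¹ • ∑ k ∈ Finset.range T, ∑ x : {a : ℂ // a ∈ P.z}, (if (x : ℂ) = 0 then 0 else
        (A k x + if IsComplex (some x) then B k x else 0))
      + ∑ x : {a : ℂ // a ∈ P.z}, (if (x : ℂ) = 0 then C x else 0)) =
    ∑ x : {a : ℂ // a ∈ P.z}, if (x : ℂ) = 0 then f (C x) else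
      ((T : ℂ)⁻¹ • ∑ k ∈ Finset.range T, f (A k x)) +
        if IsComplex (some x) then (T : ℂ)⁻¹ • ∑ k ∈ Finset.range T, f (B k x) else 0 := by
  rw [map_add, map_smul, map_sum, map_sum]
  simp only [map_sum]
  rw [Finset.sum_comm, Finset.smul_sum, ← Finset.sum_add_distrib]
  refine Finset.sum_congr rfl fun x _ => ?_
  by_cases hx : (x : ℂ) = 0
  · simp only [hx, if_true, map_zero, Finset.sum_const_zero, smul_zero, zero_add]
  · by_cases hc : IsComplex (some x : P.Pt)
    · simp only [hx, hc, if_true, if_false, map_zero, map_add, add_zero, Finset.sum_add_distrib,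
        smul_add]
    · simp only [hx, hc, if_false, map_zero, add_zero]

section
variable (hT : 0 < T) (hω : IsPrimitiveRoot ω T)
include hT hω

omit hT hω in
theorem obs_mem_filObs {a : {a : ℂ // a ∈ P.z}} {n : ℕ} {X : Affine G}
    (hX : Takiff.single (order (some a : P.Pt)) 0 X ∈ takiffRot G (some a : P.Pt))
    (h : X ∈ Affine.fil G n) : obs G (some a : P.Pt) 0 X ∈ filObs G P n :=
  emb_mem_filObs hX (Takiff.single_mem 0 h)

/-- Conjugation moves a complex point to its conjugate copy, whose filtration is defined with
`filBar`; at a real point it acts by a reflection, whose `τ` turns `filBar` into `fil`. -/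
theorem conjObs_obs_mem_filObs {a : {a : ℂ // a ∈ P.z}} {n : ℕ} {X : Affine G}
    (hX : Takiff.single (order (some a : P.Pt)) 0 X ∈ takiffRot G (some a : P.Pt))
    (h : X ∈ Affine.filBar G n) : conjObs G P (obs G (some a : P.Pt) 0 X) ∈ filObs G P n := by
  by_cases hc : IsComplex (some a : P.Pt)
  · rw [obs, conjObs_emb_of_isComplex hc]
    exact embBar_mem_filObs hc hX (Takiff.single_mem 0 h)
  · rw [obs, conjObs_emb_of_not_isComplex hT hω hc hX]
    refine emb_mem_filObs (refl_mem_takiffRot hT hω _ hX) fun p => ?_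
    rw [Takiff.refl_single, mul_zero, pow_zero, one_smul]
    exact Takiff.single_mem 0 (Affine.sigma_pow_mem_fil (Affine.tau_mem_fil h) _) p

/-- `X ↦ X^(x)_0` at a point `x ≠ 0`. -/
def obsLin {a : {a : ℂ // a ∈ P.z}} (ha : (a : ℂ) ≠ 0) : Affine G →ₗ[ℂ] CplxObs G P where
  toFun := obs G (some a : P.Pt) 0
  map_add' X Y := by
    have h := mem_takiffRot_of_ne_zero (G := G) hω ha
    rw [obs, Takiff.single_add, emb_add hT hω (h _) (h _)]
    rfl
  map_smul' c X := by
    have h := mem_takiffRot_of_ne_zero (G := G) hω ha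
    rw [obs, Takiff.single_smul, emb_smul hT hω _ (h _)]
    rfl

/-- `X ↦ X^(conj x)_0` at a complex point `x`. -/
def obsBarLin {a : {a : ℂ // a ∈ P.z}} (ha : IsComplex (some a : P.Pt)) :
    Affine G →ₛₗ[starRingEnd ℂ] CplxObs G P where
  toFun := obsBar G (some a : P.Pt) 0
  map_add' X Y := by
    have h := mem_takiffRot_of_ne_zero (G := G) hω (ne_zero_of_isComplex ha)
    rw [obsBar, Takiff.single_add, embBar_add hT hω ha (h _) (h _)]
    rfl
  map_smul' c X := by
    have h := mem_takiffRot_of_ne_zero (G := G) hω (ne_zero_of_isComplex ha)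
    rw [obsBar, Takiff.single_smul, embBar_smul hT hω ha _ (h _)]
    rfl

variable (G) in
/-- `X ↦ (π_(0) X)^(x)_0` -/
def obsProjLin (a : {a : ℂ // a ∈ P.z}) : Affine G →ₗ[ℂ] CplxObs G P where
  toFun X := obs G (some a : P.Pt) 0 (Affine.eigenProj G 0 X)
  map_add' X Y := by
    have h := fun X => single_zero_mem_takiffRot (G := G) a (Affine.sigma_eigenProj_zero X)
    rw [map_add, obs, Takiff.single_add, emb_add hT hω (h _) (h _)]
    rfl
  map_smul' c X := by
    have h := fun X => single_zero_mem_takiffRot (G := G) a (Affine.sigma_eigenProj_zero X)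
    rw [map_smul, obs, Takiff.single_smul, emb_smul hT hω _ (h _)]
    rfl

end

variable {ι : Type*} [Fintype ι]

/-- The contribution of a point to the modes of the formal constraint. -/
def localModes (I Id : ι → 𝔤) (x : P.Pt) (N : ℕ) : Affine G ⊗[ℂ] CplxObs G P :=
  partialSum (Affine.D G ⊗ₜ[ℂ] obs G x 0 (Affine.K G) + Affine.K G ⊗ₜ[ℂ] obs G x 0 (Affine.D G))
    (fun n => ∑ α, Affine.gen G (-n) (Id α) ⊗ₜ[ℂ] obs G x 0 (Affine.gen G n (I α))) N

/-- The contribution of the conjugate of a complex point to the modes of the formal constraint. -/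
def localModesBar (I Id : ι → 𝔤) (x : P.Pt) (N : ℕ) : Affine G ⊗[ℂ] CplxObs G P :=
  partialSum
    (-(Affine.D G ⊗ₜ[ℂ] obsBar G x 0 (Affine.K G) + Affine.K G ⊗ₜ[ℂ] obsBar G x 0 (Affine.D G)))
    (fun n => ∑ α, Affine.gen G n (Id α) ⊗ₜ[ℂ] obsBar G x 0 (Affine.gen G n (I α))) N

-- The factor `i` turns the coefficients `∓i` of `𝒦` and `𝒫` into `±1`, matching the sign in
-- `localModesBar` that comes from `τ K = -K` and `τ D = -D`.
open Classical in
theorem partialSum_constraint (I Id : ι → 𝔤) (N : ℕ) :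
    partialSum (Affine.D G ⊗ₜ[ℂ] (Complex.I • constraintK G P) +
        Affine.K G ⊗ₜ[ℂ] (Complex.I • momentum G P))
      (fun n => ∑ α, Affine.gen G (-n) (Id α) ⊗ₜ[ℂ] constraintMode G P n (I α)) N =
    ∑ x : {a : ℂ // a ∈ P.z}, (localModes I Id (some x) N +
      if IsComplex (some x : P.Pt) then localModesBar I Id (some x) N else 0) := by
  have hII : Complex.I * -Complex.I = 1 := by rw [mul_neg, Complex.I_mul_I, neg_neg]
  have hX : ∀ (X : Affine G) (u : CplxObs G P),
      u = -Complex.I • ∑ x : {a : ℂ // a ∈ P.z}, obs G (some x) 0 X +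
        Complex.I • ∑ x : {a : ℂ // a ∈ P.z},
          (if IsComplex (some x : P.Pt) then obsBar G (some x) 0 X else 0) →
      Complex.I • u = ∑ x : {a : ℂ // a ∈ P.z}, (obs G (some x) 0 X +
        -if IsComplex (some x : P.Pt) then obsBar G (some x) 0 X else 0) := by
    rintro X _ rfl
    rw [smul_add, smul_smul, smul_smul, hII, Complex.I_mul_I, one_smul, neg_one_smul,
      Finset.sum_add_distrib, Finset.sum_neg_distrib]
  have hM : ∀ n (y : 𝔤), constraintMode G P n y = ∑ x : {a : ℂ // a ∈ P.z},
      (obs G (some x) 0 (Affine.gen G n y) +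
        if IsComplex (some x : P.Pt) then obsBar G (some x) 0 (Affine.gen G (-n) y) else 0) :=
    fun n y => Finset.sum_add_distrib.symm
  rw [hX (Affine.K G) (constraintK G P) rfl, hX (Affine.D G) (momentum G P) rfl]
  simp only [hM, partialSum, TensorProduct.tmul_sum]
  rw [← Finset.sum_add_distrib]
  have hcomm : ∑ n ∈ Finset.Ioo (-(N : ℤ)) N, ∑ α, ∑ x : {a : ℂ // a ∈ P.z},
      Affine.gen G (-n) (Id α) ⊗ₜ[ℂ] (obs G (some x) 0 (Affine.gen G n (I α)) +
        if IsComplex (some x : P.Pt) then obsBar G (some x) 0 (Affine.gen G (-n) (I α)) else 0) =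
      ∑ x : {a : ℂ // a ∈ P.z}, ∑ n ∈ Finset.Ioo (-(N : ℤ)) N, ∑ α,
      Affine.gen G (-n) (Id α) ⊗ₜ[ℂ] (obs G (some x) 0 (Affine.gen G n (I α)) +
        if IsComplex (some x : P.Pt) then obsBar G (some x) 0 (Affine.gen G (-n) (I α)) else 0) := by
    conv_rhs => rw [Finset.sum_comm]
    exact Finset.sum_congr rfl fun n _ => Finset.sum_comm
  rw [hcomm, ← Finset.sum_add_distrib]
  refine Finset.sum_congr rfl fun x _ => ?_
  unfold localModes localModesBar partialSum
  split_ifs with hx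
  -- The substitution of `-n` for `n` preserves the symmetric truncation, so the conjugate
  -- contribution matches without an error term.
  · have hneg : ∑ n ∈ Finset.Ioo (-(N : ℤ)) N, ∑ α, Affine.gen G n (Id α) ⊗ₜ[ℂ]
        obsBar G (some x : P.Pt) 0 (Affine.gen G n (I α)) =
        ∑ n ∈ Finset.Ioo (-(N : ℤ)) N, ∑ α, Affine.gen G (-n) (Id α) ⊗ₜ[ℂ]
        obsBar G (some x : P.Pt) 0 (Affine.gen G (-n) (I α)) := by
      refine Finset.sum_nbij' (fun n => -n) (fun n => -n) ?_ ?_ ?_ ?_ ?_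
      · intro n hn; simp only [Finset.mem_Ioo] at *; omega
      · intro n hn; simp only [Finset.mem_Ioo] at *; omega
      · intro n _; exact neg_neg n
      · intro n _; exact neg_neg n
      · intro n _; simp only [neg_neg]
    rw [hneg]
    simp only [TensorProduct.tmul_add, TensorProduct.tmul_neg, Finset.sum_add_distrib, neg_add]
    abel
  · simp only [neg_zero, add_zero]

/-! ### The mode expansion of the formal constraint -/

section
variable (hT : 0 < T) (hω : IsPrimitiveRoot ω T) [FiniteDimensional ℂ 𝔤] [DecidableEq ι]
  {I Id : Module.Basis ι ℝ (fixedReal G)}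
  (hI : ∀ α β, G.form (I α : 𝔤) (Id β : 𝔤) = if α = β then 1 else 0)
include hT hω hI

theorem average_formalField_obs {a : {a : ℂ // a ∈ P.z}} (ha : (a : ℂ) ≠ 0) (N : ℕ) :
    (T : ℂ)⁻¹ • ∑ k ∈ Finset.range T,
        evalField G P N (formalField (Affine.sigma ^ k) (obs G (some a : P.Pt) 0)) =
      (filField G P N).mkQ
        (localModes (fun α => (I α : 𝔤)) (fun α => (Id α : 𝔤)) (some a) N) := by
  have hm := mem_takiffRot_of_ne_zero (G := G) hω ha
  have h : ∀ k : ℕ, evalField G P N (formalField (Affine.sigma ^ k) (obs G (some a : P.Pt) 0)) =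
      (filField G P N).mkQ (fieldSum (Affine.sigma ^ k) (obs G (some a : P.Pt) 0) N) := by
    intro k
    refine evalField_formalField (fun n x y => ?_) N
    -- The two factors have opposite degrees: for `n ≥ 0` the term is of type `filBar ⊗ filObs`, for
    -- `n ≤ 0` of type `fil ⊗ conj filObs`.
    rcases le_total 0 n with hn | hn
    · exact tmul_mem_filField_of_filBar
        (Affine.sigma_pow_mem_filBar (Affine.gen_mem_filBar (by omega) x) k)
        (obs_mem_filObs (hm _) (Affine.gen_mem_fil (by omega) y))
    · exact tmul_mem_filField_of_fil
        (Affine.sigma_pow_mem_fil (Affine.gen_mem_fil (by omega) x) k)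
        (conjObs_obs_mem_filObs hT hω (hm _) (Affine.gen_mem_filBar (by omega) y))
  simp only [h]
  rw [← map_sum, ← map_smul]
  exact congrArg _ ((fieldSum_average (fun X => X) _ N).trans
    (fieldSum_eigenProj hI hT (obsLin hT hω ha) N))

theorem average_formalField_obsBar {a : {a : ℂ // a ∈ P.z}} (ha : IsComplex (some a : P.Pt))
    (N : ℕ) :
    (T : ℂ)⁻¹ • ∑ k ∈ Finset.range T, evalField G P N (formalField
        (fun X => (Affine.sigma ^ k) (Affine.tau X)) (obsBar G (some a : P.Pt) 0)) =
      (filField G P N).mkQ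
        (localModesBar (fun α => (I α : 𝔤)) (fun α => (Id α : 𝔤)) (some a) N) := by
  have hm := mem_takiffRot_of_ne_zero (G := G) hω (ne_zero_of_isComplex ha)
  have h : ∀ k : ℕ, evalField G P N (formalField
        (fun X => (Affine.sigma ^ k) (Affine.tau X)) (obsBar G (some a : P.Pt) 0)) =
      (filField G P N).mkQ (fieldSum (fun X => (Affine.sigma ^ k) (Affine.tau X))
        (obsBar G (some a : P.Pt) 0) N) := by
    intro k
    refine evalField_formalField (fun n x y => ?_) N
    rw [Affine.tau_gen, neg_neg]
    -- After `τ` both factors have the same degree `n`; conjugating `embBar` yields `emb`, so the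
    -- two types of terms in `filField` occur for the opposite signs of `n`.
    rcases le_total 0 n with hn | hn
    · refine tmul_mem_filField_of_fil
        (Affine.sigma_pow_mem_fil (Affine.gen_mem_fil (by omega) _) k) ?_
      rw [obsBar, conjObs_embBar ha]
      exact obs_mem_filObs (hm _) (Affine.gen_mem_fil (by omega) y)
    · exact tmul_mem_filField_of_filBar
        (Affine.sigma_pow_mem_filBar (Affine.gen_mem_filBar (by omega) _) k)
        (embBar_mem_filObs ha (hm _) (Takiff.single_mem 0 (Affine.gen_mem_filBar (by omega) y)))
  simp only [h]
  rw [← map_sum, ← map_smul]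
  exact congrArg _ ((fieldSum_average Affine.tau _ N).trans
    (fieldSum_eigenProj_tau hI hT (obsBarLin hT hω ha) N))

theorem formalField_obsProj (a : {a : ℂ // a ∈ P.z}) (N : ℕ) :
    evalField G P N
      (formalField id (fun X => obs G (some a : P.Pt) 0 (Affine.eigenProj G (0 : ℕ) X))) =
      (filField G P N).mkQ
        (localModes (fun α => (I α : 𝔤)) (fun α => (Id α : 𝔤)) (some a) N) := by
  rw [Nat.cast_zero]
  have hm := fun X => single_zero_mem_takiffRot (G := G) a (Affine.sigma_eigenProj_zero X)
  have hfix : ∀ {X : Affine G}, Affine.sigma X = X →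
      obs G (some a : P.Pt) 0 (Affine.eigenProj G 0 X) = obs G (some a : P.Pt) 0 X :=
    fun h => by rw [Affine.eigenProj_zero_of_fixed hT h]
  rw [evalField_formalField]
  · refine congrArg _ ((fieldSum_id hI hT (obsProjLin G hT hω a) (fun X => ?_) N).trans ?_)
    · exact hfix (Affine.sigma_eigenProj_zero X)
    · change partialSum (Affine.D G ⊗ₜ[ℂ] obs G (some a : P.Pt) 0 (Affine.eigenProj G 0 (Affine.K G)) +
        Affine.K G ⊗ₜ[ℂ] obs G (some a : P.Pt) 0 (Affine.eigenProj G 0 (Affine.D G)))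
        (fun n => ∑ α, Affine.gen G (-n) (Id α : 𝔤) ⊗ₜ[ℂ]
          obs G (some a : P.Pt) 0 (Affine.eigenProj G 0 (Affine.gen G n (I α : 𝔤)))) N = _
      have hg : ∀ n α, Affine.eigenProj G 0 (Affine.gen G n (I α : 𝔤)) = Affine.gen G n (I α : 𝔤) :=
        fun n α => Affine.eigenProj_zero_of_fixed hT (by rw [Affine.sigma_gen, (I α).2.1])
      simp only [hg, hfix Affine.sigma_K, hfix Affine.sigma_D]
      rfl
  · intro n x y
    rcases le_total 0 n with hn | hn
    · exact tmul_mem_filField_of_filBar (Affine.gen_mem_filBar (by omega) x)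
        (obs_mem_filObs (hm _) (Affine.eigenProj_zero_mem
          (fun X hX k => Affine.sigma_pow_mem_fil hX k) (Affine.gen_mem_fil (by omega) y)))
    · exact tmul_mem_filField_of_fil (Affine.gen_mem_fil (by omega) x)
        (conjObs_obs_mem_filObs hT hω (hm _) (Affine.eigenProj_zero_mem
          (fun X hX k => Affine.sigma_pow_mem_filBar hX k) (Affine.gen_mem_filBar (by omega) y)))

theorem formalConstraint_modes (N : ℕ) : (formalConstraint G P).1 N =
      (filField G P N).mkQ (partialSum
        (Affine.D G ⊗ₜ[ℂ] (Complex.I • constraintK G P) +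
          Affine.K G ⊗ₜ[ℂ] (Complex.I • momentum G P))
        (fun n => ∑ α, Affine.gen G (-n) (Id α : 𝔤) ⊗ₜ[ℂ] constraintMode G P n (I α)) N) := by
  classical
  rw [partialSum_constraint (fun α => (I α : 𝔤)) (fun α => (Id α : 𝔤)),
    formalConstraint_eq G P (hω.ne_zero hT.ne')]
  refine (map_sum_by_points T P (evalField G P N)
    (fun k x => formalField (Affine.sigma ^ k) (obs G (some x) 0))
    (fun k x => formalField (fun X => (Affine.sigma ^ k) (Affine.tau X)) (obsBar G (some x) 0))
    (fun x => formalField id (fun X => obs G (some x) 0 (Affine.eigenProj G (0 : ℕ) X)))).trans ?_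
  rw [map_sum]
  refine Finset.sum_congr rfl fun x _ => ?_
  by_cases hx : (x : ℂ) = 0
  -- The origin lies on every mirror, so it has no conjugate contribution.
  · have hc : ¬ IsComplex (some x : P.Pt) := fun h => ne_zero_of_isComplex h hx
    rw [if_pos hx, if_neg hc, add_zero]
    exact formalField_obsProj hT hω hI x N
  · rw [if_neg hx, map_add]
    refine congrArg₂ (· + ·) (average_formalField_obs hT hω hI hx N) ?_
    split_ifs with hc
    · exact average_formalField_obsBar hT hω hI hc N
    · exact (map_zero _).symm

end
-- Linearity of the generators of the completion
theorem genComp_smul (c : ℂ) (v : CplxObs G P) : genComp (c • v) = c • genComp v :=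
  map_smul ((toComp G P).toLinearMap ∘ₗ SymmetricAlgebra.ι ℂ (CplxObs G P)) c v

theorem genComp_add (u v : CplxObs G P) : genComp (u + v) = genComp u + genComp v :=
  map_add ((toComp G P).toLinearMap ∘ₗ SymmetricAlgebra.ι ℂ (CplxObs G P)) u v

theorem genComp_sum {κ : Type*} (s : Finset κ) (v : κ → CplxObs G P) :
    genComp (∑ i ∈ s, v i) = ∑ i ∈ s, genComp (v i) :=
  map_sum ((toComp G P).toLinearMap ∘ₗ SymmetricAlgebra.ι ℂ (CplxObs G P)) v s

end

end AffineGaudin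

end

theorem mainTheorem10 {T : ℕ} (hT : 0 < T) {ω : ℂ} (hω : IsPrimitiveRoot ω T)
    {𝔤 : Type*} [LieRing 𝔤] [LieAlgebra ℂ 𝔤] [FiniteDimensional ℂ 𝔤]
    (G : AffineGaudin.DihedralData T ω 𝔤) (P : AffineGaudin.Divisor ω)
    {ι : Type*} [Fintype ι] [DecidableEq ι]
    (I Id : Module.Basis ι ℝ (AffineGaudin.fixedReal G))
    (hI : ∀ α β, G.form (I α : 𝔤) (Id β : 𝔤) = if α = β then 1 else 0) :
    -- the Poisson bracket extends by continuity to the completion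
    (∀ a b : AffineGaudin.CompObs G P,
      AffineGaudin.IsBracket a b (AffineGaudin.bracketComp a b)) ∧
    -- the mode expansion of the formal constraint
    (∀ N : ℕ, (AffineGaudin.formalConstraint G P).1 N =
      (AffineGaudin.filField G P N).mkQ (AffineGaudin.partialSum
        (AffineGaudin.Affine.D G ⊗ₜ[ℂ] (Complex.I • AffineGaudin.constraintK G P) +
          AffineGaudin.Affine.K G ⊗ₜ[ℂ] (Complex.I • AffineGaudin.momentum G P))
        (fun n => ∑ α, AffineGaudin.Affine.gen G (-n) (Id α : 𝔤) ⊗ₜ[ℂ]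
          AffineGaudin.constraintMode G P n (I α)) N)) ∧
    -- the affine bracket relations
    (∀ a : AffineGaudin.CompObs G P,
      AffineGaudin.bracketComp (AffineGaudin.genComp (AffineGaudin.constraintK G P)) a = 0) ∧
    (∀ (n : ℤ) (α : ι),
      AffineGaudin.bracketComp (AffineGaudin.genComp (AffineGaudin.momentum G P))
          (AffineGaudin.genComp (AffineGaudin.constraintMode G P n (I α))) =
        (-Complex.I * n) • AffineGaudin.genComp (AffineGaudin.constraintMode G P n (I α))) ∧
    (∀ (m n : ℤ) (α β : ι),
      AffineGaudin.bracketComp (AffineGaudin.genComp (AffineGaudin.constraintMode G P m (I α)))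
          (AffineGaudin.genComp (AffineGaudin.constraintMode G P n (I β))) =
        ∑ γ, G.form ⁅(I α : 𝔤), (I β : 𝔤)⁆ (Id γ : 𝔤) •
            AffineGaudin.genComp (AffineGaudin.constraintMode G P (m + n) (I γ)) +
          (if m + n = 0 then Complex.I * m * G.form (I α : 𝔤) (I β : 𝔤) else 0) •
            AffineGaudin.genComp (AffineGaudin.constraintK G P)) ∧
    -- the ideal is closed under the bracket
    (∀ a ∈ AffineGaudin.constraintIdealComp G P (fun α => (I α : 𝔤)),
      ∀ b ∈ AffineGaudin.constraintIdealComp G P (fun α => (I α : 𝔤)),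
        AffineGaudin.bracketComp a b ∈
          AffineGaudin.constraintIdealComp G P (fun α => (I α : 𝔤))) := by
  have hmem : ∀ α, G.σ (I α : 𝔤) = I α := fun α => (I α).2.1
  refine ⟨AffineGaudin.isBracket_bracketComp hT hω,
    AffineGaudin.formalConstraint_modes hT hω hI,
    AffineGaudin.bracketComp_genComp_of_central hT hω (AffineGaudin.lieObs_constraintK hT hω),
    fun n α => ?_, fun m n α β => ?_, fun a ha b hb => ?_⟩
  · rw [AffineGaudin.bracketComp_genComp hT hω,
      AffineGaudin.lieObs_momentum_constraintMode hT hω n (hmem α), AffineGaudin.genComp_smul]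
  · rw [AffineGaudin.bracketComp_genComp hT hω,
      AffineGaudin.lieObs_constraintMode_constraintMode hT hω hI, AffineGaudin.genComp_add,
      AffineGaudin.genComp_sum, AffineGaudin.genComp_smul]
    simp only [AffineGaudin.genComp_smul]
  · exact AffineGaudin.bracketComp_mem_idealComp hT hω
      (AffineGaudin.poisson_mem_constraintIdeal hT hω hI) ha hb
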